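/- Let $0<q<1$ be real and $[a,b]_q:=ab-q^{-1}ba$. **Setting.** Let $\mathcal U=\mathcal U_q(\mathfrak{su}(3))$ be the complex Hopf algebra with generators $K_i^{\pm1},E_i,F_i$ ($i=1,2$) and relations $K_iK_i^{-1}=K_i^{-1}K_i=1$, $[K_i,K_j]=0$, $[E_i,F_i]=\frac{K_i^2-K_i^{-2}}{q-q^{-1}}$, $K_iE_iK_i^{-1}=qE_i$, $K_i^{-1}F_iK_i=qF_i$, and, for $i\ne j$, $[E_i,F_j]=0$, $K_iE_jK_i^{-1}=q^{-1/2}E_j$, $K_i^{-1}F_jK_i=q^{-1/2}F_j$, $E_i^2E_j-(q+q^{-1})E_iE_jE_i+E_jE_i^2=0$, $F_jF_i^2-(q+q^{-1})F_iF_jF_i+F_i^2F_j=0$; with $\Delta(K_i)=K_i\otimes K_i$, $\Delta(E_i)=E_i\otimes K_i+K_i^{-1}\otimes E_i$, $\Delta(F_i)=F_i\otimes K_i+K_i^{-1}\otimes F_i$, $\epsilon(K_i)=1$, $\epsilon(E_i)=\epsilon(F_i)=0$, $S(K_i)=K_i^{-1}$, $S(E_i)=-qE_i$, $S(F_i)=-q^{-1}F_i$.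 Let $\mathcal U_q(\mathfrak u(2))\subset\mathcal U$ be the Hopf subalgebra generated by $K_1^{\pm1},E_1,F_1,(K_1K_2^2)^{\pm1}$. Let $\mathcal A=\mathcal A(\mathrm{SU}_q(3))$ be the complex $*$-algebra generated by $u^i_j$ ($i,j=1,2,3$) with relations $u^i_ku^j_k=qu^j_ku^i_k$, $u^k_iu^k_j=qu^k_ju^k_i$ for $i<j$; $[u^i_l,u^j_k]=0$, $[u^i_k,u^j_l]=(q-q^{-1})u^i_lu^j_k$ for $i<j$, $k<l$; $\sum_{\pi\in S_3}(-q)^{\|\pi\|}u^1_{\pi(1)}u^2_{\pi(2)}u^3_{\pi(3)}=1$, where $\|\pi\|$ is the length of $\pi$; and $(u^i_j)^*=(-q)^{j-i}(u^{k_1}_{l_1}u^{k_2}_{l_2}-qu^{k_1}_{l_2}u^{k_2}_{l_1})$, where $\{k_1<k_2\}$ and $\{l_1<l_2\}$ are the complements of $\{i\}$ and $\{j\}$ in $\{1,2,3\}$. Its coproduct is $\Delta(u^i_j)=\sum_ku^i_k\otimes u^k_j$. The dual pairing $\langle\cdot,\cdot\rangle:\mathcal U\times\mathcal A\to\mathbb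 C$ is the one with $\langle h,ab\rangle=\langle h_{(1)},a\rangle\langle h_{(2)},b\rangle$, $\langle h,1\rangle=\epsilon(h)$ and $\langle h,u^i_j\rangle=\rho(h)_{ij}$, where $\rho:\mathcal U\to M_3(\mathbb C)$ is the representation with $\rho(K_i)$ diagonal with entries $q^{-1/2}$ in position $i$, $q^{1/2}$ in position $i+1$ and $1$ in the remaining one, $\rho(E_i)$ the matrix unit in position $(i+1,i)$ and $\rho(F_i)$ the matrix unit in position $(i,i+1)$. Put $a\triangleleft h:=\langle h,a_{(1)}\rangle a_{(2)}$ and $\mathcal L_ha:=a\triangleleft S^{-1}(h)$, and $$\mathcal A(\mathbb CP^2_q):=\{a\in\mathcal A \mid a\triangleleft h=\epsilon(h)a\ \ \forall h\in\mathcal U_q(\mathfrak u(2))\}.$$ For a representation $\sigma:\mathcal U_q(\mathfrak u(2))\to M_n(\mathbb C)$ let $$\mathfrak M(\sigma):=\{v\in\mathcal A^n \mid \sigma(S(h_{(1)}))(v\triangleleft h_{(2)})=\epsilon(h)v\ \ \forall h\in\mathcal U_q(\mathfrak u(2))\}.$$ For $N=\pm\frac32$ let $\sigma_{\frac12,N}$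 be the representation on $\mathbb C^2$ with $$\sigma_{\frac12,N}(K_1)=\begin{pmatrix}q^{1/2}&0\\0&q^{-1/2}\end{pmatrix},\quad\sigma_{\frac12,N}(E_1)=\begin{pmatrix}0&1\\0&0\end{pmatrix},\quad\sigma_{\frac12,N}(F_1)=\begin{pmatrix}0&0\\1&0\end{pmatrix},\quad\sigma_{\frac12,N}(K_1K_2^2)=q^N\,\mathrm{id}.$$ Put $\sigma^{1,0}:=\sigma_{\frac12,-\frac32}$, $\sigma^{0,1}:=\sigma_{\frac12,\frac32}$, $\Omega^{1,0}:=\mathfrak M(\sigma^{1,0})$, $\Omega^{0,1}:=\mathfrak M(\sigma^{0,1})$ and $\Omega^1:=\Omega^{1,0}\oplus\Omega^{0,1}$; $\mathcal A(\mathbb CP^2_q)$ acts on these by componentwise left and right multiplication. The involution of one-forms is $(v,w)^*:=(-J(w),J(v))$ for $v\in\Omega^{1,0}$, $w\in\Omega^{0,1}$, where $J(x_1,x_2)^t:=(-q^{-1/2}x_2^*,\,q^{1/2}x_1^*)^t$. **Proposition.** Let $$X=(X_1,X_2)^t:=(q^{-1}K_2E_2,\,-K_1K_2[E_1,E_2]_q)^t,\qquad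 Y=(Y_1,Y_2)^t:=(K_1K_2[F_2,F_1]_q,\,K_2F_2)^t,$$ and, with $x\stackrel{\mathrm{ad}}{\triangleleft}h:=S(h_{(1)})\,x\,h_{(2)}$ and $e^1,e^2$ the standard basis of $\mathbb C^2$, define for $a\in\mathcal A(\mathbb CP^2_q)$ $$\partial a:=q^{-1/2}(\mathcal L_{X_1}a,\mathcal L_{X_2}a)^t,\qquad\bar\partial a:=(\mathcal L_{Y_1}a,\mathcal L_{Y_2}a)^t,\qquad \mathrm da:=(\partial a,\bar\partial a).$$ Then: 1. $X$ and $Y$ are invariant: for all $h\in\mathcal U_q(\mathfrak u(2))$, $\sum_k X_k\stackrel{\mathrm{ad}}{\triangleleft}S^{-1}(h_{(1)})\otimes\sigma^{1,0}(h_{(2)})e^k=\epsilon(h)\sum_kX_k\otimes e^k$ and $\sum_k Y_k\stackrel{\mathrm{ad}}{\triangleleft}S^{-1}(h_{(1)})\otimes\sigma^{0,1}(h_{(2)})e^k=\epsilon(h)\sum_kY_k\otimes e^k$. 2. $\partial$ and $\bar\partial$ are derivations from $\mathcal A(\mathbb CP^2_q)$ to $\Omega^{1,0}$ and to $\Omega^{0,1}$: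 they take values there, and $\partial(ab)=(\partial a)b+a\,\partial b$ and $\bar\partial(ab)=(\bar\partial a)b+a\,\bar\partial b$ for all $a,b\in\mathcal A(\mathbb CP^2_q)$. 3. $\mathcal A(\mathbb CP^2_q)\,\mathrm d\mathcal A(\mathbb CP^2_q)=\Omega^1$, i.e. $\Omega^1$ is the linear span of the elements $a\,\mathrm db$ with $a,b\in\mathcal A(\mathbb CP^2_q)$. 4. For all $a\in\mathcal A(\mathbb CP^2_q)$ one has $a^*\in\mathcal A(\mathbb CP^2_q)$ and $\mathrm d(a^*)=-(\mathrm da)^*$. -/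

import Mathlib

open scoped TensorProduct

noncomputable section

namespace QuantumCP2

/-! ### The deformation parameter -/

/-- The deformation parameter is a real number `0 < q < 1`. -/
abbrev Param := Set.Ioo (0 : ℝ) 1

/-- `q` as a complex number. -/
def qc (q : Param) : ℂ := ((q : ℝ) : ℂ)

/-- `q ^ (1/2)`, the positive square root of `q`, as a complex number. -/
def qh (q : Param) : ℂ := ((Real.sqrt (q : ℝ) : ℝ) : ℂ)

lemma qc_eq (q : Param) : qc q = qh q * qh q := by
  have h : (0 : ℝ) ≤ q := q.2.1.le
  rw [qc, qh, ← Complex.ofReal_mul, Real.mul_self_sqrt h]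

lemma qc_ne (q : Param) : qc q ≠ 0 := by
  have h : (q : ℝ) ≠ 0 := q.2.1.ne'
  simpa [qc] using h

lemma qh_ne (q : Param) : qh q ≠ 0 := by
  intro h
  exact qc_ne q (by rw [qc_eq, h, mul_zero])

lemma qc_sub_ne (q : Param) : qc q - (qc q)⁻¹ ≠ 0 := by
  have h0 : (0 : ℝ) < q := q.2.1
  have h1 : (q : ℝ) < 1 := q.2.2
  have h2 : (q : ℝ) - (q : ℝ)⁻¹ < 0 := by
    have : 1 < (q : ℝ)⁻¹ := (one_lt_inv₀ h0).2 h1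
    linarith
  have h3 : qc q - (qc q)⁻¹ = (((q : ℝ) - (q : ℝ)⁻¹ : ℝ) : ℂ) := by
    simp [qc]
  rw [h3]
  exact_mod_cast h2.ne

lemma conj_qc (q : Param) : (starRingEnd ℂ) (qc q) = qc q := by simp [qc]

lemma conj_qh (q : Param) : (starRingEnd ℂ) (qh q) = qh q := by simp [qh]

/-! ### The quantized enveloping algebra `U_q(su(3))` -/

/-- Names of the generators `K_i, K_i⁻¹, E_i, F_i`; the index `i = 1, 2` is `0, 1 : Fin 2`. -/
inductive UGen
  | K (i : Fin 2)
  | Kinv (i : Fin 2)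
  | E (i : Fin 2)
  | F (i : Fin 2)

/-- The defining relations, for elements `k i, l i, e i, f i` of an arbitrary algebra in the role of
`K_i, K_i⁻¹, E_i, F_i`. The relations between the `f i` are the adjoints of those between
the `e i`. -/
structure IsURep (q : Param) {B : Type*} [Ring B] [Algebra ℂ B] (k l e f : Fin 2 → B) : Prop where
  kl : ∀ i, k i * l i = 1
  lk : ∀ i, l i * k i = 1
  kk : ∀ i j, k i * k j = k j * k i
  ef : ∀ i, e i * f i - f i * e i = (qc q - (qc q)⁻¹)⁻¹ • (k i ^ 2 - l i ^ 2)
  ef_ne : ∀ i j, i ≠ j → e i * f j = f j * e i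
  ke : ∀ i, k i * e i * l i = qc q • e i
  ke_ne : ∀ i j, i ≠ j → k i * e j * l i = (qh q)⁻¹ • e j
  kf : ∀ i, l i * f i * k i = qc q • f i
  kf_ne : ∀ i j, i ≠ j → l i * f j * k i = (qh q)⁻¹ • f j
  serre_e : ∀ i j, i ≠ j →
    e i ^ 2 * e j - (qc q + (qc q)⁻¹) • (e i * e j * e i) + e j * e i ^ 2 = 0
  serre_f : ∀ i j, i ≠ j →
    f j * f i ^ 2 - (qc q + (qc q)⁻¹) • (f i * f j * f i) + f i ^ 2 * f j = 0

section
open FreeAlgebra UGen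

/-- The defining relations of `U_q(su(3))`, in the free algebra on the generators. -/
inductive URel (q : Param) : FreeAlgebra ℂ UGen → FreeAlgebra ℂ UGen → Prop
  | kl (i : Fin 2) : URel q (ι ℂ (K i) * ι ℂ (Kinv i)) 1
  | lk (i : Fin 2) : URel q (ι ℂ (Kinv i) * ι ℂ (K i)) 1
  | kk (i j : Fin 2) : URel q (ι ℂ (K i) * ι ℂ (K j)) (ι ℂ (K j) * ι ℂ (K i))
  | ef (i : Fin 2) : URel q (ι ℂ (E i) * ι ℂ (F i) - ι ℂ (F i) * ι ℂ (E i))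
      ((qc q - (qc q)⁻¹)⁻¹ • (ι ℂ (K i) ^ 2 - ι ℂ (Kinv i) ^ 2))
  | ef_ne (i j : Fin 2) : i ≠ j → URel q (ι ℂ (E i) * ι ℂ (F j)) (ι ℂ (F j) * ι ℂ (E i))
  | ke (i : Fin 2) : URel q (ι ℂ (K i) * ι ℂ (E i) * ι ℂ (Kinv i)) (qc q • ι ℂ (E i))
  | ke_ne (i j : Fin 2) : i ≠ j →
      URel q (ι ℂ (K i) * ι ℂ (E j) * ι ℂ (Kinv i)) ((qh q)⁻¹ • ι ℂ (E j))
  | kf (i : Fin 2) : URel q (ι ℂ (Kinv i) * ι ℂ (F i) * ι ℂ (K i)) (qc q • ι ℂ (F i))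
  | kf_ne (i j : Fin 2) : i ≠ j →
      URel q (ι ℂ (Kinv i) * ι ℂ (F j) * ι ℂ (K i)) ((qh q)⁻¹ • ι ℂ (F j))
  | serre_e (i j : Fin 2) : i ≠ j →
      URel q (ι ℂ (E i) ^ 2 * ι ℂ (E j)
        - (qc q + (qc q)⁻¹) • (ι ℂ (E i) * ι ℂ (E j) * ι ℂ (E i)) + ι ℂ (E j) * ι ℂ (E i) ^ 2) 0
  | serre_f (i j : Fin 2) : i ≠ j →
      URel q (ι ℂ (F j) * ι ℂ (F i) ^ 2
        - (qc q + (qc q)⁻¹) • (ι ℂ (F i) * ι ℂ (F j) * ι ℂ (F i)) + ι ℂ (F i) ^ 2 * ι ℂ (F j)) 0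

end

/-- The algebra `U_q(su(3))`. -/
def U (q : Param) : Type := RingQuot (URel q)

instance (q : Param) : Ring (U q) := inferInstanceAs (Ring (RingQuot (URel q)))
instance (q : Param) : Algebra ℂ (U q) := inferInstanceAs (Algebra ℂ (RingQuot (URel q)))

/-- The quotient map from the free algebra. -/
def Umk (q : Param) : FreeAlgebra ℂ UGen →ₐ[ℂ] U q := RingQuot.mkAlgHom ℂ (URel q)

/-- The class of a generator. -/
def Ugen (q : Param) (x : UGen) : U q := Umk q (FreeAlgebra.ι ℂ x)

/-- The generator `K_i`. -/
def K (q : Param) (i : Fin 2) : U q := Ugen q (.K i)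
/-- The generator `K_i⁻¹`. -/
def Kinv (q : Param) (i : Fin 2) : U q := Ugen q (.Kinv i)
/-- The generator `E_i`. -/
def E (q : Param) (i : Fin 2) : U q := Ugen q (.E i)
/-- The generator `F_i`. -/
def F (q : Param) (i : Fin 2) : U q := Ugen q (.F i)

lemma isURep_U (q : Param) : IsURep q (K q) (Kinv q) (E q) (F q) := by
  have key : ∀ {x y}, URel q x y → Umk q x = Umk q y := fun h => RingQuot.mkAlgHom_rel ℂ h
  constructor
  · intro i; simpa [K, Kinv, E, F, Ugen] using key (.kl i)
  · intro i; simpa [K, Kinv, E, F, Ugen] using key (.lk i)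
  · intro i j; simpa [K, Kinv, E, F, Ugen] using key (.kk i j)
  · intro i; simpa [K, Kinv, E, F, Ugen] using key (.ef i)
  · intro i j h; simpa [K, Kinv, E, F, Ugen] using key (.ef_ne i j h)
  · intro i; simpa [K, Kinv, E, F, Ugen] using key (.ke i)
  · intro i j h; simpa [K, Kinv, E, F, Ugen] using key (.ke_ne i j h)
  · intro i; simpa [K, Kinv, E, F, Ugen] using key (.kf i)
  · intro i j h; simpa [K, Kinv, E, F, Ugen] using key (.kf_ne i j h)
  · intro i j h; simpa [K, Kinv, E, F, Ugen] using key (.serre_e i j h)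
  · intro i j h; simpa [K, Kinv, E, F, Ugen] using key (.serre_f i j h)

section
variable {q : Param} {B : Type*} [Ring B] [Algebra ℂ B] {k l e f : Fin 2 → B}

/-- The images of the generators. -/
def UgenMap (k l e f : Fin 2 → B) : UGen → B
  | .K i => k i
  | .Kinv i => l i
  | .E i => e i
  | .F i => f i

/-- The universal property of `U_q(su(3))`. -/
def Ulift (h : IsURep q k l e f) : U q →ₐ[ℂ] B :=
  RingQuot.liftAlgHom ℂ ⟨FreeAlgebra.lift ℂ (UgenMap k l e f), by
    intro x y r
    cases r with
    | kl i => simpa [UgenMap] using h.kl i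
    | lk i => simpa [UgenMap] using h.lk i
    | kk i j => simpa [UgenMap] using h.kk i j
    | ef i => simpa [UgenMap] using h.ef i
    | ef_ne i j hij => simpa [UgenMap] using h.ef_ne i j hij
    | ke i => simpa [UgenMap] using h.ke i
    | ke_ne i j hij => simpa [UgenMap] using h.ke_ne i j hij
    | kf i => simpa [UgenMap] using h.kf i
    | kf_ne i j hij => simpa [UgenMap] using h.kf_ne i j hij
    | serre_e i j hij => simpa [UgenMap] using h.serre_e i j hij
    | serre_f i j hij => simpa [UgenMap] using h.serre_f i j hij⟩

lemma Ulift_gen (h : IsURep q k l e f) (x : UGen) : Ulift h (Ugen q x) = UgenMap k l e f x := by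
  unfold Ulift Ugen Umk
  erw [RingQuot.liftAlgHom_mkAlgHom_apply]
  simp

@[simp] lemma Ulift_K (h : IsURep q k l e f) (i : Fin 2) : Ulift h (K q i) = k i := Ulift_gen h _
@[simp] lemma Ulift_Kinv (h : IsURep q k l e f) (i : Fin 2) : Ulift h (Kinv q i) = l i :=
  Ulift_gen h _
@[simp] lemma Ulift_E (h : IsURep q k l e f) (i : Fin 2) : Ulift h (E q i) = e i := Ulift_gen h _
@[simp] lemma Ulift_F (h : IsURep q k l e f) (i : Fin 2) : Ulift h (F q i) = f i := Ulift_gen h _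

lemma U_hom_ext {φ ψ : U q →ₐ[ℂ] B} (hK : ∀ i, φ (K q i) = ψ (K q i))
    (hL : ∀ i, φ (Kinv q i) = ψ (Kinv q i)) (hE : ∀ i, φ (E q i) = ψ (E q i))
    (hF : ∀ i, φ (F q i) = ψ (F q i)) : φ = ψ := by
  refine RingQuot.ringQuot_ext' (S := ℂ) (s := URel q) φ ψ ?_
  apply FreeAlgebra.hom_ext
  funext x
  cases x with
  | K i => exact hK i
  | Kinv i => exact hL i
  | E i => exact hE i
  | F i => exact hF i

/-- A subalgebra containing the generators is everything. -/
lemma U_subalgebra_eq_top (S : Subalgebra ℂ (U q)) (hK : ∀ i, K q i ∈ S) (hL : ∀ i, Kinv q i ∈ S)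
    (hE : ∀ i, E q i ∈ S) (hF : ∀ i, F q i ∈ S) (x : U q) : x ∈ S := by
  have hrep : IsURep q (fun i => (⟨K q i, hK i⟩ : S)) (fun i => ⟨Kinv q i, hL i⟩)
      (fun i => ⟨E q i, hE i⟩) (fun i => ⟨F q i, hF i⟩) := by
    have h := isURep_U q
    constructor
    · intro i; exact Subtype.ext (h.kl i)
    · intro i; exact Subtype.ext (h.lk i)
    · intro i j; exact Subtype.ext (h.kk i j)
    · intro i; exact Subtype.ext (h.ef i)
    · intro i j hij; exact Subtype.ext (h.ef_ne i j hij)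
    · intro i; exact Subtype.ext (h.ke i)
    · intro i j hij; exact Subtype.ext (h.ke_ne i j hij)
    · intro i; exact Subtype.ext (h.kf i)
    · intro i j hij; exact Subtype.ext (h.kf_ne i j hij)
    · intro i j hij; exact Subtype.ext (h.serre_e i j hij)
    · intro i j hij; exact Subtype.ext (h.serre_f i j hij)
  have : S.val.comp (Ulift hrep) = AlgHom.id ℂ (U q) := by
    apply U_hom_ext <;> intro i <;> simp
  have h2 := congrArg (fun φ => φ x) this
  simp only [AlgHom.comp_apply, AlgHom.id_apply] at h2
  rw [← h2]
  exact (Ulift hrep x).2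

namespace IsURep

lemma ek (h : IsURep q k l e f) (i : Fin 2) : e i * k i = (qc q)⁻¹ • (k i * e i) := by
  have := congrArg (· * k i) (h.ke i)
  simp only [mul_assoc, h.lk, mul_one, smul_mul_assoc] at this
  rw [this, inv_smul_smul₀ (qc_ne q)]

lemma ek_ne (h : IsURep q k l e f) {i j : Fin 2} (hij : i ≠ j) :
    e j * k i = qh q • (k i * e j) := by
  have := congrArg (· * k i) (h.ke_ne i j hij)
  simp only [mul_assoc, h.lk, mul_one, smul_mul_assoc] at this
  rw [this, smul_inv_smul₀ (qh_ne q)]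

lemma el (h : IsURep q k l e f) (i : Fin 2) : e i * l i = qc q • (l i * e i) := by
  have := congrArg (l i * ·) (h.ke i)
  simp only [← mul_assoc, h.lk, one_mul, mul_smul_comm] at this
  exact this

lemma el_ne (h : IsURep q k l e f) {i j : Fin 2} (hij : i ≠ j) :
    e j * l i = (qh q)⁻¹ • (l i * e j) := by
  have := congrArg (l i * ·) (h.ke_ne i j hij)
  simp only [← mul_assoc, h.lk, one_mul, mul_smul_comm] at this
  exact this

lemma fk (h : IsURep q k l e f) (i : Fin 2) : f i * k i = qc q • (k i * f i) := by
  have := congrArg (k i * ·) (h.kf i)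
  simp only [← mul_assoc, h.kl, one_mul, mul_smul_comm] at this
  exact this

lemma fk_ne (h : IsURep q k l e f) {i j : Fin 2} (hij : i ≠ j) :
    f j * k i = (qh q)⁻¹ • (k i * f j) := by
  have := congrArg (k i * ·) (h.kf_ne i j hij)
  simp only [← mul_assoc, h.kl, one_mul, mul_smul_comm] at this
  exact this

lemma fl (h : IsURep q k l e f) (i : Fin 2) : f i * l i = (qc q)⁻¹ • (l i * f i) := by
  have := congrArg (· * l i) (h.kf i)
  simp only [mul_assoc, h.kl, mul_one, smul_mul_assoc] at this
  rw [this, inv_smul_smul₀ (qc_ne q)]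

lemma fl_ne (h : IsURep q k l e f) {i j : Fin 2} (hij : i ≠ j) :
    f j * l i = qh q • (l i * f j) := by
  have := congrArg (· * l i) (h.kf_ne i j hij)
  simp only [mul_assoc, h.kl, mul_one, smul_mul_assoc] at this
  rw [this, smul_inv_smul₀ (qh_ne q)]

lemma lkc (h : IsURep q k l e f) (i j : Fin 2) : l i * k j = k j * l i := by
  calc l i * k j = l i * k j * (k i * l i) := by rw [h.kl, mul_one]
    _ = l i * (k j * k i) * l i := by simp only [mul_assoc]
    _ = l i * (k i * k j) * l i := by rw [h.kk]
    _ = (l i * k i) * (k j * l i) := by simp only [mul_assoc]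
    _ = _ := by rw [h.lk, one_mul]

lemma ll (h : IsURep q k l e f) (i j : Fin 2) : l i * l j = l j * l i := by
  calc l i * l j = l i * l j * (k i * l i) := by rw [h.kl, mul_one]
    _ = l i * (l j * k i) * l i := by simp only [mul_assoc]
    _ = l i * (k i * l j) * l i := by rw [h.lkc]
    _ = (l i * k i) * (l j * l i) := by simp only [mul_assoc]
    _ = _ := by rw [h.lk, one_mul]

end IsURep

/-- Bookkeeping for coproducts: `q`-commuting summands preserve the Serre relation. -/
lemma serre_add {p : ℂ} (hp : p ≠ 0) {a b c d : B} (hba : b * a = p ^ 2 • (a * b))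
    (hda : d * a = p⁻¹ • (a * d)) (hcb : c * b = p • (b * c))
    (h1 : a ^ 2 * c - (p + p⁻¹) • (a * c * a) + c * a ^ 2 = 0)
    (h2 : b ^ 2 * d - (p + p⁻¹) • (b * d * b) + d * b ^ 2 = 0) :
    (a + b) ^ 2 * (c + d) - (p + p⁻¹) • ((a + b) * (c + d) * (a + b)) + (c + d) * (a + b) ^ 2
      = 0 := by
  have hbc : b * c = p⁻¹ • (c * b) := by rw [hcb, inv_smul_smul₀ hp]
  have g1 : a * (a * d) - (p + p⁻¹) • (a * (d * a)) + d * (a * a) = 0 := by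
    rw [← mul_assoc d, hda, smul_mul_assoc, mul_assoc a d a, hda]
    simp only [mul_smul_comm, smul_smul]
    match_scalars; field_simp; ring
  have g2 : b * (b * c) - (p + p⁻¹) • (b * (c * b)) + c * (b * b) = 0 := by
    rw [← mul_assoc c, hcb, smul_mul_assoc, mul_assoc b c b, hcb]
    simp only [mul_smul_comm, smul_smul]
    match_scalars; field_simp; ring
  have g3 : (a * (b * c) + b * (a * c)) - (p + p⁻¹) • (a * (c * b) + b * (c * a))
      + (c * (a * b) + c * (b * a)) = 0 := by
    have e1 : b * (a * c) = p ^ 2 • (a * (b * c)) := by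
      rw [← mul_assoc, hba, smul_mul_assoc, mul_assoc]
    have e2 : b * (c * a) = p • (c * (a * b)) := by
      rw [← mul_assoc, hbc, smul_mul_assoc, mul_assoc, hba, mul_smul_comm, smul_smul]
      congr 1; field_simp
    rw [e1, e2, hcb, hba]
    simp only [mul_smul_comm]
    match_scalars <;> field_simp <;> ring
  have g4 : (a * (b * d) + b * (a * d)) - (p + p⁻¹) • (a * (d * b) + b * (d * a))
      + (d * (a * b) + d * (b * a)) = 0 := by
    have e1 : b * (a * d) = p ^ 2 • (a * (b * d)) := by
      rw [← mul_assoc, hba, smul_mul_assoc, mul_assoc]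
    have e3 : d * (a * b) = p⁻¹ • (a * (d * b)) := by
      rw [← mul_assoc, hda, smul_mul_assoc, mul_assoc]
    rw [hda, hba]
    simp only [mul_smul_comm]
    rw [e1, e3]
    match_scalars <;> field_simp <;> ring
  simp only [pow_two, mul_assoc] at h1 h2
  have : (a + b) ^ 2 * (c + d) - (p + p⁻¹) • ((a + b) * (c + d) * (a + b)) + (c + d) * (a + b) ^ 2
      = (a * (a * c) - (p + p⁻¹) • (a * (c * a)) + c * (a * a))
      + (b * (b * d) - (p + p⁻¹) • (b * (d * b)) + d * (b * b))
      + (a * (a * d) - (p + p⁻¹) • (a * (d * a)) + d * (a * a))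
      + (b * (b * c) - (p + p⁻¹) • (b * (c * b)) + c * (b * b))
      + ((a * (b * c) + b * (a * c)) - (p + p⁻¹) • (a * (c * b) + b * (c * a))
      + (c * (a * b) + c * (b * a)))
      + ((a * (b * d) + b * (a * d)) - (p + p⁻¹) • (a * (d * b) + b * (d * a))
      + (d * (a * b) + d * (b * a))) := by
    simp only [pow_two, mul_add, add_mul, mul_assoc, smul_add]
    abel
  rw [this, h1, h2, g1, g2, g3, g4]
  simp

end

/-! ### The Hopf algebra structure of `U_q(su(3))` -/

lemma isURep_comul (q : Param) : IsURep q (B := U q ⊗[ℂ] U q)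
    (fun i => K q i ⊗ₜ K q i) (fun i => Kinv q i ⊗ₜ Kinv q i)
    (fun i => E q i ⊗ₜ K q i + Kinv q i ⊗ₜ E q i)
    (fun i => F q i ⊗ₜ K q i + Kinv q i ⊗ₜ F q i) := by
  have h := isURep_U q
  have hq := qc_ne q
  have hh := qh_ne q
  constructor
  · intro i
    simp [h.kl, Algebra.TensorProduct.one_def]
  · intro i
    simp [h.lk, Algebra.TensorProduct.one_def]
  · intro i j
    simp [h.kk i j]
  · intro i
    have e1 : (E q i * Kinv q i) ⊗ₜ[ℂ] (K q i * F q i)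
        = (Kinv q i * E q i) ⊗ₜ[ℂ] (F q i * K q i) := by
      rw [h.el, h.fk, ← TensorProduct.smul_tmul', TensorProduct.tmul_smul]
    have e2 : (Kinv q i * F q i) ⊗ₜ[ℂ] (E q i * K q i)
        = (F q i * Kinv q i) ⊗ₜ[ℂ] (K q i * E q i) := by
      rw [h.fl, h.ek, ← TensorProduct.smul_tmul', TensorProduct.tmul_smul]
    have hef : E q i * F q i = F q i * E q i + (qc q - (qc q)⁻¹)⁻¹ • (K q i ^ 2 - Kinv q i ^ 2) := by
      rw [← h.ef i]; abel
    simp only [mul_add, add_mul, Algebra.TensorProduct.tmul_mul_tmul, e1, e2, hef, pow_two]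
    simp only [TensorProduct.add_tmul, TensorProduct.tmul_add, ← TensorProduct.smul_tmul',
      TensorProduct.tmul_smul, TensorProduct.sub_tmul, TensorProduct.tmul_sub, smul_sub]
    abel
  · intro i j hij
    have e1 : (E q i * Kinv q j) ⊗ₜ[ℂ] (K q i * F q j)
        = (Kinv q j * E q i) ⊗ₜ[ℂ] (F q j * K q i) := by
      rw [h.el_ne hij.symm, h.fk_ne hij, ← TensorProduct.smul_tmul', TensorProduct.tmul_smul]
    have e2 : (Kinv q i * F q j) ⊗ₜ[ℂ] (E q i * K q j)
        = (F q j * Kinv q i) ⊗ₜ[ℂ] (K q j * E q i) := by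
      rw [h.fl_ne hij, h.ek_ne hij.symm, ← TensorProduct.smul_tmul', TensorProduct.tmul_smul]
    simp only [mul_add, add_mul, Algebra.TensorProduct.tmul_mul_tmul, e1, e2, h.ef_ne i j hij,
      h.kk i j, h.ll i j]
    abel
  · intro i
    simp only [mul_add, add_mul, Algebra.TensorProduct.tmul_mul_tmul, h.ke, h.kl, one_mul]
    rw [smul_add, TensorProduct.smul_tmul', TensorProduct.tmul_smul, mul_assoc, h.kl, mul_one]
  · intro i j hij
    have e1 : K q i * K q j * Kinv q i = K q j := by
      rw [h.kk, mul_assoc, h.kl, mul_one]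
    have e2 : K q i * Kinv q j * Kinv q i = Kinv q j := by
      rw [← h.lkc, mul_assoc, h.kl, mul_one]
    simp only [mul_add, add_mul, Algebra.TensorProduct.tmul_mul_tmul, h.ke_ne i j hij, e1, e2]
    rw [smul_add, TensorProduct.smul_tmul', TensorProduct.tmul_smul]
  · intro i
    simp only [mul_add, add_mul, Algebra.TensorProduct.tmul_mul_tmul, h.kf, h.lk, one_mul]
    rw [smul_add, TensorProduct.smul_tmul', TensorProduct.tmul_smul, mul_assoc, h.lk, mul_one]
  · intro i j hij
    have e1 : Kinv q i * K q j * K q i = K q j := by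
      rw [h.lkc, mul_assoc, h.lk, mul_one]
    have e2 : Kinv q i * Kinv q j * K q i = Kinv q j := by
      rw [h.ll, mul_assoc, h.lk, mul_one]
    simp only [mul_add, add_mul, Algebra.TensorProduct.tmul_mul_tmul, h.kf_ne i j hij, e1, e2]
    rw [smul_add, TensorProduct.smul_tmul', TensorProduct.tmul_smul]
  · intro i j hij
    have hs := h.serre_e i j hij
    have := serre_add (p := (qc q)⁻¹) (inv_ne_zero hq)
      (a := E q i ⊗ₜ[ℂ] K q i) (b := Kinv q i ⊗ₜ[ℂ] E q i) (c := E q j ⊗ₜ[ℂ] K q j)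
      (d := Kinv q j ⊗ₜ[ℂ] E q j) ?_ ?_ ?_ ?_ ?_
    · rw [inv_inv, add_comm (qc q)⁻¹] at this
      exact this
    · simp only [Algebra.TensorProduct.tmul_mul_tmul, h.ek, h.el, ← TensorProduct.smul_tmul',
        TensorProduct.tmul_smul, smul_smul]
      congr 1; field_simp
    · simp only [Algebra.TensorProduct.tmul_mul_tmul, h.ek_ne hij, h.el_ne hij.symm,
        ← TensorProduct.smul_tmul', TensorProduct.tmul_smul, smul_smul]
      congr 1; rw [qc_eq]; field_simp
    · simp only [Algebra.TensorProduct.tmul_mul_tmul, h.ek_ne hij.symm, h.el_ne hij,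
        ← TensorProduct.smul_tmul', TensorProduct.tmul_smul, smul_smul]
      congr 1; rw [qc_eq]; field_simp
    · have e1 : K q i * (K q i * K q j) = K q j * (K q i * K q i) := by
        rw [← mul_assoc, mul_assoc, h.kk i j, ← mul_assoc, h.kk i j, mul_assoc]
      have e2 : K q i * (K q j * K q i) = K q j * (K q i * K q i) := by
        rw [← mul_assoc, h.kk i j, mul_assoc]
      simp only [pow_two, Algebra.TensorProduct.tmul_mul_tmul, mul_assoc, e1, e2,
        TensorProduct.smul_tmul', ← TensorProduct.sub_tmul, ← TensorProduct.add_tmul] at hs ⊢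
      rw [inv_inv, add_comm (qc q)⁻¹, hs, TensorProduct.zero_tmul]
    · have e1 : Kinv q i * (Kinv q i * Kinv q j) = Kinv q j * (Kinv q i * Kinv q i) := by
        rw [← mul_assoc, mul_assoc, h.ll i j, ← mul_assoc, h.ll i j, mul_assoc]
      have e2 : Kinv q i * (Kinv q j * Kinv q i) = Kinv q j * (Kinv q i * Kinv q i) := by
        rw [← mul_assoc, h.ll i j, mul_assoc]
      simp only [pow_two, Algebra.TensorProduct.tmul_mul_tmul, mul_assoc, e1, e2,
        ← TensorProduct.tmul_smul, ← TensorProduct.tmul_sub, ← TensorProduct.tmul_add] at hs ⊢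
      rw [inv_inv, add_comm (qc q)⁻¹, hs, TensorProduct.tmul_zero]
  · intro i j hij
    have hs := h.serre_f i j hij
    have := serre_add (p := qc q) hq
      (a := F q i ⊗ₜ[ℂ] K q i) (b := Kinv q i ⊗ₜ[ℂ] F q i) (c := F q j ⊗ₜ[ℂ] K q j)
      (d := Kinv q j ⊗ₜ[ℂ] F q j) ?_ ?_ ?_ ?_ ?_
    · rw [← this]; abel
    · simp only [Algebra.TensorProduct.tmul_mul_tmul, h.fk, h.fl, ← TensorProduct.smul_tmul',
        TensorProduct.tmul_smul, smul_smul]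
      congr 1; field_simp
    · simp only [Algebra.TensorProduct.tmul_mul_tmul, h.fk_ne hij, h.fl_ne hij.symm,
        ← TensorProduct.smul_tmul', TensorProduct.tmul_smul, smul_smul]
      congr 1; rw [qc_eq]; field_simp
    · simp only [Algebra.TensorProduct.tmul_mul_tmul, h.fk_ne hij.symm, h.fl_ne hij,
        ← TensorProduct.smul_tmul', TensorProduct.tmul_smul, smul_smul]
      congr 1; rw [qc_eq]; field_simp
    · have e1 : K q i * (K q i * K q j) = K q j * (K q i * K q i) := by
        rw [← mul_assoc, mul_assoc, h.kk i j, ← mul_assoc, h.kk i j, mul_assoc]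
      have e2 : K q i * (K q j * K q i) = K q j * (K q i * K q i) := by
        rw [← mul_assoc, h.kk i j, mul_assoc]
      simp only [pow_two, Algebra.TensorProduct.tmul_mul_tmul, mul_assoc, e1, e2,
        TensorProduct.smul_tmul', ← TensorProduct.sub_tmul, ← TensorProduct.add_tmul] at hs ⊢
      rw [show ∀ x y z : U q, x - y + z = z - y + x by intros; abel, hs, TensorProduct.zero_tmul]
    · have e1 : Kinv q i * (Kinv q i * Kinv q j) = Kinv q j * (Kinv q i * Kinv q i) := by
        rw [← mul_assoc, mul_assoc, h.ll i j, ← mul_assoc, h.ll i j, mul_assoc]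
      have e2 : Kinv q i * (Kinv q j * Kinv q i) = Kinv q j * (Kinv q i * Kinv q i) := by
        rw [← mul_assoc, h.ll i j, mul_assoc]
      simp only [pow_two, Algebra.TensorProduct.tmul_mul_tmul, mul_assoc, e1, e2,
        ← TensorProduct.tmul_smul, ← TensorProduct.tmul_sub, ← TensorProduct.tmul_add] at hs ⊢
      rw [show ∀ x y z : U q, x - y + z = z - y + x by intros; abel, hs, TensorProduct.tmul_zero]

/-- The coproduct: `Δ K_i = K_i ⊗ K_i`, `Δ E_i = E_i ⊗ K_i + K_i⁻¹ ⊗ E_i`,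
`Δ F_i = F_i ⊗ K_i + K_i⁻¹ ⊗ F_i`. -/
def comulHom (q : Param) : U q →ₐ[ℂ] U q ⊗[ℂ] U q := Ulift (isURep_comul q)

lemma isURep_counit (q : Param) : IsURep q (B := ℂ) (fun _ => 1) (fun _ => 1) (fun _ => 0)
    (fun _ => 0) := by
  constructor <;> simp

/-- The counit: `ε(K_i) = 1`, `ε(E_i) = ε(F_i) = 0`. -/
def counitHom (q : Param) : U q →ₐ[ℂ] ℂ := Ulift (isURep_counit q)

instance (q : Param) : Bialgebra ℂ (U q) :=
  Bialgebra.ofAlgHom (comulHom q) (counitHom q)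
    (by
      apply U_hom_ext <;> intro i <;>
        simp [comulHom, TensorProduct.add_tmul, TensorProduct.tmul_add, add_assoc])
    (by
      apply U_hom_ext <;> intro i <;> simp [comulHom, counitHom])
    (by
      apply U_hom_ext <;> intro i <;> simp [comulHom, counitHom])

lemma comul_eq (q : Param) (x : U q) : Coalgebra.comul (R := ℂ) x = comulHom q x := rfl
lemma counit_eq (q : Param) (x : U q) : Coalgebra.counit (R := ℂ) x = counitHom q x := rfl

open MulOpposite in
lemma isURep_op (q : Param) {c : ℂ} (hq : c ≠ 0) : IsURep q (B := (U q)ᵐᵒᵖ)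
    (fun i => op (Kinv q i)) (fun i => op (K q i)) (fun i => op (-(c • E q i)))
    (fun i => op (-(c⁻¹ • F q i))) := by
  have h := isURep_U q
  constructor
  · intro i; rw [← op_mul, h.kl, op_one]
  · intro i; rw [← op_mul, h.lk, op_one]
  · intro i j; rw [← op_mul, ← op_mul, h.ll]
  · intro i
    have hef := h.ef i
    rw [← op_mul, ← op_mul, ← op_sub, ← op_pow, ← op_pow, ← op_sub, ← op_smul]
    congr 1
    simp only [neg_mul_neg, smul_mul_smul_comm, inv_mul_cancel₀ hq, mul_inv_cancel₀ hq, one_smul]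
    rw [← neg_sub, hef, ← smul_neg, neg_sub]
  · intro i j hij
    rw [← op_mul, ← op_mul]
    congr 1
    simp only [neg_mul_neg, smul_mul_smul_comm, inv_mul_cancel₀ hq, mul_inv_cancel₀ hq, one_smul]
    rw [h.ef_ne i j hij]
  · intro i
    have := h.ke i
    rw [← op_mul, ← op_mul, ← op_smul]
    congr 1
    simp only [mul_neg, neg_mul, mul_smul_comm, smul_mul_assoc, smul_neg, ← mul_assoc, this]
    rw [smul_comm]
  · intro i j hij
    have := h.ke_ne i j hij
    rw [← op_mul, ← op_mul, ← op_smul]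
    congr 1
    simp only [mul_neg, neg_mul, mul_smul_comm, smul_mul_assoc, smul_neg, ← mul_assoc, this]
    rw [smul_comm]
  · intro i
    have := h.kf i
    rw [← op_mul, ← op_mul, ← op_smul]
    congr 1
    simp only [mul_neg, neg_mul, mul_smul_comm, smul_mul_assoc, smul_neg, ← mul_assoc, this]
    rw [smul_comm]
  · intro i j hij
    have := h.kf_ne i j hij
    rw [← op_mul, ← op_mul, ← op_smul]
    congr 1
    simp only [mul_neg, neg_mul, mul_smul_comm, smul_mul_assoc, smul_neg, ← mul_assoc, this]
    rw [smul_comm]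
  · intro i j hij
    have hs := h.serre_e i j hij
    simp only [← op_mul, ← op_pow, ← op_smul, ← op_sub, ← op_add]
    rw [← op_zero]
    congr 1
    have h2 := congrArg (fun x => (-c ^ 3) • x) hs
    simp only [smul_zero, smul_add, smul_sub, pow_two, mul_assoc] at h2 ⊢
    rw [← h2]
    simp only [mul_neg, neg_mul, mul_smul_comm, smul_mul_assoc, smul_neg, neg_neg]
    module
  · intro i j hij
    have hs := h.serre_f i j hij
    simp only [← op_mul, ← op_pow, ← op_smul, ← op_sub, ← op_add]
    rw [← op_zero]
    congr 1
    have h2 := congrArg (fun x => (-(c⁻¹) ^ 3) • x) hs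
    simp only [smul_zero, smul_add, smul_sub, pow_two, mul_assoc] at h2 ⊢
    rw [← h2]
    simp only [mul_neg, neg_mul, mul_smul_comm, smul_mul_assoc, smul_neg, neg_neg]
    module

/-- The antipode as a homomorphism to the opposite algebra: `S(K_i) = K_i⁻¹`, `S(E_i) = -q E_i`,
`S(F_i) = -q⁻¹ F_i`. -/
def antipodeHom (q : Param) : U q →ₐ[ℂ] (U q)ᵐᵒᵖ := Ulift (isURep_op q (qc_ne q))

/-- The inverse of the antipode as a homomorphism to the opposite algebra. -/
def antipodeInvHom (q : Param) : U q →ₐ[ℂ] (U q)ᵐᵒᵖ := Ulift (isURep_op q (inv_ne_zero (qc_ne q)))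

/-- The antipode `S` as a linear map. -/
def S (q : Param) : U q →ₗ[ℂ] U q :=
  (MulOpposite.opLinearEquiv ℂ).symm.toLinearMap ∘ₗ (antipodeHom q).toLinearMap

/-- The inverse `S⁻¹` of the antipode as a linear map. -/
def Sinv (q : Param) : U q →ₗ[ℂ] U q :=
  (MulOpposite.opLinearEquiv ℂ).symm.toLinearMap ∘ₗ (antipodeInvHom q).toLinearMap

section
variable (q : Param)

lemma S_apply (x : U q) : S q x = (antipodeHom q x).unop := rfl
lemma Sinv_apply (x : U q) : Sinv q x = (antipodeInvHom q x).unop := rfl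
@[simp] lemma S_one : S q 1 = 1 := by simp [S_apply]
@[simp] lemma Sinv_one : Sinv q 1 = 1 := by simp [Sinv_apply]
lemma S_mul (x y : U q) : S q (x * y) = S q y * S q x := by simp [S_apply]
lemma Sinv_mul (x y : U q) : Sinv q (x * y) = Sinv q y * Sinv q x := by simp [Sinv_apply]
lemma S_algebraMap (c : ℂ) : S q (algebraMap ℂ _ c) = algebraMap ℂ _ c := by simp [S_apply]
lemma Sinv_algebraMap (c : ℂ) : Sinv q (algebraMap ℂ _ c) = algebraMap ℂ _ c := by
  simp [Sinv_apply]
@[simp] lemma S_K (i : Fin 2) : S q (K q i) = Kinv q i := by simp [S_apply, antipodeHom]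
@[simp] lemma S_Kinv (i : Fin 2) : S q (Kinv q i) = K q i := by simp [S_apply, antipodeHom]
@[simp] lemma S_E (i : Fin 2) : S q (E q i) = -(qc q • E q i) := by simp [S_apply, antipodeHom]
@[simp] lemma S_F (i : Fin 2) : S q (F q i) = -((qc q)⁻¹ • F q i) := by
  simp [S_apply, antipodeHom]
@[simp] lemma Sinv_K (i : Fin 2) : Sinv q (K q i) = Kinv q i := by
  simp [Sinv_apply, antipodeInvHom]
@[simp] lemma Sinv_Kinv (i : Fin 2) : Sinv q (Kinv q i) = K q i := by
  simp [Sinv_apply, antipodeInvHom]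
@[simp] lemma Sinv_E (i : Fin 2) : Sinv q (E q i) = -((qc q)⁻¹ • E q i) := by
  simp [Sinv_apply, antipodeInvHom]
@[simp] lemma Sinv_F (i : Fin 2) : Sinv q (F q i) = -(qc q • F q i) := by
  simp [Sinv_apply, antipodeInvHom]

/-- `Sinv` is the two-sided inverse of `S`. -/
lemma S_Sinv (x : U q) : S q (Sinv q x) = x ∧ Sinv q (S q x) = x := by
  have hq := qc_ne q
  let T : Subalgebra ℂ (U q) :=
    { carrier := {x | S q (Sinv q x) = x ∧ Sinv q (S q x) = x}
      mul_mem' := fun {a b} ha hb => by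
        simp only [Set.mem_ofPred_eq] at ha hb ⊢
        rw [Sinv_mul, S_mul, S_mul, Sinv_mul, ha.1, ha.2, hb.1, hb.2]
        exact ⟨rfl, rfl⟩
      add_mem' := fun {a b} ha hb => by
        simp only [Set.mem_ofPred_eq] at ha hb ⊢
        simp [ha.1, ha.2, hb.1, hb.2]
      algebraMap_mem' := fun c => by
        simp only [Set.mem_ofPred_eq]
        simp [S_algebraMap, Sinv_algebraMap] }
  refine U_subalgebra_eq_top T ?_ ?_ ?_ ?_ x <;> intro i <;>
    change S q (Sinv q _) = _ ∧ Sinv q (S q _) = _ <;> simp [smul_smul, hq]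

lemma comul_K (i : Fin 2) : Coalgebra.comul (R := ℂ) (K q i) = K q i ⊗ₜ K q i := by
  simp [comul_eq, comulHom]
lemma comul_Kinv (i : Fin 2) : Coalgebra.comul (R := ℂ) (Kinv q i) = Kinv q i ⊗ₜ Kinv q i := by
  simp [comul_eq, comulHom]
lemma comul_E (i : Fin 2) :
    Coalgebra.comul (R := ℂ) (E q i) = E q i ⊗ₜ K q i + Kinv q i ⊗ₜ E q i := by
  simp [comul_eq, comulHom]
lemma comul_F (i : Fin 2) :
    Coalgebra.comul (R := ℂ) (F q i) = F q i ⊗ₜ K q i + Kinv q i ⊗ₜ F q i := by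
  simp [comul_eq, comulHom]
@[simp] lemma counit_K (i : Fin 2) : Coalgebra.counit (R := ℂ) (K q i) = 1 := by
  simp [counit_eq, counitHom]
@[simp] lemma counit_Kinv (i : Fin 2) : Coalgebra.counit (R := ℂ) (Kinv q i) = 1 := by
  simp [counit_eq, counitHom]
@[simp] lemma counit_E (i : Fin 2) : Coalgebra.counit (R := ℂ) (E q i) = 0 := by
  simp [counit_eq, counitHom]
@[simp] lemma counit_F (i : Fin 2) : Coalgebra.counit (R := ℂ) (F q i) = 0 := by
  simp [counit_eq, counitHom]

lemma antipode_left_aux (t s : U q ⊗[ℂ] U q) (r : ℂ)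
    (h : LinearMap.mul' ℂ (U q) ((S q).rTensor _ t) = algebraMap ℂ _ r) :
    LinearMap.mul' ℂ (U q) ((S q).rTensor _ (t * s))
      = r • LinearMap.mul' ℂ (U q) ((S q).rTensor _ s) := by
  have key : ∀ c d : U q, LinearMap.mul' ℂ (U q) ((S q).rTensor _ (t * c ⊗ₜ d))
      = S q c * LinearMap.mul' ℂ (U q) ((S q).rTensor _ t) * d := by
    intro c d
    clear h
    induction t with
    | zero => simp
    | tmul a b => simp [S_mul, mul_assoc]
    | add x y hx hy => simp only [add_mul, mul_add, map_add, hx, hy]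
  induction s with
  | zero => simp
  | tmul c d =>
    rw [key, h, ← Algebra.commutes, mul_assoc, ← Algebra.smul_def]
    simp
  | add x y hx hy => simp only [mul_add, map_add, hx, hy, smul_add]

lemma antipode_right_aux (t s : U q ⊗[ℂ] U q) (r : ℂ)
    (h : LinearMap.mul' ℂ (U q) ((S q).lTensor _ s) = algebraMap ℂ _ r) :
    LinearMap.mul' ℂ (U q) ((S q).lTensor _ (t * s))
      = r • LinearMap.mul' ℂ (U q) ((S q).lTensor _ t) := by
  have key : ∀ a b : U q, LinearMap.mul' ℂ (U q) ((S q).lTensor _ (a ⊗ₜ b * s))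
      = a * LinearMap.mul' ℂ (U q) ((S q).lTensor _ s) * S q b := by
    intro a b
    clear h
    induction s with
    | zero => simp
    | tmul c d => simp [S_mul, mul_assoc]
    | add x y hx hy => simp only [add_mul, mul_add, map_add, hx, hy]
  induction t with
  | zero => simp
  | tmul c d =>
    rw [key, h, ← Algebra.commutes, mul_assoc, ← Algebra.smul_def]
    simp
  | add x y hx hy => simp only [add_mul, map_add, hx, hy, smul_add]

lemma antipode_left (x : U q) :
    LinearMap.mul' ℂ (U q) ((S q).rTensor _ (Coalgebra.comul (R := ℂ) x))
      = algebraMap ℂ _ (Coalgebra.counit (R := ℂ) x) := by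
  have h := isURep_U q
  have hq := qc_ne q
  let T : Subalgebra ℂ (U q) :=
    { carrier := {x | LinearMap.mul' ℂ (U q) ((S q).rTensor _ (Coalgebra.comul (R := ℂ) x))
        = algebraMap ℂ _ (Coalgebra.counit (R := ℂ) x)}
      mul_mem' := fun {a b} ha hb => by
        simp only [Set.mem_ofPred_eq] at ha hb ⊢
        rw [Bialgebra.comul_mul, antipode_left_aux q _ _ _ ha, hb, Bialgebra.counit_mul, map_mul,
          Algebra.smul_def]
      add_mem' := fun {a b} ha hb => by
        simp only [Set.mem_ofPred_eq] at ha hb ⊢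
        simp [ha, hb]
      algebraMap_mem' := fun c => by
        simp only [Set.mem_ofPred_eq]
        simp [Algebra.TensorProduct.algebraMap_apply, S_algebraMap] }
  refine U_subalgebra_eq_top T ?_ ?_ ?_ ?_ x <;> intro i <;>
    change LinearMap.mul' ℂ (U q) ((S q).rTensor _ (Coalgebra.comul (R := ℂ) _)) = _
  · simp [comul_K, h.lk]
  · simp [comul_Kinv, h.kl]
  · simp [comul_E, h.ek, smul_smul, hq]
  · simp [comul_F, h.fk, smul_smul, hq]

lemma antipode_right (x : U q) :
    LinearMap.mul' ℂ (U q) ((S q).lTensor _ (Coalgebra.comul (R := ℂ) x))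
      = algebraMap ℂ _ (Coalgebra.counit (R := ℂ) x) := by
  have h := isURep_U q
  have hq := qc_ne q
  let T : Subalgebra ℂ (U q) :=
    { carrier := {x | LinearMap.mul' ℂ (U q) ((S q).lTensor _ (Coalgebra.comul (R := ℂ) x))
        = algebraMap ℂ _ (Coalgebra.counit (R := ℂ) x)}
      mul_mem' := fun {a b} ha hb => by
        simp only [Set.mem_ofPred_eq] at ha hb ⊢
        rw [Bialgebra.comul_mul, antipode_right_aux q _ _ _ hb, ha, Bialgebra.counit_mul, mul_comm,
          map_mul, Algebra.smul_def]
      add_mem' := fun {a b} ha hb => by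
        simp only [Set.mem_ofPred_eq] at ha hb ⊢
        simp [ha, hb]
      algebraMap_mem' := fun c => by
        simp only [Set.mem_ofPred_eq]
        simp [Algebra.TensorProduct.algebraMap_apply] }
  refine U_subalgebra_eq_top T ?_ ?_ ?_ ?_ x <;> intro i <;>
    change LinearMap.mul' ℂ (U q) ((S q).lTensor _ (Coalgebra.comul (R := ℂ) _)) = _
  · simp [comul_K, h.kl]
  · simp [comul_Kinv, h.lk]
  · simp [comul_E, h.el]
  · simp [comul_F, h.fl]

end

instance (q : Param) : HopfAlgebra ℂ (U q) where
  antipode := S q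
  mul_antipode_rTensor_comul := LinearMap.ext fun x => antipode_left q x
  mul_antipode_lTensor_comul := LinearMap.ext fun x => antipode_right q x

/-! ### The Hopf subalgebra `U_q(u(2))` -/

/-- `U_q(u(2))`: the subalgebra generated by `K_1, K_1⁻¹, E_1, F_1`, `K_1 K_2²` and
`(K_1 K_2²)⁻¹`. -/
def Uu2 (q : Param) : Subalgebra ℂ (U q) :=
  Algebra.adjoin ℂ {K q 0, Kinv q 0, E q 0, F q 0, K q 0 * K q 1 ^ 2, Kinv q 0 * Kinv q 1 ^ 2}

section
variable (q : Param)

lemma K_mem : K q 0 ∈ Uu2 q := Algebra.subset_adjoin (by simp)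
lemma Kinv_mem : Kinv q 0 ∈ Uu2 q := Algebra.subset_adjoin (by simp)
lemma E_mem : E q 0 ∈ Uu2 q := Algebra.subset_adjoin (by simp)
lemma F_mem : F q 0 ∈ Uu2 q := Algebra.subset_adjoin (by simp)
lemma L_mem : K q 0 * K q 1 ^ 2 ∈ Uu2 q := Algebra.subset_adjoin (by simp)
lemma Linv_mem : Kinv q 0 * Kinv q 1 ^ 2 ∈ Uu2 q := Algebra.subset_adjoin (by simp)

/-- A subalgebra containing the generators of `U_q(u(2))` contains `U_q(u(2))`. -/
lemma Uu2_le {T : Subalgebra ℂ (U q)} (h1 : K q 0 ∈ T) (h2 : Kinv q 0 ∈ T) (h3 : E q 0 ∈ T)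
    (h4 : F q 0 ∈ T) (h5 : K q 0 * K q 1 ^ 2 ∈ T) (h6 : Kinv q 0 * Kinv q 1 ^ 2 ∈ T) :
    Uu2 q ≤ T := by
  apply Algebra.adjoin_le
  intro x hx
  simp only [Set.mem_insert_iff, Set.mem_singleton_iff] at hx
  rcases hx with rfl | rfl | rfl | rfl | rfl | rfl <;> assumption

lemma S_mem {x : U q} (hx : x ∈ Uu2 q) : S q x ∈ Uu2 q := by
  have h := isURep_U q
  have hle : Uu2 q ≤ (Uu2 q).op.comap (antipodeHom q) := by
    apply Uu2_le <;> rw [Subalgebra.mem_comap, Subalgebra.mem_op] <;> rw [← S_apply]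
    · simpa using Kinv_mem q
    · simpa using K_mem q
    · simpa using (Uu2 q).smul_mem (E_mem q) (qc q)
    · simpa using (Uu2 q).smul_mem (F_mem q) (qc q)⁻¹
    · have : S q (K q 0 * K q 1 ^ 2) = Kinv q 0 * Kinv q 1 ^ 2 := by
        simp only [pow_two, S_mul, S_K]
        rw [mul_assoc, h.ll 1 0, ← mul_assoc, h.ll 1 0, mul_assoc]
      rw [this]; exact Linv_mem q
    · have : S q (Kinv q 0 * Kinv q 1 ^ 2) = K q 0 * K q 1 ^ 2 := by
        simp only [pow_two, S_mul, S_Kinv]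
        rw [mul_assoc, h.kk 1 0, ← mul_assoc, h.kk 1 0, mul_assoc]
      rw [this]; exact L_mem q
  exact hle hx

/-- The antipode of `U_q(u(2))`, with values in the opposite algebra. -/
def Su2 : Uu2 q →ₐ[ℂ] (Uu2 q)ᵐᵒᵖ :=
  { toFun := fun x => MulOpposite.op ⟨S q x, S_mem q x.2⟩
    map_one' := by
      apply MulOpposite.unop_injective; apply Subtype.ext; simp
    map_mul' := fun x y => by
      apply MulOpposite.unop_injective; apply Subtype.ext; simp [S_mul]
    map_zero' := by
      apply MulOpposite.unop_injective; apply Subtype.ext; simp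
    map_add' := fun x y => by
      apply MulOpposite.unop_injective; apply Subtype.ext; simp
    commutes' := fun c => by
      apply MulOpposite.unop_injective; apply Subtype.ext
      simp [S_algebraMap, MulOpposite.algebraMap_apply] }

@[simp] lemma coe_Su2 (x : Uu2 q) : ((Su2 q x).unop : U q) = S q x := rfl

/-- The inclusion `U_q(u(2)) ⊗ U_q(u(2)) → U_q(su(3)) ⊗ U_q(su(3))`. -/
def inclTensor : Uu2 q ⊗[ℂ] Uu2 q →ₐ[ℂ] U q ⊗[ℂ] U q :=
  Algebra.TensorProduct.map (Uu2 q).val (Uu2 q).val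

lemma inclTensor_injective : Function.Injective (inclTensor q) :=
  TensorProduct.map_injective_of_flat_flat _ _ Subtype.val_injective Subtype.val_injective

lemma comul_mem (x : Uu2 q) : comulHom q x ∈ (inclTensor q).range := by
  have hle : Uu2 q ≤ (inclTensor q).range.comap (comulHom q) := by
    have hK : comulHom q (K q 0) ∈ (inclTensor q).range :=
      ⟨(⟨K q 0, K_mem q⟩ : Uu2 q) ⊗ₜ (⟨K q 0, K_mem q⟩ : Uu2 q), by simp [inclTensor, comulHom]⟩
    have hL : comulHom q (Kinv q 0) ∈ (inclTensor q).range :=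
      ⟨(⟨Kinv q 0, Kinv_mem q⟩ : Uu2 q) ⊗ₜ (⟨Kinv q 0, Kinv_mem q⟩ : Uu2 q),
        by simp [inclTensor, comulHom]⟩
    apply Uu2_le <;> rw [Subalgebra.mem_comap]
    · exact hK
    · exact hL
    · exact ⟨(⟨E q 0, E_mem q⟩ : Uu2 q) ⊗ₜ (⟨K q 0, K_mem q⟩ : Uu2 q)
        + (⟨Kinv q 0, Kinv_mem q⟩ : Uu2 q) ⊗ₜ (⟨E q 0, E_mem q⟩ : Uu2 q),
        by simp [inclTensor, comulHom]⟩
    · exact ⟨(⟨F q 0, F_mem q⟩ : Uu2 q) ⊗ₜ (⟨K q 0, K_mem q⟩ : Uu2 q)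
        + (⟨Kinv q 0, Kinv_mem q⟩ : Uu2 q) ⊗ₜ (⟨F q 0, F_mem q⟩ : Uu2 q),
        by simp [inclTensor, comulHom]⟩
    · exact ⟨(⟨_, L_mem q⟩ : Uu2 q) ⊗ₜ (⟨_, L_mem q⟩ : Uu2 q),
        by simp [inclTensor, comulHom, pow_two]⟩
    · exact ⟨(⟨_, Linv_mem q⟩ : Uu2 q) ⊗ₜ (⟨_, Linv_mem q⟩ : Uu2 q),
        by simp [inclTensor, comulHom, pow_two]⟩
  exact hle x.2

/-- The coproduct of `U_q(u(2))`: the restriction of `Δ`. -/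
def comulU2 : Uu2 q →ₐ[ℂ] Uu2 q ⊗[ℂ] Uu2 q :=
  (AlgEquiv.ofInjective (inclTensor q) (inclTensor_injective q)).symm.toAlgHom.comp
    (((comulHom q).comp (Uu2 q).val).codRestrict (inclTensor q).range (comul_mem q))

/-- `comulU2` is the restriction of the coproduct of `U_q(su(3))`. -/
lemma inclTensor_comulU2 (x : Uu2 q) :
    inclTensor q (comulU2 q x) = Coalgebra.comul (R := ℂ) (x : U q) := by
  have := (AlgEquiv.ofInjective (inclTensor q) (inclTensor_injective q)).apply_symm_apply
    (((comulHom q).comp (Uu2 q).val).codRestrict (inclTensor q).range (comul_mem q) x)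
  exact congrArg Subtype.val this

end

/-! ### The coordinate algebra `A(SU_q(3))` -/

/-- The length (number of inversions) of a permutation of `{1, 2, 3}`. -/
def permLength (π : Equiv.Perm (Fin 3)) : ℕ :=
  (Finset.univ.filter fun p : Fin 3 × Fin 3 => p.1 < p.2 ∧ π p.2 < π p.1).card

/-- The quantum determinant of a `3 × 3` array of elements of an algebra. -/
def qdet (q : Param) {B : Type*} [Ring B] [Algebra ℂ B] (u : Fin 3 → Fin 3 → B) : B :=
  ∑ π : Equiv.Perm (Fin 3), (-qc q) ^ permLength π • (u 0 (π 0) * u 1 (π 1) * u 2 (π 2))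

/-- The defining relations of `A(SU_q(3))` for elements `u i j` of an arbitrary algebra in the role
of the generators `u^i_j`. -/
structure IsARep (q : Param) {B : Type*} [Ring B] [Algebra ℂ B] (u : Fin 3 → Fin 3 → B) :
    Prop where
  col : ∀ i j k, i < j → u i k * u j k = qc q • (u j k * u i k)
  row : ∀ i j k, i < j → u k i * u k j = qc q • (u k j * u k i)
  comm : ∀ i j k l, i < j → k < l → u i l * u j k - u j k * u i l = 0
  diag : ∀ i j k l, i < j → k < l →
    u i k * u j l - u j l * u i k = (qc q - (qc q)⁻¹) • (u i l * u j k)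
  det : qdet q u = 1

/-- The generators of the free algebra, as an array. -/
def freeU (i j : Fin 3) : FreeAlgebra ℂ (Fin 3 × Fin 3) := FreeAlgebra.ι ℂ (i, j)

/-- The defining relations of `A(SU_q(3))`, in the free algebra on the generators. -/
inductive ARel (q : Param) :
    FreeAlgebra ℂ (Fin 3 × Fin 3) → FreeAlgebra ℂ (Fin 3 × Fin 3) → Prop
  | col (i j k : Fin 3) : i < j → ARel q (freeU i k * freeU j k) (qc q • (freeU j k * freeU i k))
  | row (i j k : Fin 3) : i < j → ARel q (freeU k i * freeU k j) (qc q • (freeU k j * freeU k i))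
  | comm (i j k l : Fin 3) : i < j → k < l →
      ARel q (freeU i l * freeU j k - freeU j k * freeU i l) 0
  | diag (i j k l : Fin 3) : i < j → k < l →
      ARel q (freeU i k * freeU j l - freeU j l * freeU i k)
        ((qc q - (qc q)⁻¹) • (freeU i l * freeU j k))
  | det : ARel q (qdet q freeU) 1

/-- The algebra `A(SU_q(3))`. -/
def A (q : Param) : Type := RingQuot (ARel q)

instance (q : Param) : Ring (A q) := inferInstanceAs (Ring (RingQuot (ARel q)))
instance (q : Param) : Algebra ℂ (A q) := inferInstanceAs (Algebra ℂ (RingQuot (ARel q)))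

/-- The quotient map from the free algebra. -/
def Amk (q : Param) : FreeAlgebra ℂ (Fin 3 × Fin 3) →ₐ[ℂ] A q := RingQuot.mkAlgHom ℂ (ARel q)

/-- The generator `u^i_j`; the indices `1, 2, 3` are `0, 1, 2 : Fin 3`. -/
def u (q : Param) (i j : Fin 3) : A q := Amk q (freeU i j)

section
variable {q : Param} {B C : Type*} [Ring B] [Algebra ℂ B] [Ring C] [Algebra ℂ C]

lemma map_qdet (φ : B →ₐ[ℂ] C) (x : Fin 3 → Fin 3 → B) :
    φ (qdet q x) = qdet q fun i j => φ (x i j) := by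
  simp [qdet, map_sum]

lemma isARep_u (q : Param) : IsARep q (u q) := by
  have key : ∀ {x y}, ARel q x y → Amk q x = Amk q y := fun h => RingQuot.mkAlgHom_rel ℂ h
  constructor
  · intro i j k h; simpa [u] using key (.col i j k h)
  · intro i j k h; simpa [u] using key (.row i j k h)
  · intro i j k l h h'; simpa [u] using key (.comm i j k l h h')
  · intro i j k l h h'; simpa [u] using key (.diag i j k l h h')
  · have := key .det
    rw [map_qdet, map_one] at this
    exact this

/-- The universal property of `A(SU_q(3))`. -/
def Alift {x : Fin 3 → Fin 3 → B} (h : IsARep q x) : A q →ₐ[ℂ] B :=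
  RingQuot.liftAlgHom ℂ ⟨FreeAlgebra.lift ℂ fun p => x p.1 p.2, by
    intro a b r
    cases r with
    | col i j k hij => simpa [freeU] using h.col i j k hij
    | row i j k hij => simpa [freeU] using h.row i j k hij
    | comm i j k l hij hkl => simpa [freeU] using h.comm i j k l hij hkl
    | diag i j k l hij hkl => simpa [freeU] using h.diag i j k l hij hkl
    | det =>
      rw [map_qdet, map_one]
      simpa [freeU] using h.det⟩

@[simp] lemma Alift_u {x : Fin 3 → Fin 3 → B} (h : IsARep q x) (i j : Fin 3) :
    Alift h (u q i j) = x i j := by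
  unfold Alift u Amk
  erw [RingQuot.liftAlgHom_mkAlgHom_apply]
  simp [freeU]

lemma A_hom_ext {φ ψ : A q →ₐ[ℂ] B} (h : ∀ i j, φ (u q i j) = ψ (u q i j)) : φ = ψ := by
  refine RingQuot.ringQuot_ext' (S := ℂ) (s := ARel q) φ ψ ?_
  apply FreeAlgebra.hom_ext
  funext p
  exact h p.1 p.2

/-- A subalgebra containing the generators is everything. -/
lemma A_subalgebra_eq_top (T : Subalgebra ℂ (A q)) (hu : ∀ i j, u q i j ∈ T) (x : A q) :
    x ∈ T := by
  have h := isARep_u q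
  have hrep : IsARep q (fun i j => (⟨u q i j, hu i j⟩ : T)) := by
    constructor
    · intro i j k hij; exact Subtype.ext (h.col i j k hij)
    · intro i j k hij; exact Subtype.ext (h.row i j k hij)
    · intro i j k l hij hkl; exact Subtype.ext (h.comm i j k l hij hkl)
    · intro i j k l hij hkl; exact Subtype.ext (h.diag i j k l hij hkl)
    · apply Subtype.ext
      have := map_qdet (q := q) T.val (fun i j => (⟨u q i j, hu i j⟩ : T))
      exact this.trans h.det
  have : T.val.comp (Alift hrep) = AlgHom.id ℂ (A q) := by
    apply A_hom_ext; intro i j; simp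
  have h2 := congrArg (fun φ => φ x) this
  simp only [AlgHom.comp_apply, AlgHom.id_apply] at h2
  rw [← h2]
  exact (Alift hrep x).2

/-! ### The `R`-matrix form of the relations -/

/-- The completely `q`-antisymmetric tensor. -/
def qeps (q : Param) (a b c : Fin 3) : ℂ :=
  if a = b ∨ a = c ∨ b = c then 0
  else (-qc q) ^ ((if b < a then 1 else 0) + (if c < a then 1 else 0) + (if c < b then 1 else 0))

lemma sum_perm_eq {M : Type*} [AddCommGroup M] [Module ℂ M] (f : Fin 3 → Fin 3 → Fin 3 → M) :
    ∑ π : Equiv.Perm (Fin 3), (-qc q) ^ permLength π • f (π 0) (π 1) (π 2)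
      = ∑ a, ∑ b, ∑ c, qeps q a b c • f a b c := by
  have huniv : (Finset.univ : Finset (Equiv.Perm (Fin 3))) =
      {1, Equiv.swap 0 1, Equiv.swap 0 2, Equiv.swap 1 2, Equiv.swap 0 1 * Equiv.swap 1 2,
        Equiv.swap 1 2 * Equiv.swap 0 1} := by decide
  have l1 : permLength 1 = 0 := by decide
  have l2 : permLength (Equiv.swap 0 1) = 1 := by decide
  have l3 : permLength (Equiv.swap 0 2) = 3 := by decide
  have l4 : permLength (Equiv.swap 1 2) = 1 := by decide
  have l5 : permLength (Equiv.swap 0 1 * Equiv.swap 1 2) = 2 := by decide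
  have l6 : permLength (Equiv.swap 1 2 * Equiv.swap 0 1) = 2 := by decide
  rw [huniv, Finset.sum_insert (by decide), Finset.sum_insert (by decide),
    Finset.sum_insert (by decide), Finset.sum_insert (by decide), Finset.sum_insert (by decide),
    Finset.sum_singleton, l1, l2, l3, l4, l5, l6]
  have a1 : (Equiv.swap 0 1 : Equiv.Perm (Fin 3)) 2 = 2 := by decide
  have a2 : (Equiv.swap 0 2 : Equiv.Perm (Fin 3)) 1 = 1 := by decide
  have a3 : (Equiv.swap 1 2 : Equiv.Perm (Fin 3)) 0 = 0 := by decide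
  have a4 : (Equiv.swap 0 1 * Equiv.swap 1 2 : Equiv.Perm (Fin 3)) 0 = 1 := by decide
  have a5 : (Equiv.swap 0 1 * Equiv.swap 1 2 : Equiv.Perm (Fin 3)) 1 = 2 := by decide
  have a6 : (Equiv.swap 0 1 * Equiv.swap 1 2 : Equiv.Perm (Fin 3)) 2 = 0 := by decide
  have a7 : (Equiv.swap 1 2 * Equiv.swap 0 1 : Equiv.Perm (Fin 3)) 0 = 2 := by decide
  have a8 : (Equiv.swap 1 2 * Equiv.swap 0 1 : Equiv.Perm (Fin 3)) 1 = 0 := by decide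
  have a9 : (Equiv.swap 1 2 * Equiv.swap 0 1 : Equiv.Perm (Fin 3)) 2 = 1 := by decide
  simp only [a1, a2, a3, a4, a5, a6, a7, a8, a9, Equiv.swap_apply_left, Equiv.swap_apply_right,
    Equiv.Perm.one_apply]
  simp [Fin.sum_univ_three, qeps]
  abel

lemma qdet_eq (x : Fin 3 → Fin 3 → B) :
    qdet q x = ∑ a, ∑ b, ∑ c, qeps q a b c • (x 0 a * x 1 b * x 2 c) :=
  sum_perm_eq fun a b c => x 0 a * x 1 b * x 2 c

/-- The coefficients of the (symmetric) braid matrix. -/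
def tcoef (q : Param) (p r : Fin 3 × Fin 3) : ℂ :=
  if p.1 = p.2 then (if r = p then qc q else 0)
  else (if r = (p.2, p.1) then 1 else 0)
    + (if p.1 < p.2 then (if r = p then qc q - (qc q)⁻¹ else 0) else 0)

/-- The braid matrix over an algebra. -/
def tmat (q : Param) (B : Type*) [Ring B] [Algebra ℂ B] :
    Matrix (Fin 3 × Fin 3) (Fin 3 × Fin 3) B :=
  Matrix.of fun p r => algebraMap ℂ B (tcoef q p r)

lemma tcoef_symm (p r : Fin 3 × Fin 3) : tcoef q p r = tcoef q r p := by
  obtain ⟨a, b⟩ := p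
  obtain ⟨c, d⟩ := r
  fin_cases a <;> fin_cases b <;> fin_cases c <;> fin_cases d <;> simp [tcoef]

/-- The tensor square of an array of elements of an algebra. -/
def sq (x : Fin 3 → Fin 3 → B) : Matrix (Fin 3 × Fin 3) (Fin 3 × Fin 3) B :=
  Matrix.of fun p r => x p.1 r.1 * x p.2 r.2

/-- Contraction with the braid matrix, on arbitrary families. -/
lemma sum_tcoef {M : Type*} [AddCommGroup M] [Module ℂ M] (g : Fin 3 × Fin 3 → M) (i j : Fin 3) :
    ∑ r, tcoef q (i, j) r • g r = if i = j then qc q • g (i, j)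
      else g (j, i) + if i < j then (qc q - (qc q)⁻¹) • g (i, j) else 0 := by
  by_cases h : i = j
  · simp [tcoef, h, Finset.sum_ite_eq']
  · by_cases h' : i < j
    · simp [tcoef, h, h', add_smul, Finset.sum_add_distrib, Finset.sum_ite_eq']
    · simp [tcoef, h, h', Finset.sum_ite_eq']

lemma tmat_mul (m : Matrix (Fin 3 × Fin 3) (Fin 3 × Fin 3) B) (p r : Fin 3 × Fin 3) :
    (tmat q B * m) p r = ∑ s, tcoef q p s • m s r := by
  simp [Matrix.mul_apply, tmat, Algebra.smul_def]

lemma mul_tmat (m : Matrix (Fin 3 × Fin 3) (Fin 3 × Fin 3) B) (p r : Fin 3 × Fin 3) :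
    (m * tmat q B) p r = ∑ s, tcoef q r s • m p s := by
  simp only [Matrix.mul_apply, tmat, Algebra.smul_def, Matrix.of_apply]
  refine Finset.sum_congr rfl fun s _ => ?_
  rw [tcoef_symm, Algebra.commutes]

lemma smul_eq_iff {c : ℂ} (hc : c ≠ 0) (a b : B) : a = c • b ↔ b = c⁻¹ • a := by
  constructor
  · rintro rfl; rw [inv_smul_smul₀ hc]
  · rintro rfl; rw [smul_inv_smul₀ hc]

/-- The quadratic relations say that the tensor square commutes with the braid matrix. -/
lemma IsARep.braid {x : Fin 3 → Fin 3 → B} (h : IsARep q x) :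
    tmat q B * sq x = sq x * tmat q B := by
  have hq := qc_ne q
  have hcol : ∀ i j k, i < j → x j k * x i k = (qc q)⁻¹ • (x i k * x j k) := fun i j k hij =>
    (smul_eq_iff hq _ _).1 (h.col i j k hij)
  have hrow : ∀ i j k, i < j → x k j * x k i = (qc q)⁻¹ • (x k i * x k j) := fun i j k hij =>
    (smul_eq_iff hq _ _).1 (h.row i j k hij)
  have hcomm : ∀ i j k l, i < j → k < l → x i l * x j k = x j k * x i l :=
    fun i j k l hij hkl => sub_eq_zero.1 (h.comm i j k l hij hkl)
  have hdiag : ∀ i j k l, i < j → k < l →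
      x i k * x j l = x j l * x i k + (qc q - (qc q)⁻¹) • (x i l * x j k) :=
    fun i j k l hij hkl => by rw [← h.diag i j k l hij hkl]; abel
  ext ⟨i, j⟩ ⟨k, l⟩
  rw [tmat_mul, mul_tmat, sum_tcoef, sum_tcoef]
  simp only [sq, Matrix.of_apply]
  rcases lt_trichotomy i j with hij | rfl | hij <;> rcases lt_trichotomy k l with hkl | rfl | hkl
  · simp [hij, hij.ne, hkl, hkl.ne, hcomm i j k l hij hkl]
  · simp only [hij, hij.ne, if_true, if_false, hcol i j k hij]
    module
  · simp only [hij, hij.ne, hkl.ne', hkl.not_gt, if_true, if_false, add_zero]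
    rw [hdiag i j l k hij hkl]
  · simp only [hkl, hkl.ne, if_true, if_false, hrow k l i hkl]
    module
  · simp
  · simp only [hkl.ne', hkl.not_gt, if_true, if_false, add_zero, hrow l k i hkl]
    rw [smul_inv_smul₀ hq]
  · simp only [hij.ne', hij.not_gt, hkl, hkl.ne, if_true, if_false, add_zero]
    rw [hdiag j i k l hij hkl, hcomm j i k l hij hkl]
  · simp only [hij.ne', hij.not_gt, if_true, if_false, add_zero, hcol j i k hij]
    rw [smul_inv_smul₀ hq]
  · simp [hij.ne', hij.not_gt, hkl.ne', hkl.not_gt, hcomm j i l k hij hkl]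

/-- Conversely, the braid relation gives the quadratic relations. -/
lemma isARep_of_braid {x : Fin 3 → Fin 3 → B} (h : tmat q B * sq x = sq x * tmat q B)
    (hdet : qdet q x = 1) : IsARep q x := by
  have hq := qc_ne q
  have key : ∀ i j k l : Fin 3,
      (if i = j then qc q • (x i k * x j l)
        else x j k * x i l + if i < j then (qc q - (qc q)⁻¹) • (x i k * x j l) else 0)
      = if k = l then qc q • (x i k * x j l)
        else x i l * x j k + if k < l then (qc q - (qc q)⁻¹) • (x i k * x j l) else 0 := by
    intro i j k l
    have := congrFun (congrFun h (i, j)) (k, l)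
    rw [tmat_mul, mul_tmat, sum_tcoef, sum_tcoef] at this
    simpa only [sq, Matrix.of_apply] using this
  refine ⟨?_, ?_, ?_, ?_, hdet⟩
  · intro i j k hij
    have := key j i k k
    simp only [hij.ne', hij.not_gt, if_true, if_false, add_zero] at this
    exact this
  · intro i j k hij
    have := key k k j i
    simp only [hij.ne', hij.not_gt, if_true, if_false, add_zero] at this
    exact this.symm
  · intro i j k l hij hkl
    have := key i j k l
    simp only [hij, hij.ne, hkl, hkl.ne, if_true, if_false] at this
    rw [sub_eq_zero]
    exact (add_right_cancel this).symm
  · intro i j k l hij hkl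
    have := key i j l k
    simp only [hij, hij.ne, hkl.ne', hkl.not_gt, if_true, if_false, add_zero] at this
    rw [← this]; abel

/-- A `q`-antisymmetric family is a multiple of the `q`-antisymmetric tensor. -/
lemma eq_qeps_smul {M : Type*} [AddCommGroup M] [Module ℂ M] (v : Fin 3 → Fin 3 → Fin 3 → M)
    (h1 : ∀ a c, v a a c = 0) (h2 : ∀ a b c, a < b → v b a c = -(qc q • v a b c))
    (h3 : ∀ a b, v a b b = 0) (h4 : ∀ a b c, b < c → v a c b = -(qc q • v a b c))
    (a b c : Fin 3) : v a b c = qeps q a b c • v 0 1 2 := by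
  have e1 : v 1 0 2 = -(qc q • v 0 1 2) := h2 0 1 2 (by decide)
  have e2 : v 0 2 1 = -(qc q • v 0 1 2) := h4 0 1 2 (by decide)
  have e3 : v 1 2 0 = -(qc q • v 1 0 2) := h4 1 0 2 (by decide)
  have e4 : v 2 0 1 = -(qc q • v 0 2 1) := h2 0 2 1 (by decide)
  have e5 : v 2 1 0 = -(qc q • v 2 0 1) := h4 2 0 1 (by decide)
  have z1 : ∀ a c, a ≠ c → v a c a = 0 := by
    intro a c hac
    rcases lt_or_gt_of_ne hac with h | h
    · rw [h4 a a c h, h1]; simp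
    · rw [h2 c a a h, h3]; simp
  fin_cases a <;> fin_cases b <;> fin_cases c <;>
    simp [h1, h3, z1, qeps, e1, e2, e3, e4, e5, smul_smul, pow_succ, mul_assoc]

end

section
variable {q : Param} {B C : Type*} [Ring B] [Algebra ℂ B] [Ring C] [Algebra ℂ C]

lemma qc_add_ne (q : Param) : qc q + (qc q)⁻¹ ≠ 0 := by
  have h0 : (0 : ℝ) < q := q.2.1
  have h3 : qc q + (qc q)⁻¹ = (((q : ℝ) + (q : ℝ)⁻¹ : ℝ) : ℂ) := by simp [qc]
  rw [h3]
  have : (0 : ℝ) < (q : ℝ) + (q : ℝ)⁻¹ := by positivity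
  exact_mod_cast this.ne'

lemma antisymm_of_tcoef {M : Type*} [AddCommGroup M] [Module ℂ M] (g : Fin 3 × Fin 3 → M)
    (h : ∀ p, ∑ s, tcoef q p s • g s = -((qc q)⁻¹ • g p)) :
    (∀ i, g (i, i) = 0) ∧ ∀ i j, i < j → g (j, i) = -(qc q • g (i, j)) := by
  constructor
  · intro i
    have := h (i, i)
    rw [sum_tcoef] at this
    simp only [if_true] at this
    have h2 : (qc q + (qc q)⁻¹) • g (i, i) = 0 := by
      rw [add_smul, this]; abel
    exact (smul_eq_zero.1 h2).resolve_left (qc_add_ne q)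
  · intro i j hij
    have := h (i, j)
    rw [sum_tcoef] at this
    simp only [hij.ne, hij, if_true, if_false] at this
    rw [← eq_sub_iff_add_eq] at this
    rw [this]
    module

lemma tcoef_qeps_left (p : Fin 3 × Fin 3) (c : Fin 3) :
    ∑ s : Fin 3 × Fin 3, tcoef q p s * qeps q s.1 s.2 c = -((qc q)⁻¹ * qeps q p.1 p.2 c) := by
  have hq := qc_ne q
  obtain ⟨a, b⟩ := p
  have := sum_tcoef (q := q) (fun s => qeps q s.1 s.2 c) a b
  simp only [smul_eq_mul] at this
  rw [this]
  fin_cases a <;> fin_cases b <;> fin_cases c <;> simp [qeps] <;> field_simp <;> ring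

lemma tcoef_qeps_right (p : Fin 3 × Fin 3) (c : Fin 3) :
    ∑ s : Fin 3 × Fin 3, tcoef q p s * qeps q c s.1 s.2 = -((qc q)⁻¹ * qeps q c p.1 p.2) := by
  have hq := qc_ne q
  obtain ⟨a, b⟩ := p
  have := sum_tcoef (q := q) (fun s => qeps q c s.1 s.2) a b
  simp only [smul_eq_mul] at this
  rw [this]
  fin_cases a <;> fin_cases b <;> fin_cases c <;> simp [qeps] <;> field_simp <;> ring

/-- An array whose tensor square commutes with the braid matrix preserves eigenvectors. -/
lemma braid_eigen {x : Fin 3 → Fin 3 → B} (h : tmat q B * sq x = sq x * tmat q B)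
    (w : Fin 3 × Fin 3 → ℂ) (hw : ∀ p, ∑ s, tcoef q p s * w s = -((qc q)⁻¹ * w p)) :
    (∀ i, ∑ r : Fin 3 × Fin 3, w r • (x i r.1 * x i r.2) = 0) ∧
    ∀ i j, i < j → ∑ r : Fin 3 × Fin 3, w r • (x j r.1 * x i r.2)
      = -(qc q • ∑ r : Fin 3 × Fin 3, w r • (x i r.1 * x j r.2)) := by
  apply antisymm_of_tcoef (q := q)
    (fun p : Fin 3 × Fin 3 => ∑ r : Fin 3 × Fin 3, w r • (x p.1 r.1 * x p.2 r.2))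
  intro p
  have e1 : ∀ r, ∑ s, tcoef q p s • (x s.1 r.1 * x s.2 r.2)
      = ∑ s, tcoef q r s • (x p.1 s.1 * x p.2 s.2) := by
    intro r
    have := congrFun (congrFun h p) r
    rw [tmat_mul, mul_tmat] at this
    exact this
  calc ∑ s, tcoef q p s • ∑ r : Fin 3 × Fin 3, w r • (x s.1 r.1 * x s.2 r.2)
      = ∑ r, w r • ∑ s, tcoef q p s • (x s.1 r.1 * x s.2 r.2) := by
        simp only [Finset.smul_sum]
        rw [Finset.sum_comm]
        refine Finset.sum_congr rfl fun _ _ => Finset.sum_congr rfl fun _ _ => ?_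
        rw [smul_comm]
    _ = ∑ r, w r • ∑ s, tcoef q r s • (x p.1 s.1 * x p.2 s.2) := by simp only [e1]
    _ = ∑ s, (∑ r, tcoef q s r * w r) • (x p.1 s.1 * x p.2 s.2) := by
        simp only [Finset.smul_sum, Finset.sum_smul]
        rw [Finset.sum_comm]
        refine Finset.sum_congr rfl fun s _ => Finset.sum_congr rfl fun r _ => ?_
        rw [smul_smul, mul_comm, tcoef_symm]
    _ = _ := by
        simp only [hw, neg_smul, Finset.sum_neg_distrib, Finset.smul_sum, smul_smul]

/-- The `q`-antisymmetric tensor is an eigenvector of the tensor cube. -/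
lemma cube_qeps {x : Fin 3 → Fin 3 → B} (h : tmat q B * sq x = sq x * tmat q B) (a b c : Fin 3) :
    ∑ d, ∑ e, ∑ f, qeps q d e f • (x a d * x b e * x c f) = qeps q a b c • qdet q x := by
  have hl : ∀ a b c, ∑ d, ∑ e, ∑ f, qeps q d e f • (x a d * x b e * x c f)
      = ∑ f, (∑ r : Fin 3 × Fin 3, qeps q r.1 r.2 f • (x a r.1 * x b r.2)) * x c f := by
    intro a b c
    simp only [Fintype.sum_prod_type, Finset.sum_mul, smul_mul_assoc]
    refine Eq.symm ?_
    rw [Finset.sum_comm]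
    refine Finset.sum_congr rfl fun d _ => ?_
    rw [Finset.sum_comm]
  have hr : ∀ a b c, ∑ d, ∑ e, ∑ f, qeps q d e f • (x a d * x b e * x c f)
      = ∑ d, x a d * (∑ r : Fin 3 × Fin 3, qeps q d r.1 r.2 • (x b r.1 * x c r.2)) := by
    intro a b c
    simp only [Fintype.sum_prod_type, Finset.mul_sum, mul_smul_comm, mul_assoc]
  rw [qdet_eq]
  refine eq_qeps_smul
    (fun a b c => ∑ d, ∑ e, ∑ f, qeps q d e f • (x a d * x b e * x c f)) ?_ ?_ ?_ ?_ a b c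
  · intro a c
    simp only [hl]
    refine Finset.sum_eq_zero fun f _ => ?_
    rw [(braid_eigen h (fun r => qeps q r.1 r.2 f) (fun p => tcoef_qeps_left p f)).1, zero_mul]
  · intro a b c hab
    simp only [hl]
    rw [Finset.smul_sum, ← Finset.sum_neg_distrib]
    refine Finset.sum_congr rfl fun f _ => ?_
    rw [(braid_eigen h (fun r => qeps q r.1 r.2 f) (fun p => tcoef_qeps_left p f)).2 a b hab,
      neg_mul, smul_mul_assoc]
  · intro a b
    simp only [hr]
    refine Finset.sum_eq_zero fun f _ => ?_
    rw [(braid_eigen h (fun r => qeps q f r.1 r.2) (fun p => tcoef_qeps_right p f)).1, mul_zero]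
  · intro a b c hbc
    simp only [hr]
    rw [Finset.smul_sum, ← Finset.sum_neg_distrib]
    refine Finset.sum_congr rfl fun f _ => ?_
    rw [(braid_eigen h (fun r => qeps q f r.1 r.2) (fun p => tcoef_qeps_right p f)).2 b c hbc,
      mul_neg, mul_smul_comm]

lemma braid_transpose {x : Fin 3 → Fin 3 → B} (h : tmat q B * sq x = sq x * tmat q B) :
    tmat q B * sq (fun i j => x j i) = sq (fun i j => x j i) * tmat q B := by
  ext p r
  have := congrFun (congrFun h r) p
  rw [tmat_mul, mul_tmat] at this ⊢
  exact this.symm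

lemma qeps_sq_ne (q : Param) : ∑ a, ∑ b, ∑ c, qeps q a b c * qeps q a b c ≠ 0 := by
  have h0 : (0 : ℝ) < q := q.2.1
  have : ∑ a, ∑ b, ∑ c, qeps q a b c * qeps q a b c
      = ((1 + 2 * (q : ℝ) ^ 2 + 2 * (q : ℝ) ^ 4 + (q : ℝ) ^ 6 : ℝ) : ℂ) := by
    simp [Fin.sum_univ_three, qeps, qc]
    ring
  rw [this]
  have h2 : (0 : ℝ) < 1 + 2 * (q : ℝ) ^ 2 + 2 * (q : ℝ) ^ 4 + (q : ℝ) ^ 6 := by positivity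
  exact_mod_cast h2.ne'

lemma qdet_transpose {x : Fin 3 → Fin 3 → B} (h : tmat q B * sq x = sq x * tmat q B) :
    qdet q (fun i j => x j i) = qdet q x := by
  have e1 : ∑ a, ∑ b, ∑ c, qeps q a b c • ∑ d, ∑ e, ∑ f, qeps q d e f • (x a d * x b e * x c f)
      = (∑ a, ∑ b, ∑ c, qeps q a b c * qeps q a b c) • qdet q x := by
    simp only [cube_qeps h, smul_smul, Finset.sum_smul]
  have e2 : ∑ a, ∑ b, ∑ c, qeps q a b c • ∑ d, ∑ e, ∑ f, qeps q d e f • (x d a * x e b * x f c)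
      = (∑ a, ∑ b, ∑ c, qeps q a b c * qeps q a b c) • qdet q (fun i j => x j i) := by
    have := cube_qeps (braid_transpose h)
    simp only [this, smul_smul, Finset.sum_smul]
  have e3 : ∑ a, ∑ b, ∑ c, qeps q a b c • ∑ d, ∑ e, ∑ f, qeps q d e f • (x d a * x e b * x f c)
      = ∑ a, ∑ b, ∑ c, qeps q a b c • ∑ d, ∑ e, ∑ f, qeps q d e f • (x a d * x b e * x c f) := by
    have r1 : ∀ y : Fin 3 → Fin 3 → Fin 3 → Fin 3 → Fin 3 → Fin 3 → B,
        ∑ a, ∑ b, ∑ c, qeps q a b c • ∑ d, ∑ e, ∑ f, qeps q d e f • y a b c d e f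
        = ∑ p : Fin 3 × Fin 3 × Fin 3, ∑ r : Fin 3 × Fin 3 × Fin 3,
          (qeps q p.1 p.2.1 p.2.2 * qeps q r.1 r.2.1 r.2.2) • y p.1 p.2.1 p.2.2 r.1 r.2.1 r.2.2 := by
      intro y
      simp only [Fintype.sum_prod_type, Finset.smul_sum, smul_smul]
    rw [r1, r1, Finset.sum_comm]
    refine Finset.sum_congr rfl fun _ _ => Finset.sum_congr rfl fun _ _ => ?_
    rw [mul_comm (qeps q _ _ _)]
  rw [e2, e1] at e3
  exact smul_right_injective _ (qeps_sq_ne q) e3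

/-! ### The coproduct of `A(SU_q(3))` -/

lemma isARep_mul {x y : Fin 3 → Fin 3 → B} (hx : IsARep q x) (hy : IsARep q y)
    (hxy : ∀ i j k l, y i j * x k l = x k l * y i j) :
    IsARep q (fun i j => ∑ k, x i k * y k j) := by
  have h1 : sq (fun i j => ∑ k, x i k * y k j) = sq x * sq y := by
    ext ⟨i, j⟩ ⟨k, l⟩
    simp only [sq, Matrix.of_apply, Matrix.mul_apply, Fintype.sum_prod_type]
    rw [Finset.sum_mul_sum]
    refine Finset.sum_congr rfl fun a _ => Finset.sum_congr rfl fun b _ => ?_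
    rw [mul_assoc, ← mul_assoc (y a k), hxy]
    simp only [mul_assoc]
  apply isARep_of_braid
  · rw [h1, ← mul_assoc, hx.braid, mul_assoc, hy.braid, mul_assoc]
  · rw [qdet_eq]
    have e : ∀ a b c, (∑ k, x 0 k * y k a) * (∑ k, x 1 k * y k b) * (∑ k, x 2 k * y k c)
        = ∑ d, ∑ e, ∑ f, (x 0 d * x 1 e * x 2 f) * (y d a * y e b * y f c) := by
      intro a b c
      rw [Finset.sum_mul_sum, Finset.sum_mul]
      refine Finset.sum_congr rfl fun d _ => ?_
      rw [Finset.sum_mul_sum]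
      refine Finset.sum_congr rfl fun e _ => Finset.sum_congr rfl fun f _ => ?_
      calc x 0 d * y d a * (x 1 e * y e b) * (x 2 f * y f c)
          = x 0 d * (y d a * x 1 e) * (y e b * x 2 f) * y f c := by simp only [mul_assoc]
        _ = x 0 d * x 1 e * (y d a * x 2 f) * y e b * y f c := by
            rw [hxy, hxy]; simp only [mul_assoc]
        _ = _ := by rw [hxy]; simp only [mul_assoc]
    have r1 : ∀ z : Fin 3 → Fin 3 → Fin 3 → Fin 3 → Fin 3 → Fin 3 → B,
        ∑ a, ∑ b, ∑ c, qeps q a b c • ∑ d, ∑ e, ∑ f, z a b c d e f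
        = ∑ d, ∑ e, ∑ f, ∑ a, ∑ b, ∑ c, qeps q a b c • z a b c d e f := by
      intro z
      have t1 : ∑ a, ∑ b, ∑ c, qeps q a b c • ∑ d, ∑ e, ∑ f, z a b c d e f
        = ∑ p : Fin 3 × Fin 3 × Fin 3, ∑ r : Fin 3 × Fin 3 × Fin 3,
          qeps q p.1 p.2.1 p.2.2 • z p.1 p.2.1 p.2.2 r.1 r.2.1 r.2.2 := by
        simp only [Fintype.sum_prod_type, Finset.smul_sum]
      rw [t1, Finset.sum_comm]
      simp only [Fintype.sum_prod_type]
    simp only [e]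
    rw [r1]
    have hc := cube_qeps hy.braid
    have : ∀ d e f, ∑ a, ∑ b, ∑ c, qeps q a b c • ((x 0 d * x 1 e * x 2 f)
        * (y d a * y e b * y f c)) = qeps q d e f • (x 0 d * x 1 e * x 2 f) := by
      intro d e f
      have h3 := congrArg (x 0 d * x 1 e * x 2 f * ·) (hc d e f)
      simp only [Finset.mul_sum, mul_smul_comm, hy.det, mul_one] at h3
      exact h3
    simp only [this]
    rw [← qdet_eq, hx.det]

lemma IsARep.map {x : Fin 3 → Fin 3 → B} (h : IsARep q x) (φ : B →ₐ[ℂ] C) :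
    IsARep q (fun i j => φ (x i j)) := by
  constructor
  · intro i j k hij; simpa using congrArg φ (h.col i j k hij)
  · intro i j k hij; simpa using congrArg φ (h.row i j k hij)
  · intro i j k l hij hkl; simpa using congrArg φ (h.comm i j k l hij hkl)
  · intro i j k l hij hkl; simpa using congrArg φ (h.diag i j k l hij hkl)
  · rw [← map_qdet, h.det, map_one]

end

lemma isARep_comul (q : Param) :
    IsARep q (B := A q ⊗[ℂ] A q) (fun i j => ∑ k, u q i k ⊗ₜ u q k j) := by
  have h1 := (isARep_u q).map (Algebra.TensorProduct.includeLeft : A q →ₐ[ℂ] A q ⊗[ℂ] A q)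
  have h2 := (isARep_u q).map (Algebra.TensorProduct.includeRight : A q →ₐ[ℂ] A q ⊗[ℂ] A q)
  have := isARep_mul h1 h2 (by intro i j k l; simp)
  simpa using this

/-- The coproduct of `A(SU_q(3))`: `Δ(u^i_j) = ∑_k u^i_k ⊗ u^k_j`. -/
def comulA (q : Param) : A q →ₐ[ℂ] A q ⊗[ℂ] A q := Alift (isARep_comul q)

@[simp] lemma comulA_u (q : Param) (i j : Fin 3) :
    comulA q (u q i j) = ∑ k, u q i k ⊗ₜ u q k j := Alift_u _ i j

/-! ### The dual pairing and the right canonical action -/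

set_option maxHeartbeats 2000000 in
lemma isURep_rho (q : Param) : IsURep q (B := Matrix (Fin 3) (Fin 3) ℂ)
    (fun i => Matrix.diagonal fun j =>
      if j = i.succ then qh q else if j = i.castSucc then (qh q)⁻¹ else 1)
    (fun i => Matrix.diagonal fun j =>
      if j = i.succ then (qh q)⁻¹ else if j = i.castSucc then qh q else 1)
    (fun i => Matrix.single i.succ i.castSucc 1) (fun i => Matrix.single i.castSucc i.succ 1) := by
  have hh := qh_ne q
  have hq := qc_ne q
  have hs := qc_sub_ne q
  constructor
  · intro i; fin_cases i <;> ext a b <;> fin_cases a <;> fin_cases b <;>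
      simp [Matrix.mul_apply, Fin.sum_univ_three, Matrix.diagonal, hh]
  · intro i; fin_cases i <;> ext a b <;> fin_cases a <;> fin_cases b <;>
      simp [Matrix.mul_apply, Fin.sum_univ_three, Matrix.diagonal, hh]
  · intro i j; rw [Matrix.diagonal_mul_diagonal, Matrix.diagonal_mul_diagonal]
    simp only [mul_comm]
  · intro i
    have h1 : (qc q - (qc q)⁻¹)⁻¹ * (qh q * qh q - (qh q)⁻¹ * (qh q)⁻¹) = 1 := by
      rw [← mul_inv, ← qc_eq, inv_mul_cancel₀ hs]
    have h2 : (qc q - (qc q)⁻¹)⁻¹ * ((qh q)⁻¹ * (qh q)⁻¹ - qh q * qh q) = -1 := by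
      rw [← h1]; ring
    rw [pow_two, pow_two, Matrix.diagonal_mul_diagonal, Matrix.diagonal_mul_diagonal]
    fin_cases i <;> ext a b <;> fin_cases a <;> fin_cases b <;>
      simp [Matrix.single, Matrix.mul_apply, Fin.sum_univ_three, Matrix.diagonal, -mul_inv_rev,
        h1, h2]
  · intro i j hij
    fin_cases i <;> fin_cases j <;> simp at hij <;> ext a b <;> fin_cases a <;> fin_cases b <;>
      simp [Matrix.single, Matrix.mul_apply, Fin.sum_univ_three]
  · intro i
    fin_cases i <;> ext a b <;> fin_cases a <;> fin_cases b <;>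
      simp [Matrix.single, Matrix.mul_apply, Fin.sum_univ_three, Matrix.diagonal, qc_eq]
  · intro i j hij
    fin_cases i <;> fin_cases j <;> simp at hij <;> ext a b <;> fin_cases a <;> fin_cases b <;>
      simp [Matrix.single, Matrix.mul_apply, Fin.sum_univ_three, Matrix.diagonal]
  · intro i
    fin_cases i <;> ext a b <;> fin_cases a <;> fin_cases b <;>
      simp [Matrix.single, Matrix.mul_apply, Fin.sum_univ_three, Matrix.diagonal, qc_eq]
  · intro i j hij
    fin_cases i <;> fin_cases j <;> simp at hij <;> ext a b <;> fin_cases a <;> fin_cases b <;>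
      simp [Matrix.single, Matrix.mul_apply, Fin.sum_univ_three, Matrix.diagonal]
  · intro i j hij
    fin_cases i <;> fin_cases j <;> simp at hij <;> ext a b <;> fin_cases a <;> fin_cases b <;>
      simp [pow_two, Matrix.single, Matrix.mul_apply, Fin.sum_univ_three]
  · intro i j hij
    fin_cases i <;> fin_cases j <;> simp at hij <;> ext a b <;> fin_cases a <;> fin_cases b <;>
      simp [pow_two, Matrix.single, Matrix.mul_apply, Fin.sum_univ_three]

/-- The fundamental representation of `U_q(su(3))`: `K_i` is diagonal with entries `q^(-1/2)`,
`q^(1/2)` in positions `i`, `i + 1` and `1` elsewhere, `E_i` is the matrix unit `(i + 1, i)` and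
`F_i` is the matrix unit `(i, i + 1)`. -/
def rho (q : Param) : U q →ₐ[ℂ] Matrix (Fin 3) (Fin 3) ℂ := Ulift (isURep_rho q)

section
variable {q : Param}

open Coalgebra WithConv

/-- The Hopf tensor product of two matrix representations. -/
def tensorRep {m n : Type*} [Fintype m] [DecidableEq m] [Fintype n] [DecidableEq n]
    (α : U q →ₐ[ℂ] Matrix m m ℂ) (β : U q →ₐ[ℂ] Matrix n n ℂ) :
    U q →ₐ[ℂ] Matrix (m × n) (m × n) ℂ :=
  (Matrix.kroneckerAlgEquiv m n ℂ).toAlgHom.comp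
    ((Algebra.TensorProduct.map α β).comp (comulHom q))

/-- The matrix coefficients of a representation, as elements of the convolution algebra. -/
def coeff {m : Type*} [Fintype m] [DecidableEq m] (α : U q →ₐ[ℂ] Matrix m m ℂ) (i j : m) :
    WithConv (U q →ₗ[ℂ] ℂ) :=
  toConv (Matrix.entryLinearMap ℂ ℂ i j ∘ₗ α.toLinearMap)

@[simp] lemma coeff_apply {m : Type*} [Fintype m] [DecidableEq m] (α : U q →ₐ[ℂ] Matrix m m ℂ)
    (i j : m) (h : U q) : (coeff α i j) h = α h i j := rfl

lemma coeff_mul {m n : Type*} [Fintype m] [DecidableEq m] [Fintype n] [DecidableEq n]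
    (α : U q →ₐ[ℂ] Matrix m m ℂ) (β : U q →ₐ[ℂ] Matrix n n ℂ) (i j : m) (k l : n) :
    coeff α i j * coeff β k l = coeff (tensorRep α β) (i, k) (j, l) := by
  ext h
  rw [LinearMap.convMul_apply, coeff_apply]
  simp only [tensorRep, AlgHom.comp_apply, comul_eq]
  generalize comulHom q h = t
  induction t with
  | zero => simp
  | tmul a b => simp [coeff]
  | add x y hx hy =>
    simp only [map_add, hx, hy]
    rfl

set_option maxHeartbeats 4000000 in
lemma rho_comm_tmat (h : U q) :
    tmat q ℂ * tensorRep (rho q) (rho q) h = tensorRep (rho q) (rho q) h * tmat q ℂ := by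
  have hh := qh_ne q
  have hq := qc_ne q
  let T : Subalgebra ℂ (U q) :=
    (Subalgebra.centralizer ℂ {tmat q ℂ}).comap (tensorRep (rho q) (rho q))
  have hmem : ∀ x : U q, tmat q ℂ * tensorRep (rho q) (rho q) x
      = tensorRep (rho q) (rho q) x * tmat q ℂ → x ∈ T := by
    intro x hx
    rw [Subalgebra.mem_comap, Subalgebra.mem_centralizer_iff]
    intro g hg
    rw [Set.mem_singleton_iff.1 hg, hx]
  have hT : h ∈ T := by
    refine U_subalgebra_eq_top T ?_ ?_ ?_ ?_ h <;> intro i <;> apply hmem <;>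
      ext ⟨a, b⟩ ⟨c, d⟩ <;> rw [tmat_mul, mul_tmat, sum_tcoef, sum_tcoef] <;>
      simp only [tensorRep, AlgHom.comp_apply, comulHom, Ulift_K, Ulift_Kinv, Ulift_E, Ulift_F,
        rho, map_add, Algebra.TensorProduct.map_tmul] <;>
      fin_cases i <;> fin_cases a <;> fin_cases b <;> fin_cases c <;> fin_cases d <;>
      simp [Matrix.diagonal, Matrix.single, qc_eq] <;> field_simp <;> ring
  rw [Subalgebra.mem_comap, Subalgebra.mem_centralizer_iff] at hT
  exact hT _ rfl

end

section
variable {q : Param}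

open Coalgebra WithConv

lemma conv_sum_apply {ι : Type*} (s : Finset ι) (f : ι → WithConv (U q →ₗ[ℂ] ℂ)) (h : U q) :
    (∑ i ∈ s, f i) h = ∑ i ∈ s, f i h := by
  change (∑ i ∈ s, f i).ofConv h = _
  rw [ofConv_sum, LinearMap.sum_apply]

lemma conv_smul_apply (c : ℂ) (f : WithConv (U q →ₗ[ℂ] ℂ)) (h : U q) :
    (c • f) h = c • f h := rfl

lemma coeff_braid : tmat q (WithConv (U q →ₗ[ℂ] ℂ)) * sq (coeff (rho q))
    = sq (coeff (rho q)) * tmat q (WithConv (U q →ₗ[ℂ] ℂ)) := by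
  ext p r h
  rw [tmat_mul, mul_tmat]
  have := congrFun (congrFun (rho_comm_tmat h) p) r
  rw [tmat_mul, mul_tmat] at this
  simpa only [conv_sum_apply, conv_smul_apply, sq, Matrix.of_apply, coeff_mul, coeff_apply]
    using this

/-- The tensor cube of the fundamental representation. -/
def rho3 (q : Param) : U q →ₐ[ℂ] Matrix ((Fin 3 × Fin 3) × Fin 3) ((Fin 3 × Fin 3) × Fin 3) ℂ :=
  tensorRep (tensorRep (rho q) (rho q)) (rho q)

/-- The `q`-antisymmetric tensor as a vector. -/
def qvec (q : Param) (p : (Fin 3 × Fin 3) × Fin 3) : ℂ := qeps q p.1.1 p.1.2 p.2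

lemma rho3_mulVec (h : U q) :
    (rho3 q h).mulVec (qvec q) = (qdet q (coeff (rho q))) h • qvec q := by
  funext p
  obtain ⟨⟨a, b⟩, c⟩ := p
  have := congrArg (fun F : WithConv (U q →ₗ[ℂ] ℂ) => F h) (cube_qeps (coeff_braid (q := q)) a b c)
  simp only [conv_sum_apply, conv_smul_apply, coeff_mul, coeff_apply] at this
  simp only [Matrix.mulVec, dotProduct, Fintype.sum_prod_type, qvec, Pi.smul_apply, rho3,
    smul_eq_mul]
  rw [mul_comm, ← smul_eq_mul (a := qeps q a b c), ← this]
  simp only [smul_eq_mul, mul_comm]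

lemma qdet_coeff_apply (h : U q) :
    (qdet q (coeff (rho q))) h = (rho3 q h).mulVec (qvec q) ((0, 1), 2) := by
  rw [rho3_mulVec]
  simp [qvec, qeps]

set_option maxHeartbeats 2000000 in
lemma qdet_coeff : qdet q (coeff (rho q)) = 1 := by
  have hh := qh_ne q
  have hmul : ∀ x y : U q, (qdet q (coeff (rho q))) (x * y)
      = (qdet q (coeff (rho q))) x * (qdet q (coeff (rho q))) y := by
    intro x y
    rw [qdet_coeff_apply, map_mul, ← Matrix.mulVec_mulVec, rho3_mulVec y, Matrix.mulVec_smul,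
      Pi.smul_apply, ← qdet_coeff_apply, smul_eq_mul, mul_comm]
  have hone : (qdet q (coeff (rho q))) (1 : U q) = 1 := by
    rw [qdet_coeff_apply, map_one, Matrix.one_mulVec]
    simp [qvec, qeps]
  have key : AlgHom.ofLinearMap (qdet q (coeff (rho q))).ofConv hone hmul = counitHom q := by
    apply U_hom_ext <;> intro i <;>
      change (qdet q (coeff (rho q))) _ = _ <;> rw [qdet_coeff_apply] <;>
      simp only [rho3, tensorRep, AlgHom.comp_apply, comulHom, Ulift_K, Ulift_Kinv, Ulift_E,
        Ulift_F, rho, map_add, Algebra.TensorProduct.map_tmul, counitHom] <;>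
      fin_cases i <;>
      simp [Matrix.mulVec, dotProduct, Fintype.sum_prod_type, Fin.sum_univ_three, qvec, qeps,
        Matrix.diagonal, Matrix.single, hh]
  ext h
  exact congrArg (fun F : U q →ₐ[ℂ] ℂ => F h) key

end

lemma isARep_coeff (q : Param) : IsARep q (coeff (rho q)) :=
  isARep_of_braid coeff_braid qdet_coeff

/-- The dual pairing, as the algebra homomorphism `a ↦ ⟨·, a⟩` from `A(SU_q(3))` to the
convolution algebra of linear forms on `U_q(su(3))`; on generators it is
`⟨h, u^i_j⟩ = ρ(h)_{ij}`. -/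
def pairingHom (q : Param) : A q →ₐ[ℂ] WithConv (U q →ₗ[ℂ] ℂ) := Alift (isARep_coeff q)

/-- The dual pairing `⟨h, a⟩`, with arguments in the order `a`, `h`. -/
def pairing (q : Param) : A q →ₗ[ℂ] U q →ₗ[ℂ] ℂ :=
  (WithConv.linearEquiv ℂ (U q →ₗ[ℂ] ℂ)).toLinearMap ∘ₗ (pairingHom q).toLinearMap

/-- The contraction `a ⊗ b ↦ (h ↦ ⟨h, a⟩ b)`. -/
def contr (q : Param) : A q ⊗[ℂ] A q →ₗ[ℂ] U q →ₗ[ℂ] A q :=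
  TensorProduct.lift
    (LinearMap.mk₂ ℂ (fun a b : A q => (pairing q a).smulRight b)
      (fun a a' b => by ext h; simp [add_smul]) (fun c a b => by ext h; simp [mul_smul])
      (fun a b b' => by ext h; simp) (fun c a b => by ext h; simp [smul_comm c]))

/-- The right canonical action `a ◁ h = ⟨h, a₍₁₎⟩ a₍₂₎`. -/
def ract (q : Param) : A q →ₗ[ℂ] U q →ₗ[ℂ] A q := contr q ∘ₗ (comulA q).toLinearMap

section
variable (q : Param)

lemma pairing_u (i j : Fin 3) (h : U q) : pairing q (u q i j) h = rho q h i j := by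
  simp [pairing, pairingHom]

lemma pairing_mul (a b : A q) (h : U q) : pairing q (a * b) h
    = LinearMap.mul' ℂ ℂ (TensorProduct.map (pairing q a) (pairing q b)
      (Coalgebra.comul (R := ℂ) h)) := by
  simp [pairing]

lemma pairing_one (h : U q) : pairing q 1 h = Coalgebra.counit (R := ℂ) h := by
  simp [pairing]

@[simp] lemma contr_tmul (a b : A q) (h : U q) :
    contr q (a ⊗ₜ b) h = pairing q a h • b := by simp [contr]

lemma ract_eq (a : A q) (h : U q) : ract q a h = contr q (comulA q a) h := rfl

lemma contr_mul (s t : A q ⊗[ℂ] A q) (h : U q) : contr q (s * t) h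
    = LinearMap.mul' ℂ (A q) (TensorProduct.map (contr q s) (contr q t)
      (Coalgebra.comul (R := ℂ) h)) := by
  induction s with
  | zero => simp
  | add x y hx hy => simp [add_mul, TensorProduct.map_add_left, hx, hy]
  | tmul a b =>
    induction t with
    | zero => simp
    | add x y hx hy => simp [mul_add, TensorProduct.map_add_right, hx, hy]
    | tmul c d =>
      rw [Algebra.TensorProduct.tmul_mul_tmul, contr_tmul, pairing_mul]
      generalize Coalgebra.comul (R := ℂ) h = z
      induction z with
      | zero => simp
      | tmul x y => simp [smul_smul, mul_comm]
      | add x y hx hy => simp only [map_add, add_smul, hx, hy]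

/-- The action on the generators: `u^i_j ◁ h = ∑_k ρ(h)_{ik} u^k_j`. -/
lemma ract_u (i j : Fin 3) (h : U q) : ract q (u q i j) h = ∑ k, rho q h i k • u q k j := by
  simp [ract_eq, pairing_u]

/-- The right canonical action makes `A(SU_q(3))` a module algebra:
`(ab) ◁ h = (a ◁ h₍₁₎)(b ◁ h₍₂₎)`. -/
lemma ract_mul (a b : A q) (h : U q) : ract q (a * b) h
    = LinearMap.mul' ℂ (A q) (TensorProduct.map (ract q a) (ract q b)
      (Coalgebra.comul (R := ℂ) h)) := by
  rw [ract_eq, map_mul, contr_mul]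
  rfl

lemma ract_one (h : U q) : ract q 1 h = Coalgebra.counit (R := ℂ) h • (1 : A q) := by
  rw [ract_eq, map_one, Algebra.TensorProduct.one_def, contr_tmul, pairing_one]

end

/-! ### The quantum projective plane -/

/-- `A(CP²_q)`: the elements with `a ◁ h = ε(h) a` for all `h` in `U_q(u(2))`. -/
def CP2 (q : Param) : Subalgebra ℂ (A q) where
  carrier := {a | ∀ h ∈ Uu2 q, ract q a h = Coalgebra.counit (R := ℂ) h • a}
  mul_mem' := by
    intro a b ha hb h hh
    rw [ract_mul, ← inclTensor_comulU2 q ⟨h, hh⟩]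
    have key : ∀ t : Uu2 q ⊗[ℂ] Uu2 q,
        LinearMap.mul' ℂ (A q) (TensorProduct.map (ract q a) (ract q b) (inclTensor q t))
        = LinearMap.mul' ℂ ℂ (TensorProduct.map (Coalgebra.counit (R := ℂ) (A := U q))
          (Coalgebra.counit (R := ℂ) (A := U q)) (inclTensor q t)) • (a * b) := by
      intro t
      induction t with
      | zero => simp
      | tmul x y =>
        simp [inclTensor, ha x x.2, hb y y.2, smul_smul, mul_comm]
      | add x y hx hy => simp only [map_add, hx, hy, add_smul]
    rw [key, inclTensor_comulU2]
    congr 1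
    have h1 : LinearMap.mul' ℂ ℂ (TensorProduct.map (Coalgebra.counit (R := ℂ) (A := U q))
        (Coalgebra.counit (R := ℂ) (A := U q)) (Coalgebra.comul (R := ℂ) h))
        = ((1 : WithConv (U q →ₗ[ℂ] ℂ)) * 1) h := rfl
    rw [h1, one_mul]
    rfl
  add_mem' := by
    intro a b ha hb h hh
    rw [map_add, LinearMap.add_apply, ha h hh, hb h hh, smul_add]
  algebraMap_mem' := by
    intro c h _
    rw [Algebra.algebraMap_eq_smul_one, map_smul, LinearMap.smul_apply, ract_one, smul_comm]

/-! ### The involution of `A(SU_q(3))` -/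

section
variable {q : Param} {B : Type*} [Ring B] [Algebra ℂ B]

/-- The smaller of the two elements of the complement of `{i}` in `{0, 1, 2}`. -/
def lo (i : Fin 3) : Fin 3 := if i = 0 then 1 else 0

/-- The larger of the two elements of the complement of `{i}` in `{0, 1, 2}`. -/
def hi (i : Fin 3) : Fin 3 := if i = 2 then 1 else 2

/-- The quantum cofactor: `(-q)^(j-i) (u^{k₁}_{l₁} u^{k₂}_{l₂} - q u^{k₁}_{l₂} u^{k₂}_{l₁})` with
`{k₁ < k₂}` the complement of `{i}` and `{l₁ < l₂}` the complement of `{j}`. -/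
def cof (q : Param) (x : Fin 3 → Fin 3 → B) (i j : Fin 3) : B :=
  (-qc q) ^ ((j : ℤ) - (i : ℤ)) •
    (x (lo i) (lo j) * x (hi i) (hi j) - qc q • (x (lo i) (hi j) * x (hi i) (lo j)))

lemma cof_row (x : Fin 3 → Fin 3 → B) (i j : Fin 3) :
    ∑ e, ∑ f, qeps q j e f • (x (lo i) e * x (hi i) f) = (-qc q) ^ (i : ℕ) • cof q x i j := by
  have hq : -qc q ≠ 0 := neg_ne_zero.2 (qc_ne q)
  rw [cof, smul_smul, ← zpow_natCast, ← zpow_add₀ hq, add_sub_cancel, zpow_natCast]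
  fin_cases j <;> simp [Fin.sum_univ_three, qeps, lo, hi] <;> module

lemma cof_col {x : Fin 3 → Fin 3 → B} (h : IsARep q x) (i j : Fin 3) :
    ∑ d, ∑ e, qeps q d e i • (x d (lo j) * x e (hi j))
      = (-qc q) ^ (2 - (j : ℤ)) • cof q x i j := by
  have hq : -qc q ≠ 0 := neg_ne_zero.2 (qc_ne q)
  have hlt : ∀ i, lo i < hi i := by decide
  rw [cof, smul_smul, ← zpow_add₀ hq, sub_add_sub_cancel,
    sub_eq_zero.1 (h.comm (lo i) (hi i) (lo j) (hi j) (hlt i) (hlt j))]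
  fin_cases i <;> simp [Fin.sum_univ_three, qeps, lo, hi] <;> module

lemma mul_cof {x : Fin 3 → Fin 3 → B} (h : IsARep q x) (a b : Fin 3) :
    ∑ j, x a j * cof q x b j = if a = b then 1 else 0 := by
  have hq : (-qc q) ^ (b : ℕ) ≠ 0 := pow_ne_zero _ (neg_ne_zero.2 (qc_ne q))
  apply smul_right_injective B hq
  have h1 := cube_qeps h.braid a (lo b) (hi b)
  rw [h.det] at h1
  have h2 : qeps q a (lo b) (hi b) • (1 : B) = (-qc q) ^ (b : ℕ) • (if a = b then 1 else 0) := by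
    fin_cases a <;> fin_cases b <;> simp [qeps, lo, hi]
  simp only
  rw [← h2, ← h1, Finset.smul_sum]
  refine Finset.sum_congr rfl fun d _ => ?_
  rw [← mul_smul_comm, ← cof_row]
  simp only [Finset.mul_sum, mul_smul_comm, mul_assoc]

lemma cof_mul {x : Fin 3 → Fin 3 → B} (h : IsARep q x) (a b : Fin 3) :
    ∑ i, cof q x i a * x i b = if a = b then 1 else 0 := by
  have hq : (-qc q) ^ (2 - (a : ℤ)) ≠ 0 := zpow_ne_zero _ (neg_ne_zero.2 (qc_ne q))
  apply smul_right_injective B hq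
  have h1 := cube_qeps (braid_transpose h.braid) (lo a) (hi a) b
  rw [qdet_transpose h.braid, h.det] at h1
  have h2 : qeps q (lo a) (hi a) b • (1 : B)
      = (-qc q) ^ (2 - (a : ℤ)) • (if a = b then 1 else 0) := by
    fin_cases a <;> fin_cases b <;> simp [qeps, lo, hi]
  have h3 : ∑ d, ∑ e, ∑ f, qeps q d e f • (x d (lo a) * x e (hi a) * x f b)
      = ∑ f, ∑ d, ∑ e, qeps q d e f • (x d (lo a) * x e (hi a) * x f b) := by
    simp only [Fin.sum_univ_three]; abel
  simp only
  rw [← h2, ← h1, h3, Finset.smul_sum]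
  refine Finset.sum_congr rfl fun d _ => ?_
  rw [← smul_mul_assoc, ← cof_col h]
  simp only [Finset.sum_mul, smul_mul_assoc]

end

/-- The opposite algebra of `A(SU_q(3))` with the complex conjugate scalar multiplication: its
points are those of `A(SU_q(3))`, and an algebra homomorphism into it is an antilinear
antimultiplicative map. -/
def ConjOp (q : Param) : Type := (A q)ᵐᵒᵖ

instance (q : Param) : Ring (ConjOp q) := inferInstanceAs (Ring (A q)ᵐᵒᵖ)
instance (q : Param) : Algebra ℂ (ConjOp q) :=
  Algebra.compHom (A q)ᵐᵒᵖ (starRingEnd ℂ)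

section
variable {q : Param}

/-- The identity map, as an additive equivalence. -/
def toConjOp (q : Param) : A q ≃+ ConjOp q := MulOpposite.opAddEquiv

lemma toConjOp_mul (a b : A q) : toConjOp q (a * b) = toConjOp q b * toConjOp q a := rfl

lemma toConjOp_one : toConjOp q 1 = 1 := rfl

lemma toConjOp_smul (c : ℂ) (a : A q) : toConjOp q (starRingEnd ℂ c • a) = c • toConjOp q a := rfl

lemma toConjOp_symm_mul (a b : ConjOp q) :
    (toConjOp q).symm (a * b) = (toConjOp q).symm b * (toConjOp q).symm a := rfl

lemma toConjOp_symm_smul (c : ℂ) (a : ConjOp q) :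
    (toConjOp q).symm (c • a) = starRingEnd ℂ c • (toConjOp q).symm a := rfl

lemma conj_tcoef (p r : Fin 3 × Fin 3) : starRingEnd ℂ (tcoef q p r) = tcoef q p r := by
  unfold tcoef
  split_ifs <;> simp [conj_qc]

lemma conj_qeps (a b c : Fin 3) : starRingEnd ℂ (qeps q a b c) = qeps q a b c := by
  unfold qeps
  split_ifs <;> simp [conj_qc]

/-- The tensor square of the inverse matrix. -/
def cofSq (q : Param) : Matrix (Fin 3 × Fin 3) (Fin 3 × Fin 3) (A q) :=
  Matrix.of fun r p => cof q (u q) p.2 r.2 * cof q (u q) p.1 r.1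

lemma sq_mul_cofSq : sq (u q) * cofSq q = 1 := by
  ext ⟨a, b⟩ ⟨i, j⟩
  have h := mul_cof (isARep_u q)
  calc _ = ∑ k, u q a k * (∑ l, u q b l * cof q (u q) j l) * cof q (u q) i k := by
        simp only [Matrix.mul_apply, Fintype.sum_prod_type, sq, cofSq, Matrix.of_apply,
          Finset.mul_sum, Finset.sum_mul, mul_assoc]
    _ = _ := by
        rw [h b j]
        by_cases hbj : b = j
        · simp [hbj, h, Matrix.one_apply]
        · simp [hbj]

lemma cofSq_mul_sq : cofSq q * sq (u q) = 1 := by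
  ext ⟨k, l⟩ ⟨a, b⟩
  have h := cof_mul (isARep_u q)
  calc _ = ∑ j, cof q (u q) j l * (∑ i, cof q (u q) i k * u q i a) * u q j b := by
        simp only [Matrix.mul_apply, Fintype.sum_prod_type, sq, cofSq, Matrix.of_apply,
          Finset.mul_sum, Finset.sum_mul, mul_assoc]
        rw [Finset.sum_comm]
    _ = _ := by
        rw [h k a]
        by_cases hka : k = a
        · simp [hka, h, Matrix.one_apply]
        · simp [hka]

lemma cofSq_braid : cofSq q * tmat q (A q) = tmat q (A q) * cofSq q := by
  calc cofSq q * tmat q (A q) = cofSq q * tmat q (A q) * (sq (u q) * cofSq q) := by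
        rw [sq_mul_cofSq, mul_one]
    _ = cofSq q * (tmat q (A q) * sq (u q)) * cofSq q := by simp only [mul_assoc]
    _ = (cofSq q * sq (u q)) * tmat q (A q) * cofSq q := by
        rw [(isARep_u q).braid]; simp only [mul_assoc]
    _ = _ := by rw [cofSq_mul_sq, one_mul]

lemma isARep_star (q : Param) : IsARep q (fun i j => toConjOp q (cof q (u q) i j)) := by
  apply isARep_of_braid
  · ext p r
    have h := congrFun (congrFun (cofSq_braid (q := q)) r) p
    rw [tmat_mul, mul_tmat] at h ⊢
    have h2 := congrArg (toConjOp q) h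
    simp only [map_sum] at h2
    have e : ∀ (s t v : Fin 3 × Fin 3), toConjOp q (tcoef q s t • cofSq q v p)
        = tcoef q s t • toConjOp q (cofSq q v p) := by
      intro s t v
      rw [← toConjOp_smul, conj_tcoef]
    have e' : ∀ (s t v : Fin 3 × Fin 3), toConjOp q (tcoef q s t • cofSq q r v)
        = tcoef q s t • toConjOp q (cofSq q r v) := by
      intro s t v
      rw [← toConjOp_smul, conj_tcoef]
    simp only [e, e'] at h2
    exact h2
  · rw [qdet_eq]
    apply (toConjOp q).symm.injective
    have e : ∀ a b c, (toConjOp q).symm (qeps q a b c • (toConjOp q (cof q (u q) 0 a)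
        * toConjOp q (cof q (u q) 1 b) * toConjOp q (cof q (u q) 2 c)))
        = qeps q a b c • (cof q (u q) 2 c * (cof q (u q) 1 b * cof q (u q) 0 a)) := by
      intro a b c
      rw [toConjOp_symm_smul, conj_qeps]
      rfl
    have h := isARep_u q
    have h1 := cube_qeps (braid_transpose h.braid)
    rw [qdet_transpose h.braid, h.det] at h1
    have h0 : ∀ a b c, (∑ d, ∑ e, ∑ f, (u q a d * u q b e * u q c f) *
        (cof q (u q) 2 f * (cof q (u q) 1 e * cof q (u q) 0 d)))
        = (if a = 0 then 1 else 0) * ((if b = 1 then 1 else 0) * (if c = 2 then (1 : A q) else 0)) := by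
      intro a b c
      have hm := mul_cof h
      calc _ = ∑ d, u q a d * (∑ e, u q b e * (∑ f, u q c f * cof q (u q) 2 f)
            * cof q (u q) 1 e) * cof q (u q) 0 d := by
            simp only [Finset.mul_sum, Finset.sum_mul, mul_assoc]
        _ = _ := by
            rw [hm c 2]
            by_cases hc : c = 2 <;> by_cases hb : b = 1 <;> simp [hc, hb, hm]
    simp only [map_sum, e]
    have h3 : ∀ d e f, qeps q d e f • (cof q (u q) 2 f * (cof q (u q) 1 e * cof q (u q) 0 d))
        = ∑ a, ∑ b, ∑ c, qeps q a b c • ((u q a d * u q b e * u q c f) *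
        (cof q (u q) 2 f * (cof q (u q) 1 e * cof q (u q) 0 d))) := by
      intro d e f
      have h5 := congrArg (· * (cof q (u q) 2 f * (cof q (u q) 1 e * cof q (u q) 0 d))) (h1 d e f)
      simp only [Finset.sum_mul, smul_mul_assoc, one_mul] at h5
      exact h5.symm
    simp only [h3]
    have r1 : ∀ z : Fin 3 → Fin 3 → Fin 3 → Fin 3 → Fin 3 → Fin 3 → A q,
        ∑ d, ∑ e, ∑ f, ∑ a, ∑ b, ∑ c, qeps q a b c • z a b c d e f
        = ∑ a, ∑ b, ∑ c, qeps q a b c • ∑ d, ∑ e, ∑ f, z a b c d e f := by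
      intro z
      have t1 : ∑ d, ∑ e, ∑ f, ∑ a, ∑ b, ∑ c, qeps q a b c • z a b c d e f
        = ∑ r : Fin 3 × Fin 3 × Fin 3, ∑ p : Fin 3 × Fin 3 × Fin 3,
          qeps q p.1 p.2.1 p.2.2 • z p.1 p.2.1 p.2.2 r.1 r.2.1 r.2.2 := by
        simp only [Fintype.sum_prod_type]
      rw [t1, Finset.sum_comm]
      simp only [Fintype.sum_prod_type, Finset.smul_sum]
    rw [r1]
    simp only [h0]
    simp [qeps, ← toConjOp_one]

/-- The involution of `A(SU_q(3))`, as a homomorphism to the conjugate opposite algebra: it sends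
`u^i_j` to the quantum cofactor. -/
def starHom (q : Param) : A q →ₐ[ℂ] ConjOp q := Alift (isARep_star q)

instance : Star (A q) := ⟨fun a => (toConjOp q).symm (starHom q a)⟩

lemma star_def (a : A q) : star a = (toConjOp q).symm (starHom q a) := rfl

lemma star_u (i j : Fin 3) : star (u q i j) = cof q (u q) i j := by
  rw [star_def, starHom, Alift_u, AddEquiv.symm_apply_apply]

lemma star_mul_A (a b : A q) : star (a * b) = star b * star a := by
  simp only [star_def, map_mul, toConjOp_symm_mul]

lemma star_add_A (a b : A q) : star (a + b) = star a + star b := by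
  simp only [star_def, map_add]

lemma star_smul_A (c : ℂ) (a : A q) : star (c • a) = starRingEnd ℂ c • star a := by
  simp only [star_def, map_smul, toConjOp_symm_smul]

lemma star_one_A : star (1 : A q) = 1 := by
  simp only [star_def, map_one]; rfl

/-- The involution, applied twice, as an algebra homomorphism. -/
def starStar (q : Param) : A q →ₐ[ℂ] A q where
  toFun a := star (star a)
  map_one' := by simp only [star_one_A]
  map_mul' a b := by simp only [star_mul_A]
  map_zero' := by simp only [star_def, map_zero]
  map_add' a b := by simp only [star_add_A]
  commutes' c := by
    rw [Algebra.algebraMap_eq_smul_one, star_smul_A, star_smul_A, star_one_A, star_one_A,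
      Complex.conj_conj]

lemma star_cof (i j : Fin 3) : star (cof q (u q) i j) = u q i j := by
  have h := isARep_u q
  have h0 : star (0 : A q) = 0 := by simp only [star_def, map_zero]
  have hs : ∀ f : Fin 3 → A q, star (∑ k, f k) = ∑ k, star (f k) := by
    intro f; simp only [Fin.sum_univ_three, star_add_A]
  have h1 : ∀ a b, ∑ k, star (cof q (u q) b k) * cof q (u q) a k = if a = b then 1 else 0 := by
    intro a b
    have := congrArg star (mul_cof h a b)
    simp only [hs, star_mul_A, star_u, apply_ite star, star_one_A, h0] at this
    exact this
  calc star (cof q (u q) i j)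
      = ∑ k, star (cof q (u q) i k) * (∑ a, cof q (u q) a k * u q a j) := by
        simp [cof_mul h]
    _ = ∑ a, (∑ k, star (cof q (u q) i k) * cof q (u q) a k) * u q a j := by
        simp only [Finset.mul_sum, Finset.sum_mul, mul_assoc]
        rw [Finset.sum_comm]
    _ = _ := by simp [h1]

lemma star_star_A (a : A q) : star (star a) = a := by
  have : starStar q = AlgHom.id ℂ (A q) := by
    apply A_hom_ext
    intro i j
    change star (star (u q i j)) = u q i j
    rw [star_u, star_cof]
  exact congrArg (fun φ => φ a) this

instance : StarRing (A q) where
  star_involutive := star_star_A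
  star_mul := star_mul_A
  star_add := star_add_A

instance : StarModule ℂ (A q) where
  star_smul := star_smul_A

end

/-! ### Representations of `U_q(u(2))` -/

section
variable (q : Param)

/-- `3 × 3` matrices that are block diagonal with blocks `{0, 1}` and `{2}`. -/
def blockMat : Subalgebra ℂ (Matrix (Fin 3) (Fin 3) ℂ) where
  carrier := {M | M 0 2 = 0 ∧ M 1 2 = 0 ∧ M 2 0 = 0 ∧ M 2 1 = 0}
  mul_mem' := by
    rintro M N ⟨h1, h2, h3, h4⟩ ⟨k1, k2, k3, k4⟩
    simp [Matrix.mul_apply, Fin.sum_univ_three, h1, h2, h3, h4, k1, k2, k3, k4]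
  add_mem' := by
    rintro M N ⟨h1, h2, h3, h4⟩ ⟨k1, k2, k3, k4⟩
    simp [h1, h2, h3, h4, k1, k2, k3, k4]
  algebraMap_mem' := by
    intro c
    simp [Matrix.algebraMap_eq_diagonal]

lemma rho_block (h : Uu2 q) : rho q h ∈ blockMat := by
  have hle : Uu2 q ≤ blockMat.comap (rho q) := by
    have hK : ∀ i, rho q (K q i) ∈ blockMat := by
      intro i; fin_cases i <;> refine ⟨?_, ?_, ?_, ?_⟩ <;> simp [rho, Matrix.diagonal]
    have hL : ∀ i, rho q (Kinv q i) ∈ blockMat := by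
      intro i; fin_cases i <;> refine ⟨?_, ?_, ?_, ?_⟩ <;> simp [rho, Matrix.diagonal]
    apply Uu2_le <;> rw [Subalgebra.mem_comap]
    · exact hK 0
    · exact hL 0
    · refine ⟨?_, ?_, ?_, ?_⟩ <;> simp [rho, Matrix.single]
    · refine ⟨?_, ?_, ?_, ?_⟩ <;> simp [rho, Matrix.single]
    · rw [map_mul, map_pow]; exact mul_mem (hK 0) (pow_mem (hK 1) 2)
    · rw [map_mul, map_pow]; exact mul_mem (hL 0) (pow_mem (hL 1) 2)
  exact hle h.2

/-- The character of `U_q(u(2))` on the last vector of the fundamental representation: it is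
trivial on `K_1, E_1, F_1` and takes the value `q` at `K_1 K_2²`. -/
def chi : Uu2 q →ₐ[ℂ] ℂ where
  toFun h := rho q h 2 2
  map_one' := by simp
  map_mul' x y := by
    obtain ⟨-, -, h3, h4⟩ := rho_block q x
    simp [Matrix.mul_apply, Fin.sum_univ_three, h3, h4]
  map_zero' := by simp
  map_add' x y := by simp
  commutes' c := by
    simp [Matrix.algebraMap_eq_diagonal]

/-- The inverse character, trivial on `K_1, E_1, F_1` and with value `q⁻¹` at `K_1 K_2²`. -/
def chiInv : Uu2 q →ₐ[ℂ] ℂ :=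
  (AlgHom.fromOpposite (chi q) fun _ _ => Commute.all _ _).comp (Su2 q)

/-- The two-dimensional block of the fundamental representation, in the basis `(e_2, e_1)`: this is
the representation of spin `1/2` and charge `-1/2`. -/
def sigmaHalf : Uu2 q →ₐ[ℂ] Matrix (Fin 2) (Fin 2) ℂ where
  toFun h := !![rho q h 1 1, rho q h 1 0; rho q h 0 1, rho q h 0 0]
  map_one' := by
    ext i j; fin_cases i <;> fin_cases j <;> simp
  map_mul' x y := by
    obtain ⟨h1, h2, -, -⟩ := rho_block q x
    ext i j
    fin_cases i <;> fin_cases j <;>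
      simp [Matrix.mul_apply, Fin.sum_univ_three, h1, h2, add_comm]
  map_zero' := by
    ext i j; fin_cases i <;> fin_cases j <;> simp
  map_add' x y := by
    ext i j; fin_cases i <;> fin_cases j <;> simp
  commutes' c := by
    ext i j; fin_cases i <;> fin_cases j <;> simp [Matrix.algebraMap_eq_diagonal]

variable {q}

/-- The Hopf tensor product `h ↦ σ(h₍₁₎) χ(h₍₂₎)` of a matrix representation of `U_q(u(2))` and a
character. -/
def twist {n : ℕ} (σ : Uu2 q →ₐ[ℂ] Matrix (Fin n) (Fin n) ℂ) (χ : Uu2 q →ₐ[ℂ] ℂ) :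
    Uu2 q →ₐ[ℂ] Matrix (Fin n) (Fin n) ℂ :=
  (Algebra.TensorProduct.rid ℂ ℂ (Matrix (Fin n) (Fin n) ℂ)).toAlgHom.comp
    ((Algebra.TensorProduct.map σ χ).comp (comulU2 q))

variable (q)

/-- The representation `σ^{1,0} = σ_{1/2,-3/2}` of `U_q(u(2))`. -/
def sigma10 : Uu2 q →ₐ[ℂ] Matrix (Fin 2) (Fin 2) ℂ := twist (sigmaHalf q) (chiInv q)

/-- The representation `σ^{0,1} = σ_{1/2,3/2}` of `U_q(u(2))`. -/
def sigma01 : Uu2 q →ₐ[ℂ] Matrix (Fin 2) (Fin 2) ℂ := twist (twist (sigmaHalf q) (chi q)) (chi q)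

/-- `K_1`, as an element of `U_q(u(2))`. -/
def K1 : Uu2 q := ⟨K q 0, K_mem q⟩
/-- `E_1`, as an element of `U_q(u(2))`. -/
def E1 : Uu2 q := ⟨E q 0, E_mem q⟩
/-- `F_1`, as an element of `U_q(u(2))`. -/
def F1 : Uu2 q := ⟨F q 0, F_mem q⟩
/-- `K_1 K_2²`, as an element of `U_q(u(2))`. -/
def K1K2sq : Uu2 q := ⟨K q 0 * K q 1 ^ 2, L_mem q⟩

lemma comulU2_K1 : comulU2 q (K1 q) = K1 q ⊗ₜ K1 q := by
  apply inclTensor_injective q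
  rw [inclTensor_comulU2]
  simp [inclTensor, K1, comul_K]

lemma comulU2_E1 : comulU2 q (E1 q)
    = E1 q ⊗ₜ K1 q + (⟨Kinv q 0, Kinv_mem q⟩ : Uu2 q) ⊗ₜ E1 q := by
  apply inclTensor_injective q
  rw [inclTensor_comulU2]
  simp [inclTensor, K1, E1, comul_E]

lemma comulU2_F1 : comulU2 q (F1 q)
    = F1 q ⊗ₜ K1 q + (⟨Kinv q 0, Kinv_mem q⟩ : Uu2 q) ⊗ₜ F1 q := by
  apply inclTensor_injective q
  rw [inclTensor_comulU2]
  simp [inclTensor, K1, F1, comul_F]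

lemma comulU2_K1K2sq : comulU2 q (K1K2sq q) = K1K2sq q ⊗ₜ K1K2sq q := by
  apply inclTensor_injective q
  rw [inclTensor_comulU2]
  simp [inclTensor, K1K2sq, comul_K, pow_two]

lemma chi_values : chi q (K1 q) = 1 ∧ chi q (E1 q) = 0 ∧ chi q (F1 q) = 0 ∧
    chi q (K1K2sq q) = qc q := by
  simp [chi, K1, E1, F1, K1K2sq, rho, Matrix.diagonal, Matrix.single, Matrix.mul_apply,
    pow_two, qc_eq]

lemma chiInv_apply (h : Uu2 q) : chiInv q h = rho q (S q h) 2 2 := rfl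

lemma chiInv_values : chiInv q (K1 q) = 1 ∧ chiInv q (E1 q) = 0 ∧ chiInv q (F1 q) = 0 ∧
    chiInv q (K1K2sq q) = (qc q)⁻¹ := by
  simp [chiInv_apply, K1, E1, F1, K1K2sq, rho, S_mul, Matrix.diagonal, Matrix.single,
    Matrix.mul_apply, pow_two, qc_eq]

lemma sigmaHalf_values : sigmaHalf q (K1 q) = !![qh q, 0; 0, (qh q)⁻¹] ∧
    sigmaHalf q (E1 q) = !![0, 1; 0, 0] ∧ sigmaHalf q (F1 q) = !![0, 0; 1, 0] ∧
    sigmaHalf q (K1K2sq q) = (qh q)⁻¹ • 1 := by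
  have hh := qh_ne q
  refine ⟨?_, ?_, ?_, ?_⟩ <;> ext i j <;> fin_cases i <;> fin_cases j <;>
    simp [sigmaHalf, K1, E1, F1, K1K2sq, rho, Matrix.diagonal, Matrix.single, Matrix.mul_apply,
      pow_two, hh]

lemma sigma10_values : sigma10 q (K1 q) = !![qh q, 0; 0, (qh q)⁻¹] ∧
    sigma10 q (E1 q) = !![0, 1; 0, 0] ∧ sigma10 q (F1 q) = !![0, 0; 1, 0] ∧
    sigma10 q (K1K2sq q) = (qh q ^ 3)⁻¹ • 1 := by
  have hh := qh_ne q
  obtain ⟨a1, a2, a3, a4⟩ := sigmaHalf_values q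
  obtain ⟨b1, b2, b3, b4⟩ := chiInv_values q
  refine ⟨?_, ?_, ?_, ?_⟩
  · simp [sigma10, twist, comulU2_K1, a1, b1]
  · simp [sigma10, twist, comulU2_E1, a2, b1, b2]
  · simp [sigma10, twist, comulU2_F1, a3, b1, b3]
  · simp [sigma10, twist, comulU2_K1K2sq, a4, b4, smul_smul, qc_eq]
    field_simp

lemma sigma01_values : sigma01 q (K1 q) = !![qh q, 0; 0, (qh q)⁻¹] ∧
    sigma01 q (E1 q) = !![0, 1; 0, 0] ∧ sigma01 q (F1 q) = !![0, 0; 1, 0] ∧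
    sigma01 q (K1K2sq q) = (qh q ^ 3) • 1 := by
  have hh := qh_ne q
  obtain ⟨a1, a2, a3, a4⟩ := sigmaHalf_values q
  obtain ⟨b1, b2, b3, b4⟩ := chi_values q
  refine ⟨?_, ?_, ?_, ?_⟩
  · simp [sigma01, twist, comulU2_K1, a1, b1]
  · simp [sigma01, twist, comulU2_E1, a2, b1, b2]
  · simp [sigma01, twist, comulU2_F1, a3, b1, b3]
  · simp [sigma01, twist, comulU2_K1K2sq, a4, b4, smul_smul, qc_eq]
    ring

end

/-! ### Equivariant elements and one-forms -/

section
variable {q : Param}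

/-- `h ↦ f(h₍₁₎) g(h₍₂₎)` on `U_q(u(2))`, for `f` scalar valued. -/
def sweedlerLeft {M : Type*} [AddCommGroup M] [Module ℂ M] (f : Uu2 q →ₗ[ℂ] ℂ)
    (g : Uu2 q →ₗ[ℂ] M) : Uu2 q →ₗ[ℂ] M :=
  (TensorProduct.lid ℂ M).toLinearMap ∘ₗ TensorProduct.map f g ∘ₗ (comulU2 q).toLinearMap

/-- `h ↦ f(h₍₂₎) g(h₍₁₎)` on `U_q(u(2))`, for `f` scalar valued. -/
def sweedlerRight {M : Type*} [AddCommGroup M] [Module ℂ M] (g : Uu2 q →ₗ[ℂ] M)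
    (f : Uu2 q →ₗ[ℂ] ℂ) : Uu2 q →ₗ[ℂ] M :=
  (TensorProduct.rid ℂ M).toLinearMap ∘ₗ TensorProduct.map g f ∘ₗ (comulU2 q).toLinearMap

/-- The matrix coefficient `h ↦ σ(h)_{ij}`. -/
def entry {n : ℕ} (σ : Uu2 q →ₐ[ℂ] Matrix (Fin n) (Fin n) ℂ) (i j : Fin n) : Uu2 q →ₗ[ℂ] ℂ :=
  Matrix.entryLinearMap ℂ ℂ i j ∘ₗ σ.toLinearMap

/-- The antipode of `U_q(u(2))`, as a linear map. -/
def antipodeU2 (q : Param) : Uu2 q →ₗ[ℂ] Uu2 q :=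
  (MulOpposite.opLinearEquiv ℂ).symm.toLinearMap ∘ₗ (Su2 q).toLinearMap

lemma coe_antipodeU2 (h : Uu2 q) : (antipodeU2 q h : U q) = S q h := rfl

/-- `h ↦ a ◁ h` on `U_q(u(2))`. -/
def ractU2 (a : A q) : Uu2 q →ₗ[ℂ] A q := ract q a ∘ₗ (Uu2 q).val.toLinearMap

/-- `𝔐(σ)`: the `v` in `A(SU_q(3))^n` with `σ(S(h₍₁₎)) (v ◁ h₍₂₎) = ε(h) v` for all `h` in
`U_q(u(2))`. -/
def Equivariant {n : ℕ} (σ : Uu2 q →ₐ[ℂ] Matrix (Fin n) (Fin n) ℂ) :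
    Submodule ℂ (Fin n → A q) where
  carrier := {v | ∀ (h : Uu2 q) (i : Fin n),
    ∑ j, sweedlerLeft (entry σ i j ∘ₗ antipodeU2 q) (ractU2 (v j)) h
      = Coalgebra.counit (R := ℂ) (h : U q) • v i}
  add_mem' := by
    intro v w hv hw h i
    have : ∀ a b : A q, ractU2 (a + b) = ractU2 a + ractU2 b := by
      intro a b; ext; simp [ractU2]
    have e : ∀ (f : Uu2 q →ₗ[ℂ] ℂ) (g g' : Uu2 q →ₗ[ℂ] A q), sweedlerLeft f (g + g') h
        = sweedlerLeft f g h + sweedlerLeft f g' h := by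
      intro f g g'; simp [sweedlerLeft, TensorProduct.map_add_right]
    simp only [Pi.add_apply, this, e, Finset.sum_add_distrib, hv h i, hw h i, smul_add]
  zero_mem' := by
    intro h i
    have : ractU2 (0 : A q) = 0 := by ext; simp [ractU2]
    simp [this, sweedlerLeft]
  smul_mem' := by
    intro c v hv h i
    have : ∀ a : A q, ractU2 (c • a) = c • ractU2 a := by
      intro a; ext; simp [ractU2]
    have e : ∀ (f : Uu2 q →ₗ[ℂ] ℂ) (g : Uu2 q →ₗ[ℂ] A q), sweedlerLeft f (c • g) h
        = c • sweedlerLeft f g h := by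
      intro f g; simp [sweedlerLeft, TensorProduct.map_smul_right]
    simp only [Pi.smul_apply, this, e, ← Finset.smul_sum, hv h i]
    rw [smul_comm]

variable (q)

/-- The `(1,0)`-forms on `CP²_q`. -/
def Omega10 : Submodule ℂ (Fin 2 → A q) := Equivariant (sigma10 q)

/-- The `(0,1)`-forms on `CP²_q`. -/
def Omega01 : Submodule ℂ (Fin 2 → A q) := Equivariant (sigma01 q)

/-- The one-forms on `CP²_q`: pairs of a `(1,0)`-form and a `(0,1)`-form. -/
def Omega1 : Submodule ℂ ((Fin 2 → A q) × (Fin 2 → A q)) := (Omega10 q).prod (Omega01 q)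

variable {q}

/-- `[a, b]_q = a b - q⁻¹ b a`. -/
def qcomm (a b : U q) : U q := a * b - (qc q)⁻¹ • (b * a)

variable (q)

/-- The element `X = (q⁻¹ K_2 E_2, -K_1 K_2 [E_1, E_2]_q)`. -/
def X : Fin 2 → U q := ![(qc q)⁻¹ • (K q 1 * E q 1), -(K q 0 * K q 1 * qcomm (E q 0) (E q 1))]

/-- The element `Y = (K_1 K_2 [F_2, F_1]_q, K_2 F_2)`. -/
def Y : Fin 2 → U q := ![K q 0 * K q 1 * qcomm (F q 1) (F q 0), K q 1 * F q 1]

variable {q}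

/-- The right adjoint action `x ◁ h = S(h₍₁₎) x h₍₂₎` of `U_q(su(3))` on itself, as a linear map
in `h`. -/
def radj (x : U q) : U q →ₗ[ℂ] U q :=
  LinearMap.mul' ℂ (U q) ∘ₗ TensorProduct.map (LinearMap.mulRight ℂ x ∘ₗ S q) LinearMap.id
    ∘ₗ Coalgebra.comul

/-- `∑_k X_k ⊗ e^k` is invariant for the tensor product of the right adjoint action and `σ`:
`∑_k (X_k ◁ S⁻¹(h₍₁₎)) ⊗ σ(h₍₂₎) e^k = ε(h) ∑_k X_k ⊗ e^k` for all `h` in `U_q(u(2))`. -/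
def IsInvariant {n : ℕ} (σ : Uu2 q →ₐ[ℂ] Matrix (Fin n) (Fin n) ℂ) (X : Fin n → U q) : Prop :=
  ∀ (h : Uu2 q) (i : Fin n),
    ∑ k, sweedlerRight (radj (X k) ∘ₗ Sinv q ∘ₗ (Uu2 q).val.toLinearMap) (entry σ i k) h
      = Coalgebra.counit (R := ℂ) (h : U q) • X i

/-- The left action `L_h a = a ◁ S⁻¹(h)`, as a linear map in `a`. -/
def leftAct (h : U q) : A q →ₗ[ℂ] A q := (ract q).flip (Sinv q h)

variable (q)

/-- `∂ a = q^(-1/2) (L_{X_1} a, L_{X_2} a)`. -/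
def del : A q →ₗ[ℂ] (Fin 2 → A q) := LinearMap.pi fun k => (qh q)⁻¹ • leftAct (X q k)

/-- `∂̄ a = (L_{Y_1} a, L_{Y_2} a)`. -/
def delbar : A q →ₗ[ℂ] (Fin 2 → A q) := LinearMap.pi fun k => leftAct (Y q k)

/-- `d = ∂ + ∂̄`, with values in pairs of a `(1,0)`-form and a `(0,1)`-form. -/
def extd : A q →ₗ[ℂ] (Fin 2 → A q) × (Fin 2 → A q) := (del q).prod (delbar q)

variable {q}

/-- The antilinear map `J (v_1, v_2) = (-q^(-1/2) v_2^*, q^(1/2) v_1^*)`. -/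
def quatJ (v : Fin 2 → A q) : Fin 2 → A q := ![-((qh q)⁻¹ • star (v 1)), qh q • star (v 0)]

/-- The involution of one-forms: `(ω^*)_{1,0} = -J(ω_{0,1})` and `(ω^*)_{0,1} = J(ω_{1,0})`. -/
def starForm (ω : (Fin 2 → A q) × (Fin 2 → A q)) : (Fin 2 → A q) × (Fin 2 → A q) :=
  (-quatJ ω.2, quatJ ω.1)

end

end QuantumCP2

end

/-!
The right action of `U_q(su(3))` on `A(SU_q(3))` is an action (`ract_mul_right`), and both the
invariance of functions and the equivariance of one-forms can be tested on the generators `K_1`,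
`E_1`, `F_1`, `K_1 K_2²` of `U_q(u(2))`. Thus `A(CP²_q)` is the algebra of *singlets* of weight one
(`mem_CP2_iff`), and `Ω^{1,0}`, `Ω^{0,1}` consist of *doublets*, that is, of vectors of spin `1/2` and
of a fixed weight (`mem_Equivariant_iff`).

Let `a` be an invariant element and `a' = a ◁ K_2`, again a singlet of weight one. Up to scalars the
components of `∂a` are `a' ◁ E_2` and `a' ◁ E_2 E_1`, and those of `∂̄a` are `a' ◁ F_2 F_1` and
`a' ◁ F_2` (`del_apply`, `delbar_apply`). The commutation relations and the `q`-Serre relations show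
that these pairs are doublets (`doublet_E`, `doublet_F`). The Leibniz rule follows from the
coproducts of `E_i` and `F_i`, as `K_1`, `E_1`, `F_1` and `K_2²` act trivially on `a`. The involution
satisfies `a^* ◁ E_i = -q (a ◁ F_i)^*` and `a^* ◁ F_i = -q⁻¹ (a ◁ E_i)^*` (`ract_star_E`,
`ract_star_F`; a direct check on the generators, where `u^*` is a quantum minor). Hence it exchanges
`∂` and `∂̄` up to sign (`extd_star`).

For the span, put `z_j = u^3_j`. The rows of `u` are orthonormal, and their adjoints are orthogonal
for sums twisted by the square of the antipode (`sum_u_mul_star`, `sum_star_mul_u`). The `(1,0)`-part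
of `d(z_j^* z_k)` involves `z_j^*`, and its `(0,1)`-part involves the adjoints of the first two rows.
Multiplying by `f_k z_j` from the left and summing over `j` therefore removes the `(0,1)`-part and
the factor `z_j^*`. If `f_k` is the contraction of a given `(1,0)`-form `v` with the adjoints of the
first two rows, the sum over `k` gives back `v` (`inl_mem_span`). For `(0,1)`-forms the elements
`z_k z_j^*` play the same role (`inr_mem_span`).

The expression defining invariance of `X` and `Y` is a left action of `h` (`tensorAct_mul`), so it is
enough to treat the generators (`isInvariant_of_generators`). There the claim is an identity in
`U_q(su(3))`, proved by bringing all monomials to a normal order and applying the `q`-Serre relations.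
-/

namespace QuantumCP2

section
variable {q : Param}

/-! ### The right action on generators and products -/

lemma rho_K (i : Fin 2) : rho q (K q i) = Matrix.diagonal fun j =>
    if j = i.succ then qh q else if j = i.castSucc then (qh q)⁻¹ else 1 := by
  simp [rho]

lemma rho_Kinv (i : Fin 2) : rho q (Kinv q i) = Matrix.diagonal fun j =>
    if j = i.succ then (qh q)⁻¹ else if j = i.castSucc then qh q else 1 := by
  simp [rho]

lemma rho_E (i : Fin 2) : rho q (E q i) = Matrix.single i.succ i.castSucc 1 := by
  simp [rho]

lemma rho_F (i : Fin 2) : rho q (F q i) = Matrix.single i.castSucc i.succ 1 := by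
  simp [rho]

/-- A linear condition on `A(SU_q(3))` that is stable under products holds everywhere as soon as it
holds on the generators `u^i_j` and on the scalars. -/
lemma A_induction {P : A q → Prop} (hu : ∀ i j, P (u q i j))
    (hc : ∀ c : ℂ, P (algebraMap ℂ _ c)) (hadd : ∀ a b, P a → P b → P (a + b))
    (hmul : ∀ a b, P a → P b → P (a * b)) (a : A q) : P a :=
  A_subalgebra_eq_top
    { carrier := {a | P a}
      mul_mem' := fun {a b} ha hb => hmul a b ha hb
      add_mem' := fun {a b} ha hb => hadd a b ha hb
      algebraMap_mem' := hc } hu a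

lemma ract_algebraMap (c : ℂ) (h : U q) :
    ract q (algebraMap ℂ _ c) h = Coalgebra.counit (R := ℂ) h • algebraMap ℂ (A q) c := by
  rw [Algebra.algebraMap_eq_smul_one, map_smul, LinearMap.smul_apply, ract_one, smul_comm]

lemma ract_one_right (a : A q) : ract q a 1 = a := by
  induction a using A_induction with
  | hu i j => simp [ract_u, Matrix.one_apply]
  | hc c => simp [ract_algebraMap]
  | hadd a b ha hb => simp [ha, hb]
  | hmul a b ha hb =>
    rw [ract_mul, Bialgebra.comul_one, Algebra.TensorProduct.one_def]
    simp [ha, hb]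

/-- `a ◁ (gh) = (a ◁ g) ◁ h`. -/
lemma ract_mul_right (a : A q) (g h : U q) : ract q a (g * h) = ract q (ract q a g) h := by
  induction a using A_induction generalizing g h with
  | hu i j =>
    simp only [ract_u, map_mul, map_sum, LinearMap.sum_apply, map_smul, LinearMap.smul_apply,
      Matrix.mul_apply, Finset.sum_smul, Finset.smul_sum, smul_smul]
    rw [Finset.sum_comm]
  | hc c => rw [ract_algebraMap, ract_algebraMap, map_smul, LinearMap.smul_apply, ract_algebraMap,
      smul_smul, Bialgebra.counit_mul]
  | hadd a b ha hb => simp [ha, hb]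
  | hmul a b ha hb =>
    rw [ract_mul, ract_mul q a b g, Bialgebra.comul_mul]
    generalize Coalgebra.comul (R := ℂ) g = t
    induction t with
    | zero => simp
    | add x y hx hy => simp only [add_mul, map_add, hx, hy, LinearMap.add_apply]
    | tmul x y =>
      rw [TensorProduct.map_tmul, LinearMap.mul'_apply, ract_mul]
      generalize Coalgebra.comul (R := ℂ) h = s
      induction s with
      | zero => simp
      | add z w hz hw => simp only [mul_add, map_add, hz, hw]
      | tmul z w => simp [ha, hb]

lemma ract_mul_K (a b : A q) (i : Fin 2) :
    ract q (a * b) (K q i) = ract q a (K q i) * ract q b (K q i) := by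
  simp [ract_mul, comul_K]

lemma ract_mul_Kinv (a b : A q) (i : Fin 2) :
    ract q (a * b) (Kinv q i) = ract q a (Kinv q i) * ract q b (Kinv q i) := by
  simp [ract_mul, comul_Kinv]

lemma ract_mul_E (a b : A q) (i : Fin 2) : ract q (a * b) (E q i)
    = ract q a (E q i) * ract q b (K q i) + ract q a (Kinv q i) * ract q b (E q i) := by
  simp [ract_mul, comul_E]

lemma ract_mul_F (a b : A q) (i : Fin 2) : ract q (a * b) (F q i)
    = ract q a (F q i) * ract q b (K q i) + ract q a (Kinv q i) * ract q b (F q i) := by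
  simp [ract_mul, comul_F]

/-! ### The commutation relations, as relations between the actions of the generators -/

lemma ract_K_Kinv (a : A q) (i : Fin 2) : ract q (ract q a (K q i)) (Kinv q i) = a := by
  rw [← ract_mul_right, (isURep_U q).kl, ract_one_right]

lemma ract_E_K (a : A q) (i : Fin 2) : ract q (ract q a (E q i)) (K q i)
    = (qc q)⁻¹ • ract q (ract q a (K q i)) (E q i) := by
  simp only [← ract_mul_right, (isURep_U q).ek, map_smul]

lemma ract_E_K_ne (a : A q) {i j : Fin 2} (h : i ≠ j) : ract q (ract q a (E q j)) (K q i)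
    = qh q • ract q (ract q a (K q i)) (E q j) := by
  simp only [← ract_mul_right, (isURep_U q).ek_ne h, map_smul]

lemma ract_E_Kinv (a : A q) (i : Fin 2) : ract q (ract q a (E q i)) (Kinv q i)
    = qc q • ract q (ract q a (Kinv q i)) (E q i) := by
  simp only [← ract_mul_right, (isURep_U q).el, map_smul]

lemma ract_E_Kinv_ne (a : A q) {i j : Fin 2} (h : i ≠ j) : ract q (ract q a (E q j)) (Kinv q i)
    = (qh q)⁻¹ • ract q (ract q a (Kinv q i)) (E q j) := by
  simp only [← ract_mul_right, (isURep_U q).el_ne h, map_smul]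

lemma ract_F_K (a : A q) (i : Fin 2) : ract q (ract q a (F q i)) (K q i)
    = qc q • ract q (ract q a (K q i)) (F q i) := by
  simp only [← ract_mul_right, (isURep_U q).fk, map_smul]

lemma ract_F_K_ne (a : A q) {i j : Fin 2} (h : i ≠ j) : ract q (ract q a (F q j)) (K q i)
    = (qh q)⁻¹ • ract q (ract q a (K q i)) (F q j) := by
  simp only [← ract_mul_right, (isURep_U q).fk_ne h, map_smul]

lemma ract_F_Kinv (a : A q) (i : Fin 2) : ract q (ract q a (F q i)) (Kinv q i)
    = (qc q)⁻¹ • ract q (ract q a (Kinv q i)) (F q i) := by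
  simp only [← ract_mul_right, (isURep_U q).fl, map_smul]

lemma ract_F_Kinv_ne (a : A q) {i j : Fin 2} (h : i ≠ j) : ract q (ract q a (F q j)) (Kinv q i)
    = qh q • ract q (ract q a (Kinv q i)) (F q j) := by
  simp only [← ract_mul_right, (isURep_U q).fl_ne h, map_smul]

lemma ract_K_comm (a : A q) (i j : Fin 2) : ract q (ract q a (K q i)) (K q j)
    = ract q (ract q a (K q j)) (K q i) := by
  simp only [← ract_mul_right, (isURep_U q).kk i j]

lemma ract_E_F (a : A q) (i : Fin 2) : ract q (ract q a (E q i)) (F q i)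
    = ract q (ract q a (F q i)) (E q i) + (qc q - (qc q)⁻¹)⁻¹ •
      (ract q (ract q a (K q i)) (K q i) - ract q (ract q a (Kinv q i)) (Kinv q i)) := by
  simp only [← ract_mul_right, ← map_sub, ← map_smul, ← map_add, ← pow_two, ← (isURep_U q).ef i]
  congr 1
  abel

lemma ract_F_E (a : A q) (i : Fin 2) : ract q (ract q a (F q i)) (E q i)
    = ract q (ract q a (E q i)) (F q i) - (qc q - (qc q)⁻¹)⁻¹ •
      (ract q (ract q a (K q i)) (K q i) - ract q (ract q a (Kinv q i)) (Kinv q i)) := by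
  rw [ract_E_F, add_sub_cancel_right]

lemma ract_E_F_ne (a : A q) {i j : Fin 2} (h : i ≠ j) : ract q (ract q a (E q i)) (F q j)
    = ract q (ract q a (F q j)) (E q i) := by
  simp only [← ract_mul_right, (isURep_U q).ef_ne i j h]

/-- The `q`-Serre relation on a vector killed by `E_1`. -/
lemma ract_E_serre {a : A q} (h : ract q a (E q 0) = 0) :
    ract q (ract q (ract q a (E q 1)) (E q 0)) (E q 0) = 0 := by
  have hs := congrArg (ract q a) ((isURep_U q).serre_e 0 1 (by decide))
  simpa [pow_two, ract_mul_right, h] using hs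

/-- The `q`-Serre relation on a vector killed by `F_1`. -/
lemma ract_F_serre {a : A q} (h : ract q a (F q 0) = 0) :
    ract q (ract q (ract q a (F q 1)) (F q 0)) (F q 0) = 0 := by
  have hs := congrArg (ract q a) ((isURep_U q).serre_f 0 1 (by decide))
  simpa [pow_two, ract_mul_right, h] using hs

/-! ### The action on rows of generators and on rows of their adjoints -/

lemma ract_u_K (i : Fin 2) (k j : Fin 3) : ract q (u q k j) (K q i)
    = (if k = i.succ then qh q else if k = i.castSucc then (qh q)⁻¹ else 1) • u q k j := by
  simp [ract_u, rho_K, Matrix.diagonal_apply]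

lemma ract_u_Kinv (i : Fin 2) (k j : Fin 3) : ract q (u q k j) (Kinv q i)
    = (if k = i.succ then (qh q)⁻¹ else if k = i.castSucc then qh q else 1) • u q k j := by
  simp [ract_u, rho_Kinv, Matrix.diagonal_apply]

lemma ract_u_E (i : Fin 2) (k j : Fin 3) : ract q (u q k j) (E q i)
    = if k = i.succ then u q i.castSucc j else 0 := by
  simp only [ract_u, rho_E, Matrix.single_apply]
  by_cases h : k = i.succ
  · subst h; simp
  · simp [h, Ne.symm h]

lemma ract_u_F (i : Fin 2) (k j : Fin 3) : ract q (u q k j) (F q i)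
    = if k = i.castSucc then u q i.succ j else 0 := by
  simp only [ract_u, rho_F, Matrix.single_apply]
  by_cases h : k = i.castSucc
  · subst h; simp
  · simp [h, Ne.symm h]

/-! ### The action and the involution -/

lemma lo_lt_hi (j : Fin 3) : lo j < hi j := by
  fin_cases j <;> decide

lemma u_row (k j : Fin 3) :
    u q k (lo j) * u q k (hi j) = qc q • (u q k (hi j) * u q k (lo j)) :=
  (isARep_u q).row _ _ k (lo_lt_hi j)

lemma star_u_eq (i j : Fin 3) : star (u q i j)
    = ((-qc q) ^ (j : ℕ) * ((-qc q) ^ (i : ℕ))⁻¹) •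
      (u q (lo i) (lo j) * u q (hi i) (hi j) - qc q • (u q (lo i) (hi j) * u q (hi i) (lo j))) := by
  rw [star_u, cof, zpow_sub₀ (neg_ne_zero.2 (qc_ne q)), zpow_natCast, zpow_natCast, div_eq_mul_inv]

lemma lo_hi_values : lo 0 = 1 ∧ lo 1 = 0 ∧ lo 2 = 0 ∧ hi 0 = 2 ∧ hi 1 = 2 ∧ hi 2 = 1 := by
  decide

lemma ract_star_u_K (i : Fin 2) (k j : Fin 3) : ract q (star (u q k j)) (K q i)
    = star (ract q (u q k j) (Kinv q i)) := by
  have hh := qh_ne q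
  rw [ract_u_Kinv, star_smul, star_u_eq]
  simp only [map_sub, map_smul, LinearMap.sub_apply, LinearMap.smul_apply, ract_mul_K,
    ract_u_K]
  fin_cases i <;> fin_cases k <;> simp [lo_hi_values, conj_qh, hh] <;> module

/-- The formula `u^* ◁ E_i = -q (u ◁ F_i)^*` on generators. Both sides are combinations of `2 × 2`
quantum minors; where `E_i` produces a minor with two equal rows, it vanishes by `u_row`. -/
lemma ract_star_u_E (i : Fin 2) (k j : Fin 3) : ract q (star (u q k j)) (E q i)
    = -(qc q • star (ract q (u q k j) (F q i))) := by
  have hh := qh_ne q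
  have hq := qc_ne q
  rw [ract_u_F, apply_ite star, star_zero, star_u_eq, star_u_eq]
  simp only [map_sub, map_smul, LinearMap.sub_apply, LinearMap.smul_apply, ract_mul_E,
    ract_u_K, ract_u_Kinv, ract_u_E]
  fin_cases i <;> fin_cases k <;> simp [lo_hi_values, u_row, smul_smul, -smul_eq_zero] <;>
    match_scalars <;> field_simp <;> ring

/-- The formula `u^* ◁ F_i = -q⁻¹ (u ◁ E_i)^*` on generators. -/
lemma ract_star_u_F (i : Fin 2) (k j : Fin 3) : ract q (star (u q k j)) (F q i)
    = -((qc q)⁻¹ • star (ract q (u q k j) (E q i))) := by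
  have hh := qh_ne q
  have hq := qc_ne q
  rw [ract_u_E, apply_ite star, star_zero, star_u_eq, star_u_eq]
  simp only [map_sub, map_smul, LinearMap.sub_apply, LinearMap.smul_apply, ract_mul_F,
    ract_u_K, ract_u_Kinv, ract_u_F]
  fin_cases i <;> fin_cases k <;> simp [lo_hi_values, u_row, smul_smul, -smul_eq_zero] <;>
    match_scalars <;> field_simp <;> ring

lemma star_algebraMap_A (c : ℂ) :
    star (algebraMap ℂ (A q) c) = algebraMap ℂ (A q) (starRingEnd ℂ c) := by
  rw [Algebra.algebraMap_eq_smul_one, Algebra.algebraMap_eq_smul_one, star_smul, star_one]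
  rfl

/-- `(a^*) ◁ K_i = (a ◁ K_i⁻¹)^*`. -/
lemma ract_star_K (a : A q) (i : Fin 2) : ract q (star a) (K q i) = star (ract q a (Kinv q i)) := by
  induction a using A_induction with
  | hu k j => exact ract_star_u_K i k j
  | hc c => simp [star_algebraMap_A, ract_algebraMap]
  | hadd a b ha hb => simp [ha, hb]
  | hmul a b ha hb => simp [ract_mul_K, ract_mul_Kinv, ha, hb]

/-- `(a^*) ◁ K_i⁻¹ = (a ◁ K_i)^*`. -/
lemma ract_star_Kinv (a : A q) (i : Fin 2) :
    ract q (star a) (Kinv q i) = star (ract q a (K q i)) := by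
  have h := ract_star_K (ract q a (K q i)) i
  rw [ract_K_Kinv] at h
  rw [← h, ract_K_Kinv]

/-- `(a^*) ◁ E_i = -q (a ◁ F_i)^*`. -/
lemma ract_star_E (a : A q) (i : Fin 2) :
    ract q (star a) (E q i) = -(qc q • star (ract q a (F q i))) := by
  induction a using A_induction with
  | hu k j => exact ract_star_u_E i k j
  | hc c => simp [star_algebraMap_A, ract_algebraMap]
  | hadd a b ha hb => simp [ha, hb, add_comm]
  | hmul a b ha hb =>
    simp [ract_mul_E, ract_mul_F, ha, hb, ract_star_K, ract_star_Kinv, add_comm]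

/-- `(a^*) ◁ F_i = -q⁻¹ (a ◁ E_i)^*`. -/
lemma ract_star_F (a : A q) (i : Fin 2) :
    ract q (star a) (F q i) = -((qc q)⁻¹ • star (ract q a (E q i))) := by
  induction a using A_induction with
  | hu k j => exact ract_star_u_F i k j
  | hc c => simp [star_algebraMap_A, ract_algebraMap]
  | hadd a b ha hb => simp [ha, hb, add_comm]
  | hmul a b ha hb =>
    simp [ract_mul_E, ract_mul_F, ha, hb, ract_star_K, ract_star_Kinv, add_comm]

/-! ### Singlets and the coordinate algebra of the quantum projective plane -/

/-- The elements of `A(SU_q(3))` invariant under `K_1, E_1, F_1` and of weight `c` under `K_2²`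
(equivalently, under `K_1 K_2²`). -/
structure IsSinglet (c : ℂ) (a : A q) : Prop where
  K : ract q a (K q 0) = a
  E : ract q a (E q 0) = 0
  F : ract q a (F q 0) = 0
  KK : ract q (ract q a (QuantumCP2.K q 1)) (QuantumCP2.K q 1) = c • a

lemma IsSinglet.Kinv {c : ℂ} {a : A q} (h : IsSinglet c a) : ract q a (Kinv q 0) = a := by
  rw [← h.K, ract_K_Kinv, h.K]

lemma IsSinglet.mul {c d : ℂ} {a b : A q} (ha : IsSinglet c a) (hb : IsSinglet d b) :
    IsSinglet (c * d) (a * b) where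
  K := by rw [ract_mul_K, ha.K, hb.K]
  E := by rw [ract_mul_E, ha.E, hb.E, zero_mul, mul_zero, add_zero]
  F := by rw [ract_mul_F, ha.F, hb.F, zero_mul, mul_zero, add_zero]
  KK := by rw [ract_mul_K, ract_mul_K, ha.KK, hb.KK, smul_mul_smul_comm]

lemma IsSinglet.star {c : ℂ} (hc : c ≠ 0) {a : A q} (h : IsSinglet c a) :
    IsSinglet (starRingEnd ℂ c⁻¹) (star a) where
  K := by rw [ract_star_K, h.Kinv]
  E := by rw [ract_star_E, h.F, star_zero, smul_zero, neg_zero]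
  F := by rw [ract_star_F, h.E, star_zero, smul_zero, neg_zero]
  KK := by
    have e : ract q (ract q a (QuantumCP2.Kinv q 1)) (QuantumCP2.Kinv q 1) = c⁻¹ • a := by
      rw [← inv_smul_smul₀ hc a, ← h.KK]
      simp only [map_smul, LinearMap.smul_apply, ract_K_Kinv]
      rw [h.KK, inv_smul_smul₀ hc]
    rw [ract_star_K, ract_star_K, e, star_smul]
    rfl

/-- `A(CP²_q)` consists of the singlets of weight one. -/
lemma mem_CP2_iff (a : A q) : a ∈ CP2 q ↔ IsSinglet 1 a := by
  constructor
  · intro h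
    have hK : ract q a (K q 0) = a := by simpa using h _ (K_mem q)
    refine ⟨hK, by simpa using h _ (E_mem q), by simpa using h _ (F_mem q), ?_⟩
    have := h _ (L_mem q)
    simpa [pow_two, ract_mul_right, hK] using this
  · intro h x hx
    let T : Subalgebra ℂ (U q) :=
      { carrier := {x | ract q a x = Coalgebra.counit (R := ℂ) x • a}
        mul_mem' := fun {x y} hx hy => by
          simp only [Set.mem_ofPred_eq] at hx hy ⊢
          rw [ract_mul_right, hx, map_smul, LinearMap.smul_apply, hy, smul_smul,
            Bialgebra.counit_mul]
        add_mem' := fun {x y} hx hy => by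
          simp only [Set.mem_ofPred_eq] at hx hy ⊢
          rw [map_add, hx, hy, map_add, add_smul]
        algebraMap_mem' := fun c => by
          simp only [Set.mem_ofPred_eq]
          rw [Algebra.algebraMap_eq_smul_one, map_smul, ract_one_right, map_smul,
            Bialgebra.counit_one, smul_eq_mul, mul_one] }
    have hKK : ract q (ract q a (Kinv q 1)) (Kinv q 1) = a := by
      have := h.KK
      rw [one_smul] at this
      conv_lhs => rw [← this, ract_K_Kinv, ract_K_Kinv]
    have hle : Uu2 q ≤ T := by
      apply Uu2_le <;> change ract q a _ = _
      · simp [h.K]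
      · simp [h.Kinv]
      · simp [h.E]
      · simp [h.F]
      · simp [pow_two, ract_mul_right, h.K, h.KK]
      · simp [pow_two, ract_mul_right, h.Kinv, hKK]
    exact hle hx

lemma star_mem_CP2 {a : A q} (h : a ∈ CP2 q) : star a ∈ CP2 q := by
  rw [mem_CP2_iff] at h ⊢
  simpa using h.star one_ne_zero

/-! ### Doublets and the one-forms -/

/-- The pairs `v` that transform under `U_q(u(2))` by the spin `1/2` representation, with `K_1 K_2²`
acting by the scalar `c`. -/
structure IsDoublet (c : ℂ) (v : Fin 2 → A q) : Prop where
  K0 : ract q (v 0) (K q 0) = qh q • v 0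
  K1 : ract q (v 1) (K q 0) = (qh q)⁻¹ • v 1
  E0 : ract q (v 0) (E q 0) = v 1
  E1 : ract q (v 1) (E q 0) = 0
  F0 : ract q (v 0) (F q 0) = 0
  F1 : ract q (v 1) (F q 0) = v 0
  KK0 : ract q (ract q (v 0) (K q 1)) (K q 1) = (c * (qh q)⁻¹) • v 0
  KK1 : ract q (ract q (v 1) (K q 1)) (K q 1) = (c * qh q) • v 1

lemma IsDoublet.Kinv0 {c : ℂ} {v : Fin 2 → A q} (h : IsDoublet c v) :
    ract q (v 0) (Kinv q 0) = (qh q)⁻¹ • v 0 := by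
  have := congrArg (fun x => ract q x (Kinv q 0)) h.K0
  simp only [ract_K_Kinv, map_smul, LinearMap.smul_apply] at this
  rw [smul_eq_iff (qh_ne q)] at this
  exact this

lemma IsDoublet.Kinv1 {c : ℂ} {v : Fin 2 → A q} (h : IsDoublet c v) :
    ract q (v 1) (Kinv q 0) = qh q • v 1 := by
  have := congrArg (fun x => ract q x (Kinv q 0)) h.K1
  simp only [ract_K_Kinv, map_smul, LinearMap.smul_apply] at this
  rw [smul_eq_iff (inv_ne_zero (qh_ne q)), inv_inv] at this
  exact this

/-- The convolution identity `S(h₍₁₎) h₍₂₎ = ε(h)` in `U_q(u(2))`. -/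
lemma antipodeU2_left (h : Uu2 q) :
    LinearMap.mul' ℂ (Uu2 q) (TensorProduct.map (antipodeU2 q) LinearMap.id (comulU2 q h))
      = algebraMap ℂ _ (Coalgebra.counit (R := ℂ) (h : U q)) := by
  apply Subtype.val_injective
  have key : ∀ t : Uu2 q ⊗[ℂ] Uu2 q,
      ((LinearMap.mul' ℂ (Uu2 q) (TensorProduct.map (antipodeU2 q) LinearMap.id t) : Uu2 q) : U q)
        = LinearMap.mul' ℂ (U q) ((S q).rTensor _ (inclTensor q t)) := by
    intro t
    induction t with
    | zero => simp
    | tmul x y => simp [inclTensor, coe_antipodeU2]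
    | add x y hx hy => simp only [map_add, AddMemClass.coe_add, hx, hy]
  change ((LinearMap.mul' ℂ (Uu2 q) _ : Uu2 q) : U q) = _
  rw [key, inclTensor_comulU2, antipode_left]
  rfl

/-- If `v ◁ h = σ(h) v` for all `h` then `v` is equivariant. -/
lemma mem_Equivariant_of_ract {n : ℕ} {σ : Uu2 q →ₐ[ℂ] Matrix (Fin n) (Fin n) ℂ} {v : Fin n → A q}
    (hv : ∀ (h : Uu2 q) (i : Fin n), ract q (v i) h = ∑ j, σ h i j • v j) :
    v ∈ Equivariant σ := by
  intro h i
  have key : ∀ t : Uu2 q ⊗[ℂ] Uu2 q,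
      ∑ j, TensorProduct.lid ℂ (A q)
        (TensorProduct.map (entry σ i j ∘ₗ antipodeU2 q) (ractU2 (v j)) t)
      = ∑ k, σ (LinearMap.mul' ℂ (Uu2 q) (TensorProduct.map (antipodeU2 q) LinearMap.id t)) i k
        • v k := by
    intro t
    induction t with
    | zero => simp
    | add x y hx hy =>
      simp only [map_add, Finset.sum_add_distrib, hx, hy, Matrix.add_apply, add_smul]
    | tmul x y =>
      simp only [TensorProduct.map_tmul, LinearMap.mul'_apply, map_mul, Matrix.mul_apply,
        Finset.sum_smul, TensorProduct.lid_tmul, ractU2, LinearMap.comp_apply, LinearMap.id_apply]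
      rw [Finset.sum_comm]
      refine Finset.sum_congr rfl fun j _ => ?_
      change _ • ract q (v j) y = _
      rw [hv, Finset.smul_sum]
      simp [entry, smul_smul]
  have h2 := key (comulU2 q h)
  rw [antipodeU2_left] at h2
  refine h2.trans ?_
  simp [Matrix.algebraMap_matrix_apply]

/-- A subalgebra of `U_q(u(2))` that contains `K_1, E_1, F_1, K_1 K_2²` and the inverses of its
elements is everything. -/
lemma mem_of_generators (T : Subalgebra ℂ (Uu2 q))
    (hinv : ∀ x y : Uu2 q, x * y = 1 → y * x = 1 → x ∈ T → y ∈ T) (hK : K1 q ∈ T) (hE : E1 q ∈ T)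
    (hF : F1 q ∈ T) (hL : K1K2sq q ∈ T) (h : Uu2 q) : h ∈ T := by
  have hR := isURep_U q
  have hle : Uu2 q ≤ T.map (Uu2 q).val := by
    apply Uu2_le
    · exact ⟨K1 q, hK, rfl⟩
    · exact ⟨⟨Kinv q 0, Kinv_mem q⟩, hinv (K1 q) _ (Subtype.ext (hR.kl 0))
        (Subtype.ext (hR.lk 0)) hK, rfl⟩
    · exact ⟨E1 q, hE, rfl⟩
    · exact ⟨F1 q, hF, rfl⟩
    · exact ⟨K1K2sq q, hL, rfl⟩
    · have c1 : K q 0 * K q 1 ^ 2 * (Kinv q 0 * Kinv q 1 ^ 2) = 1 := by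
        have h1 : Commute (Kinv q 0) (K q 1) := hR.lkc 0 1
        have h2 : Commute (K q 1) (Kinv q 1) := (hR.kl 1).trans (hR.lk 1).symm
        rw [(h1.symm.pow_left 2).mul_mul_mul_comm, hR.kl, ← h2.mul_pow, hR.kl, one_pow, one_mul]
      have c2 : Kinv q 0 * Kinv q 1 ^ 2 * (K q 0 * K q 1 ^ 2) = 1 := by
        have h1 : Commute (Kinv q 1) (K q 0) := hR.lkc 1 0
        have h2 : Commute (Kinv q 1) (K q 1) := (hR.lk 1).trans (hR.kl 1).symm
        rw [(h1.pow_left 2).mul_mul_mul_comm, hR.lk, ← h2.mul_pow, hR.lk, one_pow, one_mul]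
      exact ⟨⟨_, Linv_mem q⟩, hinv (K1K2sq q) _ (Subtype.ext c1) (Subtype.ext c2) hL, rfl⟩
  obtain ⟨t, ht, hth⟩ := hle h.2
  have : t = h := Subtype.ext hth
  exact this ▸ ht

/-- The relation `v ◁ h = σ(h) v` holds for all `h` as soon as it holds for the generators. -/
lemma ract_eq_of_generators {n : ℕ} {σ : Uu2 q →ₐ[ℂ] Matrix (Fin n) (Fin n) ℂ} {v : Fin n → A q}
    (hK : ∀ i, ract q (v i) (K1 q) = ∑ j, σ (K1 q) i j • v j)
    (hE : ∀ i, ract q (v i) (E1 q) = ∑ j, σ (E1 q) i j • v j)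
    (hF : ∀ i, ract q (v i) (F1 q) = ∑ j, σ (F1 q) i j • v j)
    (hL : ∀ i, ract q (v i) (K1K2sq q) = ∑ j, σ (K1K2sq q) i j • v j)
    (h : Uu2 q) (i : Fin n) : ract q (v i) h = ∑ j, σ h i j • v j := by
  let T : Subalgebra ℂ (Uu2 q) :=
    { carrier := {x | ∀ i, ract q (v i) x = ∑ j, σ x i j • v j}
      mul_mem' := fun {x y} hx hy => by
        simp only [Set.mem_ofPred_eq] at hx hy ⊢
        intro i
        simp only [MulMemClass.coe_mul, ract_mul_right, hx, map_sum, map_smul, LinearMap.sum_apply,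
          LinearMap.smul_apply, hy, map_mul, Matrix.mul_apply, Finset.sum_smul, Finset.smul_sum,
          smul_smul]
        rw [Finset.sum_comm]
      add_mem' := fun {x y} hx hy => by
        simp only [Set.mem_ofPred_eq] at hx hy ⊢
        simp [hx, hy, add_smul, Finset.sum_add_distrib]
      algebraMap_mem' := fun c => by
        simp only [Set.mem_ofPred_eq]
        intro i
        have : ((algebraMap ℂ (Uu2 q) c : Uu2 q) : U q) = c • 1 := by
          rw [← Algebra.algebraMap_eq_smul_one]; rfl
        rw [this, map_smul, ract_one_right, AlgHom.commutes]
        simp [Matrix.algebraMap_matrix_apply] }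
  -- An element intertwines if its inverse does.
  have hinv : ∀ x y : Uu2 q, x * y = 1 → y * x = 1 → x ∈ T → y ∈ T := by
    intro x y hxy hyx hx i
    have e1 : v i = ∑ j, σ y i j • ract q (v j) x := by
      have : ∀ j, ract q (v j) x = ∑ k, σ x j k • v k := hx
      simp only [this, Finset.smul_sum, smul_smul]
      rw [Finset.sum_comm]
      simp only [← Finset.sum_smul, ← Matrix.mul_apply, ← map_mul, hyx, map_one]
      simp [Matrix.one_apply]
    rw [e1]
    simp only [map_sum, map_smul, LinearMap.sum_apply, LinearMap.smul_apply, ← ract_mul_right,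
      ← MulMemClass.coe_mul, hxy]
    simp [ract_one_right]
  exact mem_of_generators T hinv hK hE hF hL h i

lemma coe_K1 : ((K1 q : Uu2 q) : U q) = K q 0 := rfl
lemma coe_E1 : ((E1 q : Uu2 q) : U q) = E q 0 := rfl
lemma coe_F1 : ((F1 q : Uu2 q) : U q) = F q 0 := rfl
lemma coe_K1K2sq : ((K1K2sq q : Uu2 q) : U q) = K q 0 * K q 1 ^ 2 := rfl

/-- The one-forms of a given type are the doublets of a given weight. -/
lemma mem_Equivariant_iff {c : ℂ} (hc : c ≠ 0) {σ : Uu2 q →ₐ[ℂ] Matrix (Fin 2) (Fin 2) ℂ}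
    (hσ : σ (K1 q) = !![qh q, 0; 0, (qh q)⁻¹] ∧ σ (E1 q) = !![0, 1; 0, 0] ∧
      σ (F1 q) = !![0, 0; 1, 0] ∧ σ (K1K2sq q) = c • 1) (v : Fin 2 → A q) :
    v ∈ Equivariant σ ↔ IsDoublet c v := by
  obtain ⟨sK, sE, sF, sL⟩ := hσ
  have hh := qh_ne q
  have hR := isURep_U q
  constructor
  · intro hv
    have aK : antipodeU2 q (K1 q) = ⟨Kinv q 0, Kinv_mem q⟩ := by
      apply Subtype.ext; rw [coe_antipodeU2]; simp [K1]
    have aKinv : antipodeU2 q ⟨Kinv q 0, Kinv_mem q⟩ = K1 q := by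
      apply Subtype.ext; rw [coe_antipodeU2]; simp [K1]
    have aE : antipodeU2 q (E1 q) = -(qc q • E1 q) := by
      apply Subtype.ext; rw [coe_antipodeU2]; simp [E1]
    have aF : antipodeU2 q (F1 q) = -((qc q)⁻¹ • F1 q) := by
      apply Subtype.ext; rw [coe_antipodeU2]; simp [F1]
    have sKinv : σ ⟨Kinv q 0, Kinv_mem q⟩ = !![(qh q)⁻¹, 0; 0, qh q] := by
      have e1 : σ ⟨Kinv q 0, Kinv_mem q⟩ * σ (K1 q) = 1 := by
        rw [← map_mul, ← map_one σ]; congr 1; exact Subtype.ext (hR.lk 0)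
      have e2 : σ (K1 q) * !![(qh q)⁻¹, 0; 0, qh q] = 1 := by
        rw [sK]; ext i j; fin_cases i <;> fin_cases j <;> simp [hh]
      exact left_inv_eq_right_inv e1 e2
    have aL : σ (antipodeU2 q (K1K2sq q)) = c⁻¹ • 1 := by
      have e1 : σ (antipodeU2 q (K1K2sq q)) * σ (K1K2sq q) = 1 := by
        have := antipodeU2_left (K1K2sq q)
        rw [comulU2_K1K2sq] at this
        rw [← map_mul, ← map_one σ]; congr 1
        simpa [K1K2sq] using this
      have e2 : σ (K1K2sq q) * (c⁻¹ • 1) = 1 := by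
        rw [sL, smul_mul_smul_comm, mul_inv_cancel₀ hc, one_smul, one_mul]
      exact left_inv_eq_right_inv e1 e2
    -- Equivariance at each generator gives one relation for each component of `v`.
    have hK := fun i => hv (K1 q) i
    have hE := fun i => hv (E1 q) i
    have hF := fun i => hv (F1 q) i
    have hL := fun i => hv (K1K2sq q) i
    simp only [Fin.forall_fin_two, Fin.sum_univ_two, sweedlerLeft, comulU2_K1, comulU2_E1,
      comulU2_F1, comulU2_K1K2sq, LinearMap.comp_apply, AlgHom.toLinearMap_apply,
      TensorProduct.map_tmul, map_add, LinearEquiv.coe_coe, TensorProduct.lid_tmul,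
      entry, ractU2, Matrix.entryLinearMap_apply, aK, aKinv, aE, aF, aL, sKinv, sK, map_neg,
      map_smul, sE, sF] at hK hE hF hL
    simp [coe_K1, coe_E1, coe_F1, coe_K1K2sq] at hK hE hF hL
    have k0 : ract q (v 0) (K q 0) = qh q • v 0 := (inv_smul_eq_iff₀ hh).1 hK.1
    have k1 : ract q (v 1) (K q 0) = (qh q)⁻¹ • v 1 := (eq_inv_smul_iff₀ hh).2 hK.2
    have l0 := (inv_smul_eq_iff₀ hc).1 hL.1
    have l1 := (inv_smul_eq_iff₀ hc).1 hL.2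
    simp only [pow_two, ract_mul_right, k0, k1, map_smul, LinearMap.smul_apply] at l0 l1
    refine ⟨k0, k1, ?_, hE.2.resolve_left hh, hF.1.resolve_left hh, ?_, ?_, ?_⟩
    · apply smul_right_injective _ hh
      simp only
      rw [eq_neg_of_add_eq_zero_left hE.1, neg_neg, k1, smul_smul, qc_eq, mul_inv_cancel_right₀ hh]
    · apply smul_right_injective _ (inv_ne_zero hh)
      simp only
      rw [eq_neg_of_add_eq_zero_right hF.2, neg_neg, k0, smul_smul, qc_eq, mul_inv,
        inv_mul_cancel_right₀ hh]
    · apply smul_right_injective _ hh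
      simp only
      rw [l0, smul_smul, mul_comm c, mul_inv_cancel_left₀ hh]
    · apply smul_right_injective _ (inv_ne_zero hh)
      simp only
      rw [l1, smul_smul, mul_comm c, inv_mul_cancel_left₀ hh]
  · intro h
    apply mem_Equivariant_of_ract
    apply ract_eq_of_generators
    · intro i; fin_cases i <;> simp [sK, coe_K1, h.K0, h.K1]
    · intro i; fin_cases i <;> simp [sE, coe_E1, h.E0, h.E1]
    · intro i; fin_cases i <;> simp [sF, coe_F1, h.F0, h.F1]
    · intro i
      fin_cases i <;> simp [sL, coe_K1K2sq, pow_two, ract_mul_right, h.K0, h.K1, h.KK0, h.KK1,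
        smul_smul, hh, mul_comm c]

lemma mem_Omega10_iff (v : Fin 2 → A q) : v ∈ Omega10 q ↔ IsDoublet (qh q ^ 3)⁻¹ v :=
  mem_Equivariant_iff (inv_ne_zero (pow_ne_zero _ (qh_ne q))) (sigma10_values q) v

lemma mem_Omega01_iff (v : Fin 2 → A q) : v ∈ Omega01 q ↔ IsDoublet (qh q ^ 3) v :=
  mem_Equivariant_iff (pow_ne_zero _ (qh_ne q)) (sigma01_values q) v

lemma IsDoublet.singlet_mul {c : ℂ} {v : Fin 2 → A q} (h : IsDoublet c v) {a : A q}
    (ha : IsSinglet 1 a) : IsDoublet c (a • v) where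
  K0 := by simp [ract_mul_K, ha.K, h.K0]
  K1 := by simp [ract_mul_K, ha.K, h.K1]
  E0 := by simp [ract_mul_E, ha.E, ha.Kinv, h.E0]
  E1 := by simp [ract_mul_E, ha.E, ha.Kinv, h.E1]
  F0 := by simp [ract_mul_F, ha.F, ha.Kinv, h.F0]
  F1 := by simp [ract_mul_F, ha.F, ha.Kinv, h.F1]
  KK0 := by simp [ract_mul_K, ha.KK, h.KK0]
  KK1 := by simp [ract_mul_K, ha.KK, h.KK1]

/-! ### The partial derivatives of a singlet -/

lemma IsSinglet.ract_K_two {c : ℂ} {a : A q} (ha : IsSinglet c a) :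
    IsSinglet c (ract q a (QuantumCP2.K q 1)) where
  K := by rw [ract_K_comm, ha.K]
  E := by
    have := ract_E_K_ne a (i := 1) (j := 0) (by decide)
    rw [ha.E, map_zero, LinearMap.zero_apply] at this
    exact (smul_eq_zero.1 this.symm).resolve_left (qh_ne q)
  F := by
    have := ract_F_K_ne a (i := 1) (j := 0) (by decide)
    rw [ha.F, map_zero, LinearMap.zero_apply] at this
    exact (smul_eq_zero.1 this.symm).resolve_left (inv_ne_zero (qh_ne q))
  KK := by rw [ha.KK, map_smul, LinearMap.smul_apply]

lemma IsSinglet.Kinv_two {a : A q} (ha : IsSinglet 1 a) :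
    ract q a (QuantumCP2.Kinv q 1) = ract q a (QuantumCP2.K q 1) := by
  have := congrArg (fun x => ract q x (QuantumCP2.Kinv q 1)) ha.KK
  simp only [ract_K_Kinv, one_smul] at this
  exact this.symm

/-- On an invariant element, `∂` is given by `E_2` and by `E_2` followed by `E_1`. -/
lemma del_apply {a : A q} (ha : IsSinglet 1 a) : del q a
    = ![-((qh q ^ 3)⁻¹ • ract q (ract q a (K q 1)) (E q 1)),
      -((qh q ^ 3)⁻¹ • ract q (ract q (ract q a (K q 1)) (E q 1)) (E q 0))] := by
  have hh := qh_ne q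
  ext k
  fin_cases k <;> simp [del, leftAct, X, Sinv_mul, qcomm, ract_mul_right, ha.E, ha.Kinv_two,
    ha.ract_K_two.Kinv, ract_E_Kinv, ract_E_Kinv_ne, smul_smul, qc_eq] <;>
    congr 1 <;> field_simp

/-- On an invariant element, `∂̄` is given by `F_2` and by `F_2` followed by `F_1`. -/
lemma delbar_apply {a : A q} (ha : IsSinglet 1 a) : delbar q a
    = ![-ract q (ract q (ract q a (K q 1)) (F q 1)) (F q 0),
      -ract q (ract q a (K q 1)) (F q 1)] := by
  have hh := qh_ne q
  ext k
  fin_cases k <;> simp [delbar, leftAct, Y, Sinv_mul, qcomm, ract_mul_right, ha.F, ha.Kinv_two,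
    ha.ract_K_two.Kinv, ract_F_Kinv, ract_F_Kinv_ne, smul_smul, qc_eq] <;>
    · refine (congrArg (· • _) ?_).trans (one_smul ℂ _)
      field_simp

lemma IsDoublet.smul {c : ℂ} {v : Fin 2 → A q} (h : IsDoublet c v) (r : ℂ) :
    IsDoublet c (r • v) where
  K0 := by simp [h.K0, smul_comm r]
  K1 := by simp [h.K1, smul_comm r]
  E0 := by simp [h.E0]
  E1 := by simp [h.E1]
  F0 := by simp [h.F0]
  F1 := by simp [h.F1]
  KK0 := by simp [h.KK0, smul_comm r]
  KK1 := by simp [h.KK1, smul_comm r]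

/-- For an invariant `b`, the element `b ◁ E_2` is killed by `F_1`, and its string under `E_1`
ends after one step by the `q`-Serre relation. -/
lemma doublet_E {b : A q} (hb : IsSinglet 1 b) :
    IsDoublet (qh q ^ 3)⁻¹ ![ract q b (E q 1), ract q (ract q b (E q 1)) (E q 0)] := by
  have hh := qh_ne q
  have hs := qc_sub_ne q
  have hF : ract q (ract q b (E q 1)) (F q 0) = 0 := by simp [ract_E_F_ne, hb.F]
  have hk : ract q (ract q b (E q 1)) (K q 0) = qh q • ract q b (E q 1) := by
    simp [ract_E_K_ne, hb.K]
  have hki : ract q (ract q b (E q 1)) (Kinv q 0) = (qh q)⁻¹ • ract q b (E q 1) := by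
    simp [ract_E_Kinv_ne, hb.Kinv]
  constructor <;> simp [hF, hk, hki, ract_E_serre hb.E, ract_E_F, ract_E_K, ract_E_K_ne, hb.KK,
    smul_smul]
  case F1 => rw [← sub_smul, smul_smul, ← mul_inv, ← qc_eq, inv_mul_cancel₀ hs, one_smul]
  all_goals
    congr 1
    rw [qc_eq]
    field_simp

/-- For an invariant `b`, the element `b ◁ F_2` is killed by `E_1`, and its string under `F_1`
ends after one step by the `q`-Serre relation. -/
lemma doublet_F {b : A q} (hb : IsSinglet 1 b) :
    IsDoublet (qh q ^ 3) ![ract q (ract q b (F q 1)) (F q 0), ract q b (F q 1)] := by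
  have hh := qh_ne q
  have hs := qc_sub_ne q
  have hE : ract q (ract q b (F q 1)) (E q 0) = 0 := by simp [← ract_E_F_ne, hb.E]
  have hk : ract q (ract q b (F q 1)) (K q 0) = (qh q)⁻¹ • ract q b (F q 1) := by
    simp [ract_F_K_ne, hb.K]
  have hki : ract q (ract q b (F q 1)) (Kinv q 0) = qh q • ract q b (F q 1) := by
    simp [ract_F_Kinv_ne, hb.Kinv]
  constructor <;> simp [hE, hk, hki, ract_F_serre hb.F, ract_F_E, ract_F_K, ract_F_K_ne, hb.KK,
    smul_smul]
  case E0 => rw [← sub_smul, smul_smul, ← neg_smul, ← mul_inv, ← qc_eq, ← mul_neg, neg_sub,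
      inv_mul_cancel₀ hs, one_smul]
  all_goals
    congr 1
    rw [qc_eq]
    field_simp

lemma del_doublet {a : A q} (ha : IsSinglet 1 a) : IsDoublet (qh q ^ 3)⁻¹ (del q a) := by
  have h := (doublet_E ha.ract_K_two).smul (-(qh q ^ 3)⁻¹)
  rw [del_apply ha]
  convert h using 1
  simp

lemma delbar_doublet {a : A q} (ha : IsSinglet 1 a) : IsDoublet (qh q ^ 3) (delbar q a) := by
  have h := (doublet_F ha.ract_K_two).smul (-1)
  rw [delbar_apply ha]
  convert h using 1
  simp

lemma del_mem {a : A q} (ha : a ∈ CP2 q) : del q a ∈ Omega10 q :=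
  (mem_Omega10_iff _).2 (del_doublet ((mem_CP2_iff a).1 ha))

lemma delbar_mem {a : A q} (ha : a ∈ CP2 q) : delbar q a ∈ Omega01 q :=
  (mem_Omega01_iff _).2 (delbar_doublet ((mem_CP2_iff a).1 ha))

lemma IsSinglet.mul_of_weight_one {a b : A q} (ha : IsSinglet 1 a) (hb : IsSinglet 1 b) :
    IsSinglet 1 (a * b) := by
  simpa using ha.mul hb

lemma del_zero {a : A q} (ha : IsSinglet 1 a) : del q a 0
    = -((qh q ^ 3)⁻¹ • ract q (ract q a (K q 1)) (E q 1)) := congrFun (del_apply ha) 0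

lemma del_one {a : A q} (ha : IsSinglet 1 a) : del q a 1
    = -((qh q ^ 3)⁻¹ • ract q (ract q (ract q a (K q 1)) (E q 1)) (E q 0)) :=
  congrFun (del_apply ha) 1

lemma delbar_zero {a : A q} (ha : IsSinglet 1 a) : delbar q a 0
    = -ract q (ract q (ract q a (K q 1)) (F q 1)) (F q 0) := congrFun (delbar_apply ha) 0

lemma delbar_one {a : A q} (ha : IsSinglet 1 a) : delbar q a 1
    = -ract q (ract q a (K q 1)) (F q 1) := congrFun (delbar_apply ha) 1

/-- The Leibniz rule for `∂` on invariant elements: the group-like factors in the coproducts of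
`X_1` and `X_2` act trivially, as does `E_1`. -/
lemma del_mul {a b : A q} (ha : IsSinglet 1 a) (hb : IsSinglet 1 b) (k : Fin 2) :
    del q (a * b) k = del q a k * b + a * del q b k := by
  have h := ha.mul_of_weight_one hb
  revert k
  rw [Fin.forall_fin_two, del_zero ha, del_zero hb, del_zero h, del_one ha, del_one hb, del_one h]
  constructor <;>
    simp [ract_mul_K, ract_mul_E, ract_K_Kinv, hb.KK, ha.E, hb.E, ha.Kinv, hb.K] <;> abel

/-- The Leibniz rule for `∂̄` on invariant elements. -/
lemma delbar_mul {a b : A q} (ha : IsSinglet 1 a) (hb : IsSinglet 1 b) (k : Fin 2) :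
    delbar q (a * b) k = delbar q a k * b + a * delbar q b k := by
  have h := ha.mul_of_weight_one hb
  revert k
  rw [Fin.forall_fin_two, delbar_zero ha, delbar_zero hb, delbar_zero h, delbar_one ha,
    delbar_one hb, delbar_one h]
  constructor <;>
    simp [ract_mul_K, ract_mul_F, ract_K_Kinv, hb.KK, ha.F, hb.F, ha.Kinv, hb.K] <;> abel

lemma star_qh : star (qh q) = qh q := conj_qh q

/-- The involution exchanges the actions of `E_i` and `F_i`, hence, up to sign, `∂` and `∂̄`. -/
lemma extd_star {a : A q} (ha : a ∈ CP2 q) : extd q (star a) = -starForm (extd q a) := by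
  have hh := qh_ne q
  have hs := (mem_CP2_iff _).1 (star_mem_CP2 ha)
  have h := (mem_CP2_iff a).1 ha
  have hK : ract q (star a) (K q 1) = star (ract q a (K q 1)) := by
    rw [ract_star_K, h.Kinv_two]
  have e : ∀ b : A q, extd q b = (del q b, delbar q b) := fun _ => rfl
  rw [e, e]
  apply Prod.ext <;> funext k <;> revert k <;>
    simp only [Fin.forall_fin_two, starForm, quatJ, del_zero hs, del_one hs, delbar_zero hs,
      delbar_one hs, del_zero h, del_one h, delbar_zero h, delbar_one h, hK, ract_star_E,
      ract_star_F, Prod.fst_neg, Prod.snd_neg, neg_neg, Pi.neg_apply, Matrix.cons_val_zero,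
      Matrix.cons_val_one, map_neg, map_smul, LinearMap.neg_apply, LinearMap.smul_apply, star_neg,
      star_smul, star_inv₀, star_pow, star_qh, smul_neg, smul_smul] <;>
    refine ⟨?_, ?_⟩ <;> simp [qc_eq]
  all_goals (congr 1; field_simp)

/-! ### Orthogonality relations and generating one-forms -/

lemma sum_u_mul_star (a b : Fin 3) :
    ∑ k, u q a k * star (u q b k) = if a = b then 1 else 0 := by
  simp only [star_u]
  exact mul_cof (isARep_u q) a b

/-- The orthogonality relation twisted by the square of the antipode. It comes from
`∑ ε_{def} u^a_d u^b_e u^c_f = ε_{abc}`, where the first two factors add up to a quantum minor. -/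
lemma sum_star_mul_u (a b : Fin 3) :
    ∑ k : Fin 3, ((qc q ^ (k : ℕ))⁻¹ * (qc q ^ (k : ℕ))⁻¹) • (star (u q b k) * u q a k)
      = if a = b then ((qc q ^ (a : ℕ))⁻¹ * (qc q ^ (a : ℕ))⁻¹) • 1 else 0 := by
  have hq := qc_ne q
  have h := isARep_u q
  have h1 := cube_qeps h.braid (lo b) (hi b) a
  rw [h.det] at h1
  have h2 : ∀ f : Fin 3, ∑ d, ∑ e, qeps q d e f • (u q (lo b) d * u q (hi b) e)
      = (qc q ^ 2 * ((qc q ^ (f : ℕ))⁻¹ * (qc q ^ (f : ℕ))⁻¹) * (-qc q) ^ (b : ℕ)) •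
        star (u q b f) := by
    intro f
    rw [star_u, ← smul_smul, ← cof_row]
    fin_cases f <;> simp [Fin.sum_univ_three, qeps]
    all_goals (match_scalars <;> field_simp)
  have h3 : ∑ d, ∑ e, ∑ f, qeps q d e f • (u q (lo b) d * u q (hi b) e * u q a f)
      = ∑ f, (∑ d, ∑ e, qeps q d e f • (u q (lo b) d * u q (hi b) e)) * u q a f := by
    simp only [Fin.sum_univ_three, add_mul, smul_mul_assoc]; abel
  rw [h3] at h1
  simp only [h2, smul_mul_assoc] at h1
  have hc : qc q ^ 2 * (-qc q) ^ (b : ℕ) ≠ 0 :=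
    mul_ne_zero (pow_ne_zero _ hq) (pow_ne_zero _ (neg_ne_zero.2 hq))
  apply smul_right_injective _ hc
  simp only
  calc _ = _ := ?_
    _ = _ := h1
    _ = _ := ?_
  · rw [Finset.smul_sum]
    refine Finset.sum_congr rfl fun k _ => ?_
    rw [smul_smul]
    congr 1; ring
  · fin_cases a <;> fin_cases b <;> simp [qeps, lo, hi, smul_smul]
    all_goals (match_scalars; field_simp)

/-- The third row `z_j = u^3_j`, the homogeneous coordinates, consists of singlets of weight `q`. -/
lemma singlet_u (j : Fin 3) : IsSinglet (qc q) (u q 2 j) := by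
  constructor <;> simp [ract_u_K, ract_u_E, ract_u_F, smul_smul, qc_eq]

lemma singlet_star_u (j : Fin 3) : IsSinglet (qc q)⁻¹ (star (u q 2 j)) := by
  simpa [conj_qc] using (singlet_u j).star (qc_ne q)

lemma singlet_star_mul_u (j k : Fin 3) : IsSinglet 1 (star (u q 2 j) * u q 2 k) := by
  simpa [qc_ne q] using (singlet_star_u (q := q) j).mul (singlet_u k)

lemma singlet_u_mul_star (j k : Fin 3) : IsSinglet 1 (u q 2 j * star (u q 2 k)) := by
  simpa [qc_ne q] using (singlet_u (q := q) j).mul (singlet_star_u k)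

lemma extd_star_mul_u (j k : Fin 3) : extd q (star (u q 2 j) * u q 2 k)
    = (![-((qc q)⁻¹ • (star (u q 2 j) * u q 1 k)), -((qc q)⁻¹ • (star (u q 2 j) * u q 0 k))],
      ![-((qh q ^ 3)⁻¹ • (star (u q 0 j) * u q 2 k)), (qh q)⁻¹ • (star (u q 1 j) * u q 2 k)]) := by
  have hh := qh_ne q
  have h := singlet_star_mul_u (q := q) j k
  have e : ∀ b : A q, extd q b = (del q b, delbar q b) := fun _ => rfl
  rw [e, del_apply h, delbar_apply h]
  simp [ract_mul_K, ract_mul_E, ract_mul_F, ract_star_K, ract_star_Kinv, ract_star_E, ract_star_F,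
    ract_u_K, ract_u_Kinv, ract_u_E, ract_u_F, smul_smul, conj_qh]
  refine ⟨⟨?_, ?_⟩, ?_, ?_⟩ <;> congr 1 <;> rw [qc_eq] <;> field_simp

lemma extd_u_mul_star (j k : Fin 3) : extd q (u q 2 j * star (u q 2 k))
    = (![-((qc q ^ 2)⁻¹ • (u q 1 j * star (u q 2 k))),
        -((qc q ^ 2)⁻¹ • (u q 0 j * star (u q 2 k)))],
      ![-((qh q ^ 5)⁻¹ • (u q 2 j * star (u q 0 k))),
        (qh q ^ 3)⁻¹ • (u q 2 j * star (u q 1 k))]) := by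
  have hh := qh_ne q
  have h := singlet_u_mul_star (q := q) j k
  have e : ∀ b : A q, extd q b = (del q b, delbar q b) := fun _ => rfl
  rw [e, del_apply h, delbar_apply h]
  simp [ract_mul_K, ract_mul_E, ract_mul_F, ract_star_K, ract_star_E, ract_star_F,
    ract_u_K, ract_u_Kinv, ract_u_E, ract_u_F, smul_smul, conj_qh]
  refine ⟨⟨?_, ?_⟩, ?_, ?_⟩ <;> congr 1 <;> rw [qc_eq] <;> field_simp

lemma IsSinglet.smul {c : ℂ} {a : A q} (h : IsSinglet c a) (r : ℂ) : IsSinglet c (r • a) where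
  K := by simp [h.K]
  E := by simp [h.E]
  F := by simp [h.F]
  KK := by simp [h.KK, smul_comm r]

/-- The contraction of a `(1,0)`-form with the adjoint of the first two rows is a singlet. -/
lemma IsDoublet.contract_star {v : Fin 2 → A q} (h : IsDoublet (qh q ^ 3)⁻¹ v) (k : Fin 3) :
    IsSinglet (qc q)⁻¹ (qc q ^ 2 • (v 0 * star (u q 1 k)) + v 1 * star (u q 0 k)) := by
  have hh := qh_ne q
  constructor <;> simp [ract_mul_K, ract_mul_E, ract_mul_F, ract_star_K,
    ract_star_E, ract_star_F, ract_u_Kinv, ract_u_E, ract_u_F, h.K0, h.K1, h.E0, h.E1,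
    h.F0, h.F1, h.KK0, h.KK1, h.Kinv0, h.Kinv1, smul_smul, conj_qh, qc_eq]
  all_goals match_scalars <;> field_simp <;> ring

/-- The contraction of a `(0,1)`-form with the first two rows is a singlet. -/
lemma IsDoublet.contract {w : Fin 2 → A q} (h : IsDoublet (qh q ^ 3) w) (j : Fin 3) :
    IsSinglet (qc q) (w 1 * u q 1 j - qc q • (w 0 * u q 0 j)) := by
  have hh := qh_ne q
  constructor <;> simp [ract_mul_K, ract_mul_E, ract_mul_F, ract_u_K, ract_u_E,
    ract_u_F, h.K0, h.K1, h.E0, h.E1, h.F0, h.F1, h.KK0, h.KK1, h.Kinv0, h.Kinv1, smul_smul, qc_eq]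
  all_goals match_scalars <;> field_simp

/-- Contraction of the inner indices. -/
lemma sum_contract {f x z s : Fin 3 → A q} {r : A q} (h : ∑ j, z j * s j = r) :
    ∑ k, ∑ j, (f k * z j) * (s j * x k) = ∑ k, f k * r * x k := by
  refine Finset.sum_congr rfl fun k _ => ?_
  rw [← h, Finset.mul_sum, Finset.sum_mul]
  simp only [mul_assoc]

/-! ### The one-forms are spanned by the elements `a db` -/

variable (q) in
/-- The span of the elements `a db`. -/
def spanAdB : Submodule ℂ ((Fin 2 → A q) × (Fin 2 → A q)) :=
  Submodule.span ℂ {ω | ∃ a ∈ CP2 q, ∃ b ∈ CP2 q, ω = a • extd q b}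

lemma smul_extd_mem {a b : A q} (ha : IsSinglet 1 a) (hb : IsSinglet 1 b) :
    a • extd q b ∈ spanAdB q :=
  Submodule.subset_span ⟨a, (mem_CP2_iff a).2 ha, b, (mem_CP2_iff b).2 hb, rfl⟩

/-- The span lies in `Ω¹` because a singlet of weight one times a doublet is again a doublet. -/
lemma spanAdB_le : spanAdB q ≤ Omega1 q := by
  rw [spanAdB, Submodule.span_le]
  rintro _ ⟨a, ha, b, hb, rfl⟩
  rw [mem_CP2_iff] at ha hb
  exact ⟨(mem_Omega10_iff _).2 ((del_doublet hb).singlet_mul ha),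
    (mem_Omega01_iff _).2 ((delbar_doublet hb).singlet_mul ha)⟩

/-- `(1,0)`-forms are combinations of the `a d(z_j^* z_k)`, with `z_j = u^3_j`. The `(0,1)`-parts of
these combinations cancel because the third row is orthogonal to the first two. -/
lemma inl_mem_span {v : Fin 2 → A q} (hv : IsDoublet (qh q ^ 3)⁻¹ v) :
    (v, (0 : Fin 2 → A q)) ∈ spanAdB q := by
  have hq := qc_ne q
  let f : Fin 3 → A q := fun k => (-(qc q * ((qc q ^ (k : ℕ))⁻¹ * (qc q ^ (k : ℕ))⁻¹))) •
    (qc q ^ 2 • (v 0 * star (u q 1 k)) + v 1 * star (u q 0 k))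
  have hf : ∀ k, IsSinglet (qc q)⁻¹ (f k) := fun k => (hv.contract_star k).smul _
  have key : (v, (0 : Fin 2 → A q))
      = ∑ k, ∑ j, (f k * u q 2 j) • extd q (star (u q 2 j) * u q 2 k) := by
    have o : ∀ b : Fin 3, ∑ j, u q 2 j * star (u q b j) = if 2 = b then 1 else 0 :=
      sum_u_mul_star 2
    have c1 := fun x : Fin 3 → A q => sum_contract (f := f) (x := x) (o 2)
    have c2 := fun x : Fin 3 → A q => sum_contract (f := f) (x := x) (o 1)
    have c3 := fun x : Fin 3 → A q => sum_contract (f := f) (x := x) (o 0)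
    have t : ∀ a : Fin 3, ∑ k, f k * u q a k = -(qc q) • (qc q ^ 2 • (v 0 *
        ∑ k : Fin 3, ((qc q ^ (k : ℕ))⁻¹ * (qc q ^ (k : ℕ))⁻¹) • (star (u q 1 k) * u q a k)) + v 1 *
        ∑ k : Fin 3, ((qc q ^ (k : ℕ))⁻¹ * (qc q ^ (k : ℕ))⁻¹) • (star (u q 0 k) * u q a k)) := by
      intro a
      simp only [Finset.mul_sum, Finset.smul_sum, ← Finset.sum_add_distrib]
      refine Finset.sum_congr rfl fun k _ => ?_
      simp only [f, smul_mul_assoc, add_mul, mul_assoc, mul_smul_comm]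
      module
    simp only [sum_star_mul_u] at t
    simp only [extd_star_mul_u]
    apply Prod.ext <;> funext i <;> revert i <;> rw [Fin.forall_fin_two]
    all_goals
      simp only [Prod.fst_sum, Prod.snd_sum, Finset.sum_apply, Prod.smul_fst, Prod.smul_snd,
        Pi.smul_apply, smul_eq_mul, Matrix.cons_val_zero, Matrix.cons_val_one, mul_neg,
        mul_smul_comm, Finset.sum_neg_distrib, ← Finset.smul_sum, c1, c2, c3]
      simp [t, hq, smul_smul]
    rw [show qc q ^ 2 * ((qc q)⁻¹ * (qc q)⁻¹) = 1 by field_simp, one_smul]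
  rw [key]
  refine Submodule.sum_mem _ fun k _ => Submodule.sum_mem _ fun j _ =>
    smul_extd_mem ?_ (singlet_star_mul_u j k)
  simpa [hq] using (hf k).mul (singlet_u j)

/-- `(0,1)`-forms are combinations of the `a d(z_k z_j^*)`, with `z_j = u^3_j`. The `(1,0)`-parts of
these combinations cancel because of the twisted orthogonality of the rows. -/
lemma inr_mem_span {w : Fin 2 → A q} (hw : IsDoublet (qh q ^ 3) w) :
    ((0 : Fin 2 → A q), w) ∈ spanAdB q := by
  have hq := qc_ne q
  have hh := qh_ne q
  let f : Fin 3 → A q := fun j => qh q ^ 3 • (w 1 * u q 1 j - qc q • (w 0 * u q 0 j))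
  have hf : ∀ j, IsSinglet (qc q) (f j) := fun j => (hw.contract j).smul _
  -- The factor `q⁴` normalizes the twisted norm of the third row to one.
  let z : Fin 3 → A q := fun k =>
    (qc q ^ 4 * ((qc q ^ (k : ℕ))⁻¹ * (qc q ^ (k : ℕ))⁻¹)) • star (u q 2 k)
  have hz : ∀ k, IsSinglet (qc q)⁻¹ (z k) := fun k => (singlet_star_u k).smul _
  have key : ((0 : Fin 2 → A q), w)
      = ∑ j, ∑ k, (f j * z k) • extd q (u q 2 k * star (u q 2 j)) := by
    have o : ∀ a : Fin 3, ∑ k, z k * u q a k = if a = 2 then 1 else 0 := by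
      intro a
      have := congrArg (qc q ^ 4 • ·) (sum_star_mul_u (q := q) a 2)
      simp only [Finset.smul_sum, smul_smul] at this
      simp only [z, smul_mul_assoc, this]
      by_cases h : a = 2
      · have hc : qc q ^ 4 * ((qc q ^ 2)⁻¹ * (qc q ^ 2)⁻¹) = 1 := by field_simp
        simp [h, smul_smul, hc]
      · simp [h]
    have c1 := fun x : Fin 3 → A q => sum_contract (f := f) (x := x) (o 2)
    have c2 := fun x : Fin 3 → A q => sum_contract (f := f) (x := x) (o 1)
    have c3 := fun x : Fin 3 → A q => sum_contract (f := f) (x := x) (o 0)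
    have t : ∀ b : Fin 3, ∑ j, f j * star (u q b j) = qh q ^ 3 • (w 1 *
        ∑ j, u q 1 j * star (u q b j) - qc q • (w 0 * ∑ j, u q 0 j * star (u q b j))) := by
      intro b
      simp only [Finset.mul_sum, Finset.smul_sum, ← Finset.sum_sub_distrib]
      refine Finset.sum_congr rfl fun k _ => ?_
      simp only [f, smul_mul_assoc, sub_mul, mul_assoc]
    simp only [sum_u_mul_star] at t
    simp only [extd_u_mul_star]
    apply Prod.ext <;> funext i <;> revert i <;> rw [Fin.forall_fin_two]
    all_goals
      simp only [Prod.fst_sum, Prod.snd_sum, Finset.sum_apply, Prod.smul_fst, Prod.smul_snd,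
        Pi.smul_apply, smul_eq_mul, Matrix.cons_val_zero, Matrix.cons_val_one, mul_neg,
        mul_smul_comm, Finset.sum_neg_distrib, ← Finset.smul_sum, c1, c2, c3]
      simp [t, hh, smul_smul]
    rw [qc_eq, show (qh q ^ 5)⁻¹ * (qh q ^ 3 * (qh q * qh q)) = 1 by field_simp, one_smul]
  rw [key]
  refine Submodule.sum_mem _ fun j _ => Submodule.sum_mem _ fun k _ =>
    smul_extd_mem ?_ (singlet_u_mul_star k j)
  simpa [hq] using (hf j).mul (hz k)

lemma spanAdB_eq : spanAdB q = Omega1 q := by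
  refine le_antisymm spanAdB_le fun ω hω => ?_
  have h1 := inl_mem_span ((mem_Omega10_iff _).1 hω.1)
  have h2 := inr_mem_span ((mem_Omega01_iff _).1 hω.2)
  simpa using add_mem h1 h2

/-! ### Invariance of `X` and `Y` -/

lemma radj_one (x : U q) : radj x 1 = x := by
  simp [radj, Bialgebra.comul_one, Algebra.TensorProduct.one_def]

/-- The right adjoint action is an action. -/
lemma radj_mul (x g h : U q) : radj x (g * h) = radj (radj x g) h := by
  simp only [radj, LinearMap.comp_apply, Bialgebra.comul_mul]
  generalize Coalgebra.comul (R := ℂ) g = t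
  generalize Coalgebra.comul (R := ℂ) h = s
  induction s with
  | zero => simp
  | add y z hy hz => simp only [mul_add, map_add, hy, hz]
  | tmul c d =>
    simp only [TensorProduct.map_tmul, LinearMap.mul'_apply, LinearMap.comp_apply,
      LinearMap.mulRight_apply, LinearMap.id_apply]
    induction t with
    | zero => simp
    | add y z hy hz => simp only [add_mul, mul_add, map_add, hy, hz]
    | tmul a b => simp [S_mul, mul_assoc]

lemma radj_add (x y h : U q) : radj (x + y) h = radj x h + radj y h := by
  simp only [radj, LinearMap.comp_apply]
  generalize Coalgebra.comul (R := ℂ) h = t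
  induction t with
  | zero => simp
  | add y z hy hz => simp only [map_add, hy, hz]; abel
  | tmul a b => simp [mul_add, add_mul]

lemma radj_smul (c : ℂ) (x h : U q) : radj (c • x) h = c • radj x h := by
  simp only [radj, LinearMap.comp_apply]
  generalize Coalgebra.comul (R := ℂ) h = t
  induction t with
  | zero => simp
  | add y z hy hz => simp only [map_add, hy, hz, smul_add]
  | tmul a b => simp

/-- The right adjoint action of `h`, as a linear map. -/
noncomputable def radjHom (h : U q) : U q →ₗ[ℂ] U q where
  toFun x := radj x h
  map_add' x y := radj_add x y h
  map_smul' c x := radj_smul c x h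

lemma radj_K (x : U q) (i : Fin 2) : radj x (K q i) = Kinv q i * x * K q i := by
  simp [radj, comul_K]
lemma radj_Kinv (x : U q) (i : Fin 2) : radj x (Kinv q i) = K q i * x * Kinv q i := by
  simp [radj, comul_Kinv]
lemma radj_E (x : U q) (i : Fin 2) :
    radj x (E q i) = -(qc q • (E q i * x * K q i)) + K q i * x * E q i := by
  simp [radj, comul_E]
lemma radj_F (x : U q) (i : Fin 2) :
    radj x (F q i) = -((qc q)⁻¹ • (F q i * x * K q i)) + K q i * x * F q i := by
  simp [radj, comul_F]

/-- The map `a ⊗ b ↦ ∑_k σ(b)_{ik} (X_k ◁ S⁻¹(a))`: its value at `Δ(h)` is the `i`-th component of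
the action of `h` on `∑_k X_k ⊗ e^k`. -/
noncomputable def tensorAct {n : ℕ} (σ : Uu2 q →ₐ[ℂ] Matrix (Fin n) (Fin n) ℂ) (X : Fin n → U q)
    (i : Fin n) : Uu2 q ⊗[ℂ] Uu2 q →ₗ[ℂ] U q :=
  ∑ k, (TensorProduct.rid ℂ (U q)).toLinearMap ∘ₗ
    TensorProduct.map (radj (X k) ∘ₗ Sinv q ∘ₗ (Uu2 q).val.toLinearMap) (entry σ i k)

lemma tensorAct_tmul {n : ℕ} (σ : Uu2 q →ₐ[ℂ] Matrix (Fin n) (Fin n) ℂ) (X : Fin n → U q)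
    (i : Fin n) (a b : Uu2 q) :
    tensorAct σ X i (a ⊗ₜ b) = ∑ k, σ b i k • radjHom (Sinv q (a : U q)) (X k) := by
  simp [tensorAct, entry, radjHom]

/-- `tensorAct` is compatible with products, so that `h ↦ tensorAct (Δ h)` is a left action. -/
lemma tensorAct_mul {n : ℕ} (σ : Uu2 q →ₐ[ℂ] Matrix (Fin n) (Fin n) ℂ) (X : Fin n → U q)
    (i : Fin n) (t s : Uu2 q ⊗[ℂ] Uu2 q) :
    tensorAct σ X i (t * s) = tensorAct σ (fun k => tensorAct σ X k s) i t := by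
  induction t with
  | zero => simp
  | add y z hy hz => simp only [add_mul, map_add, hy, hz]
  | tmul a b =>
    rw [tensorAct_tmul]
    induction s with
    | zero => simp
    | add y z hy hz => simp only [mul_add, map_add, hy, hz, smul_add, Finset.sum_add_distrib]
    | tmul c d =>
      have e : ∀ x : U q, radjHom (Sinv q (a : U q)) (radjHom (Sinv q (c : U q)) x)
          = radjHom (Sinv q ((a * c : Uu2 q) : U q)) x := by
        intro x
        simp [radjHom, Sinv_mul, radj_mul]
      rw [Algebra.TensorProduct.tmul_mul_tmul, tensorAct_tmul]
      simp only [tensorAct_tmul, map_sum, map_smul, e, Finset.smul_sum, smul_smul, map_mul,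
        Matrix.mul_apply, Finset.sum_smul]
      rw [Finset.sum_comm]

lemma isInvariant_iff {n : ℕ} (σ : Uu2 q →ₐ[ℂ] Matrix (Fin n) (Fin n) ℂ) (X : Fin n → U q) :
    IsInvariant σ X ↔ ∀ h i, tensorAct σ X i (comulU2 q h)
      = Coalgebra.counit (R := ℂ) (h : U q) • X i := by
  simp [IsInvariant, tensorAct, sweedlerRight]

lemma tensorAct_smul {n : ℕ} (σ : Uu2 q →ₐ[ℂ] Matrix (Fin n) (Fin n) ℂ) (X : Fin n → U q)
    (i : Fin n) (c : ℂ) (t : Uu2 q ⊗[ℂ] Uu2 q) :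
    tensorAct σ (fun k => c • X k) i t = c • tensorAct σ X i t := by
  induction t with
  | zero => simp
  | add y z hy hz => simp only [map_add, hy, hz, smul_add]
  | tmul a b => simp only [tensorAct_tmul, map_smul, Finset.smul_sum, smul_comm c]

/-- Invariance may be checked on the generators. -/
lemma isInvariant_of_generators {n : ℕ} {σ : Uu2 q →ₐ[ℂ] Matrix (Fin n) (Fin n) ℂ}
    {X : Fin n → U q} (hK : ∀ i, tensorAct σ X i (comulU2 q (K1 q)) = X i)
    (hE : ∀ i, tensorAct σ X i (comulU2 q (E1 q)) = 0)
    (hF : ∀ i, tensorAct σ X i (comulU2 q (F1 q)) = 0)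
    (hL : ∀ i, tensorAct σ X i (comulU2 q (K1K2sq q)) = X i) : IsInvariant σ X := by
  rw [isInvariant_iff]
  have hone : ∀ i, tensorAct σ X i 1 = X i := by
    intro i
    rw [Algebra.TensorProduct.one_def, tensorAct_tmul]
    simp [Matrix.one_apply, radjHom, radj_one]
  let T : Subalgebra ℂ (Uu2 q) :=
    { carrier := {h | ∀ i, tensorAct σ X i (comulU2 q h)
        = Coalgebra.counit (R := ℂ) (h : U q) • X i}
      mul_mem' := fun {x y} hx hy => by
        simp only [Set.mem_ofPred_eq] at hx hy ⊢
        intro i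
        simp only [map_mul, tensorAct_mul, hy, tensorAct_smul, hx, smul_smul, MulMemClass.coe_mul,
          Bialgebra.counit_mul, mul_comm]
      add_mem' := fun {x y} hx hy => by
        simp only [Set.mem_ofPred_eq] at hx hy ⊢
        simp [hx, hy, add_smul]
      algebraMap_mem' := fun c => by
        simp only [Set.mem_ofPred_eq]
        intro i
        have : ((algebraMap ℂ (Uu2 q) c : Uu2 q) : U q) = algebraMap ℂ (U q) c := rfl
        rw [this, Bialgebra.counit_algebraMap, AlgHom.commutes, Algebra.algebraMap_eq_smul_one,
          map_smul, hone] }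
  -- The inverse of `h` acts by the inverse map, and its counit is the inverse of the counit of `h`.
  have hinv : ∀ x y : Uu2 q, x * y = 1 → y * x = 1 → x ∈ T → y ∈ T := by
    intro x y hxy hyx hx i
    have hx' : ∀ i, tensorAct σ X i (comulU2 q x) = Coalgebra.counit (R := ℂ) (x : U q) • X i := hx
    have e1 : Coalgebra.counit (R := ℂ) (y : U q) * Coalgebra.counit (R := ℂ) (x : U q) = 1 := by
      rw [← Bialgebra.counit_mul, ← MulMemClass.coe_mul, hyx, OneMemClass.coe_one,
        Bialgebra.counit_one]
    have e2 := tensorAct_mul σ X i (comulU2 q y) (comulU2 q x)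
    rw [← map_mul, hyx, map_one, hone] at e2
    simp only [hx', tensorAct_smul] at e2
    rw [e2, smul_smul, e1, one_smul]
  refine fun h => mem_of_generators T hinv ?_ ?_ ?_ ?_ h <;> intro i
  · simp [hK, coe_K1]
  · simp [hE, coe_E1]
  · simp [hF, coe_F1]
  · simp [hL, coe_K1K2sq]

lemma radjHom_apply (x h : U q) : radjHom h x = radj x h := rfl

/-- Rewriting rules that move the `K`'s to the left and collect them by index. -/
lemma K_order (q : Param) :
    (∀ i, K q i * Kinv q i = 1) ∧ (∀ i, Kinv q i * K q i = 1) ∧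
    K q 1 * K q 0 = K q 0 * K q 1 ∧ Kinv q 1 * K q 0 = K q 0 * Kinv q 1 ∧
    K q 1 * Kinv q 0 = Kinv q 0 * K q 1 ∧ Kinv q 1 * Kinv q 0 = Kinv q 0 * Kinv q 1 := by
  have h := isURep_U q
  exact ⟨h.kl, h.lk, h.kk 1 0, h.lkc 1 0, (h.lkc 0 1).symm, h.ll 1 0⟩

/-- Rewriting rules that move the `K`'s past the `E`'s and `F`'s. -/
lemma K_past (q : Param) :
    (∀ i, E q i * K q i = (qc q)⁻¹ • (K q i * E q i)) ∧
    (∀ i j, i ≠ j → E q j * K q i = qh q • (K q i * E q j)) ∧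
    (∀ i, E q i * Kinv q i = qc q • (Kinv q i * E q i)) ∧
    (∀ i j, i ≠ j → E q j * Kinv q i = (qh q)⁻¹ • (Kinv q i * E q j)) ∧
    (∀ i, F q i * K q i = qc q • (K q i * F q i)) ∧
    (∀ i j, i ≠ j → F q j * K q i = (qh q)⁻¹ • (K q i * F q j)) ∧
    (∀ i, F q i * Kinv q i = (qc q)⁻¹ • (Kinv q i * F q i)) ∧
    (∀ i j, i ≠ j → F q j * Kinv q i = qh q • (Kinv q i * F q j)) := by
  have h := isURep_U q
  exact ⟨h.ek, fun _ _ => h.ek_ne, h.el, fun _ _ => h.el_ne, h.fk, fun _ _ => h.fk_ne, h.fl,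
    fun _ _ => h.fl_ne⟩

/-- The rules of `K_order` inside a product. -/
lemma K_order_assoc (x : U q) :
    (∀ i, K q i * (Kinv q i * x) = x) ∧ (∀ i, Kinv q i * (K q i * x) = x) ∧
    K q 1 * (K q 0 * x) = K q 0 * (K q 1 * x) ∧ Kinv q 1 * (K q 0 * x) = K q 0 * (Kinv q 1 * x) ∧
    K q 1 * (Kinv q 0 * x) = Kinv q 0 * (K q 1 * x) ∧
    Kinv q 1 * (Kinv q 0 * x) = Kinv q 0 * (Kinv q 1 * x) := by
  simp only [← mul_assoc, K_order, one_mul, implies_true, and_self]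

/-- The rules of `K_past` inside a product. -/
lemma K_past_assoc (x : U q) :
    (∀ i, E q i * (K q i * x) = (qc q)⁻¹ • (K q i * (E q i * x))) ∧
    (∀ i j, i ≠ j → E q j * (K q i * x) = qh q • (K q i * (E q j * x))) ∧
    (∀ i, E q i * (Kinv q i * x) = qc q • (Kinv q i * (E q i * x))) ∧
    (∀ i j, i ≠ j → E q j * (Kinv q i * x) = (qh q)⁻¹ • (Kinv q i * (E q j * x))) ∧
    (∀ i, F q i * (K q i * x) = qc q • (K q i * (F q i * x))) ∧
    (∀ i j, i ≠ j → F q j * (K q i * x) = (qh q)⁻¹ • (K q i * (F q j * x))) ∧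
    (∀ i, F q i * (Kinv q i * x) = (qc q)⁻¹ • (Kinv q i * (F q i * x))) ∧
    (∀ i j, i ≠ j → F q j * (Kinv q i * x) = qh q • (Kinv q i * (F q j * x))) := by
  obtain ⟨h1, h2, h3, h4, h5, h6, h7, h8⟩ := K_past q
  refine ⟨fun i => ?_, fun i j h => ?_, fun i => ?_, fun i j h => ?_, fun i => ?_, fun i j h => ?_,
    fun i => ?_, fun i j h => ?_⟩ <;> rw [← mul_assoc]
  · rw [h1, smul_mul_assoc, mul_assoc]
  · rw [h2 i j h, smul_mul_assoc, mul_assoc]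
  · rw [h3, smul_mul_assoc, mul_assoc]
  · rw [h4 i j h, smul_mul_assoc, mul_assoc]
  · rw [h5, smul_mul_assoc, mul_assoc]
  · rw [h6 i j h, smul_mul_assoc, mul_assoc]
  · rw [h7, smul_mul_assoc, mul_assoc]
  · rw [h8 i j h, smul_mul_assoc, mul_assoc]

/-- Rewriting rules that move the `F`'s to the left of the `E`'s. -/
lemma E_past_F (q : Param) :
    (∀ i, E q i * F q i = F q i * E q i
      + (qc q - (qc q)⁻¹)⁻¹ • (K q i * K q i - Kinv q i * Kinv q i)) ∧
    (∀ i j, i ≠ j → E q i * F q j = F q j * E q i) ∧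
    (∀ i x, E q i * (F q i * x) = F q i * (E q i * x)
      + (qc q - (qc q)⁻¹)⁻¹ • (K q i * (K q i * x) - Kinv q i * (Kinv q i * x))) ∧
    (∀ i j x, i ≠ j → E q i * (F q j * x) = F q j * (E q i * x)) := by
  have h := isURep_U q
  have h1 : ∀ i, E q i * F q i = F q i * E q i
      + (qc q - (qc q)⁻¹)⁻¹ • (K q i * K q i - Kinv q i * Kinv q i) := by
    intro i
    rw [← pow_two, ← pow_two, ← h.ef i]
    abel
  refine ⟨h1, h.ef_ne, fun i x => ?_, fun i j x hij => ?_⟩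
  · rw [← mul_assoc, h1, add_mul, smul_mul_assoc, sub_mul]
    simp only [mul_assoc]
  · rw [← mul_assoc, h.ef_ne i j hij, mul_assoc]

/-- The `q`-Serre relations as rewriting rules. -/
lemma serre_words (q : Param) :
    E q 0 * (E q 0 * E q 1) = (qc q + (qc q)⁻¹) • (E q 0 * (E q 1 * E q 0))
      - E q 1 * (E q 0 * E q 0) ∧
    F q 0 * (F q 0 * F q 1) = (qc q + (qc q)⁻¹) • (F q 0 * (F q 1 * F q 0))
      - F q 1 * (F q 0 * F q 0) := by
  have h := isURep_U q
  have h1 := h.serre_e 0 1 (by decide)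
  have h2 := h.serre_f 0 1 (by decide)
  simp only [pow_two, mul_assoc] at h1 h2
  constructor
  · rw [← sub_eq_zero, ← h1]; abel
  · rw [← sub_eq_zero, ← h2]; abel

lemma qh_pow_four_sub_ne (q : Param) : qh q ^ 4 - 1 ≠ 0 := by
  have hh := qh_ne q
  intro h
  apply qc_sub_ne q
  rw [qc_eq]
  field_simp
  linear_combination h

/-- On each generator, reordering with the `K`'s to the left and the `F`'s before the `E`'s reduces the
claim to an identity between scalars; `E_1` needs the `q`-Serre relation. -/
lemma isInvariant_X : IsInvariant (sigma10 q) (X q) := by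
  have hh := qh_ne q
  have hs : qh q ^ 4 - 1 ≠ 0 := qh_pow_four_sub_ne q
  obtain ⟨s1, s2, s3, s4⟩ := sigma10_values q
  apply isInvariant_of_generators <;> rw [Fin.forall_fin_two] <;>
    simp only [comulU2_K1, comulU2_E1, comulU2_F1, comulU2_K1K2sq, map_add, tensorAct_tmul, s1, s2,
      s3, s4, Fin.sum_univ_two, radjHom_apply, coe_K1, coe_E1, coe_F1, coe_K1K2sq,
      Sinv_mul, pow_two, Sinv_K, Sinv_Kinv, Sinv_E, Sinv_F, radj_mul, radj_K, radj_Kinv, radj_E,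
      radj_F, map_neg, map_smul, X, qcomm] <;>
    refine ⟨?_, ?_⟩ <;>
    simp [mul_assoc, mul_add, mul_sub, sub_mul, add_mul, K_order_assoc, K_past, K_past_assoc,
      E_past_F, serre_words, smul_smul]
  all_goals simp only [qc_eq]; match_scalars <;> field_simp <;> ring

/-- The same reordering as for `X`; here it is `F_1` that needs the `q`-Serre relation. -/
lemma isInvariant_Y : IsInvariant (sigma01 q) (Y q) := by
  have hh := qh_ne q
  have hs : qh q ^ 4 - 1 ≠ 0 := qh_pow_four_sub_ne q
  obtain ⟨s1, s2, s3, s4⟩ := sigma01_values q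
  apply isInvariant_of_generators <;> rw [Fin.forall_fin_two] <;>
    simp only [comulU2_K1, comulU2_E1, comulU2_F1, comulU2_K1K2sq, map_add, tensorAct_tmul, s1, s2,
      s3, s4, Fin.sum_univ_two, radjHom_apply, coe_K1, coe_E1, coe_F1, coe_K1K2sq,
      Sinv_mul, pow_two, Sinv_K, Sinv_Kinv, Sinv_E, Sinv_F, radj_mul, radj_K, radj_Kinv, radj_E,
      radj_F, map_neg, map_smul, Y, qcomm] <;>
    refine ⟨?_, ?_⟩ <;>
    simp [mul_assoc, mul_add, mul_sub, sub_mul, add_mul, K_order_assoc, K_past, K_past_assoc,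
      E_past_F, serre_words, smul_smul]
  all_goals try simp only [qc_eq]
  all_goals match_scalars <;> field_simp <;> ring

end

end QuantumCP2

/-- The elements `X` and `Y` are invariant; the maps `∂` and `∂̄` are derivations from `A(CP²_q)` to
the `(1,0)`-forms and the `(0,1)`-forms; `d = ∂ + ∂̄` satisfies `A(CP²_q) d A(CP²_q) = Ω¹` and
`d a^* = -(d a)^*`. -/
theorem mainTheorem11 (q : QuantumCP2.Param) :
    QuantumCP2.IsInvariant (QuantumCP2.sigma10 q) (QuantumCP2.X q) ∧
    QuantumCP2.IsInvariant (QuantumCP2.sigma01 q) (QuantumCP2.Y q) ∧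
    (∀ a ∈ QuantumCP2.CP2 q, QuantumCP2.del q a ∈ QuantumCP2.Omega10 q) ∧
    (∀ a ∈ QuantumCP2.CP2 q, QuantumCP2.delbar q a ∈ QuantumCP2.Omega01 q) ∧
    (∀ a ∈ QuantumCP2.CP2 q, ∀ b ∈ QuantumCP2.CP2 q, ∀ k : Fin 2,
      QuantumCP2.del q (a * b) k = QuantumCP2.del q a k * b + a * QuantumCP2.del q b k) ∧
    (∀ a ∈ QuantumCP2.CP2 q, ∀ b ∈ QuantumCP2.CP2 q, ∀ k : Fin 2,
      QuantumCP2.delbar q (a * b) k = QuantumCP2.delbar q a k * b + a * QuantumCP2.delbar q b k) ∧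
    Submodule.span ℂ {ω : (Fin 2 → QuantumCP2.A q) × (Fin 2 → QuantumCP2.A q) |
      ∃ a ∈ QuantumCP2.CP2 q, ∃ b ∈ QuantumCP2.CP2 q, ω = a • QuantumCP2.extd q b}
        = QuantumCP2.Omega1 q ∧
    ∀ a ∈ QuantumCP2.CP2 q, star a ∈ QuantumCP2.CP2 q ∧
      QuantumCP2.extd q (star a) = -QuantumCP2.starForm (QuantumCP2.extd q a) := by
  refine ⟨QuantumCP2.isInvariant_X, QuantumCP2.isInvariant_Y, fun a ha => QuantumCP2.del_mem ha,
    fun a ha => QuantumCP2.delbar_mem ha,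
    fun a ha b hb k => QuantumCP2.del_mul ((QuantumCP2.mem_CP2_iff a).1 ha)
      ((QuantumCP2.mem_CP2_iff b).1 hb) k,
    fun a ha b hb k => QuantumCP2.delbar_mul ((QuantumCP2.mem_CP2_iff a).1 ha)
      ((QuantumCP2.mem_CP2_iff b).1 hb) k,
    QuantumCP2.spanAdB_eq,
    fun a ha => ⟨QuantumCP2.star_mem_CP2 ha, QuantumCP2.extd_star ha⟩⟩
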